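/- **Setting.** An *open polyhedron* in $\mathbb R^3$ is a nonempty connected set that is the interior of a finite union of convex hulls of finite sets (it need not be convex); an *open polygon* is a nonempty connected set spanning a plane that is the relative interior (in that plane) of such a union. Let $\Omega\subset\mathbb R^3$ be an open polyhedron and let $(\Gamma_i)_{i\in I}$ be a finite family of simply connected open polygons contained in $\Omega$ which may only intersect at their boundaries. Put $\overline\Gamma=\bigcup_i\overline\Gamma_i$, and assume that the boundary of each connected component of $\Omega\setminus\overline\Gamma$ contains a portion of $\partial\Omega$ of nonzero area. Let $(\mathcal M,\mathcal F,\mathcal E,\mathcal V)$ be a polytopal mesh of $\Omega$: finite sets of open polyhedral cells, open polygonal planar faces, open straight edges, and vertices, pairwise disjoint, such that $\overline\Omega$ is the union of the closed cells, the boundary of each cell (resp. face) is the union of the closed faces (resp. edges) it contains, the endpoints of the edges are vertices, each face either lies in $\Omega$ and in the boundary of two distinct cells or lies in $\partial\Omega$ and in the boundary of a cell, each edge lies in the boundary of a face and each vertex is an endpoint of an edge. Write $\mathcal F_K,\mathcal E_K,\mathcal V_K,\mathcal E_\sigma,\mathcal V_e$ for the entities in the boundary of $K$, $\sigma$, $e$;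 $h_K$ for the diameter of $K$; $\mathbf n_{K\sigma}$ for the unit normal to $\sigma$ outward from $K$; and $\mathbf n_{\sigma e}$ for the unit normal to $e$, in the plane of $\sigma$, outward from $\sigma$. Let $\mathcal F_\Gamma$ be the set of faces contained in $\overline\Gamma\cap\Omega$ and assume that the mesh is compliant with the network: $\overline\Gamma=\bigcup_{\sigma\in\mathcal F_\Gamma}\overline\sigma$. For each $\sigma\in\mathcal F_\Gamma$ one of the two cells adjacent to $\sigma$ is chosen as the positive side $K$ and the other one as the negative side $L$; $\mathbf n^+=\mathbf n_{K\sigma}$. Let $E,\nu,\mu_1,\mu_2$ be real numbers with $0<\mu_1\le\frac{E}{1+\nu}\le\mu_2$ and $-1<\nu<\frac12$, let $\mathbf f\in L^2(\Omega)^3$, and let $g\ge 0$ be constant on each $\sigma\in\mathcal F_\Gamma$. **Discrete spaces.** $X_h$ is the space of families $\underline{\mathbf v}=\big((\mathbf v_{\mathcal Ks})_{K\in\mathcal M,s\in\mathcal V_K},(\mathbf v_{\mathcal Ke})_{K\in\mathcal M,e\in\mathcal E_K},(\mathbf v_{\mathcal K\sigma})_{K\in\mathcal M,\sigma\in\mathcal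 F_K},(\mathbf v_K)_{K\in\mathcal M}\big)$ of vectors of $\mathbb R^3$ such that, for $z\in\mathcal V\cup\mathcal E\cup\mathcal F$, $\mathbf v_{\mathcal Kz}=\mathbf v_{\mathcal Lz}$ whenever $K,L$ have $z$ in their boundary and lie on the same side of $\Gamma$ around $z$. Here $K,L$ are on the same side if $z\not\subset\overline\Gamma$, or if they are joined by a finite chain of cells in which consecutive cells share a face outside $\mathcal F_\Gamma$ whose closure contains $z$. $X_{h,0}\subset X_h$ is the subspace where the components attached to vertices, edges and faces on $\partial\Omega$ vanish. $\mathbf M_h$ is the space of vector fields $\boldsymbol\lambda$ on $\Gamma$ that are constant on each $\sigma\in\mathcal F_\Gamma$, with $\lambda_{\mathbf n}=\boldsymbol\lambda\cdot\mathbf n^+$, $\boldsymbol\lambda_\tau=\boldsymbol\lambda-\lambda_{\mathbf n}\mathbf n^+$, and the discrete dual cone is $\mathcal C_{f,h}=\{\boldsymbol\lambda\in\mathbf M_h:\lambda_{\mathbf n}\ge0,\ |\boldsymbol\lambda_\tau|\le g\}$. **Reconstructions.** $\mathbb P^k(X)$ denotes the polynomials of degree $\le k$ on $X$, $\overline{\mathbf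 x}_X$ the barycenter of $X$, and divergences of matrices are taken row-wise (tangentially on faces). For $\underline{\mathbf v}\in X_h$: $\Upsilon_{Ke}\underline{\mathbf v}\in\mathbb P^2(e)^3$ has the value $\mathbf v_{\mathcal Ks}$ at each $s\in\mathcal V_e$ and the mean value $\mathbf v_{\mathcal Ke}$ on $e$; $\mathbb G_{K\sigma}\underline{\mathbf v}\in\mathbb P^1(\sigma)^{3\times3}$ and $\Upsilon_{K\sigma}\underline{\mathbf v}\in\mathbb P^2(\sigma)^3$ satisfy, for all $\boldsymbol\xi\in\mathbb P^1(\sigma)^{3\times3}$ and all $\boldsymbol\eta$ whose rows are in $(\mathbf x-\overline{\mathbf x}_\sigma)\mathbb P^2(\sigma)$, $$\int_\sigma\mathbb G_{K\sigma}\underline{\mathbf v}:\boldsymbol\xi=-\int_\sigma\mathbf v_{\mathcal K\sigma}\cdot\operatorname{div}\boldsymbol\xi+\sum_{e\in\mathcal E_\sigma}\int_e\Upsilon_{Ke}\underline{\mathbf v}\cdot\boldsymbol\xi\mathbf n_{\sigma e},\qquad \int_\sigma\Upsilon_{K\sigma}\underline{\mathbf v}\cdot\operatorname{div}\boldsymbol\eta=-\int_\sigma\mathbb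 G_{K\sigma}\underline{\mathbf v}:\boldsymbol\eta+\sum_{e\in\mathcal E_\sigma}\int_e\Upsilon_{Ke}\underline{\mathbf v}\cdot\boldsymbol\eta\mathbf n_{\sigma e};$$ $\mathbb G_K\underline{\mathbf v}\in\mathbb P^1(K)^{3\times3}$ and $\Upsilon_K\underline{\mathbf v}\in\mathbb P^2(K)^3$ satisfy, for all $\boldsymbol\xi\in\mathbb P^1(K)^{3\times3}$ and all $\boldsymbol\eta$ whose rows are in $(\mathbf x-\overline{\mathbf x}_K)\mathbb P^2(K)$, $$\int_K\mathbb G_K\underline{\mathbf v}:\boldsymbol\xi=-\int_K\mathbf v_K\cdot\operatorname{div}\boldsymbol\xi+\sum_{\sigma\in\mathcal F_K}\int_\sigma\Upsilon_{K\sigma}\underline{\mathbf v}\cdot\boldsymbol\xi\mathbf n_{K\sigma},\qquad \int_K\Upsilon_K\underline{\mathbf v}\cdot\operatorname{div}\boldsymbol\eta=-\int_K\mathbb G_K\underline{\mathbf v}:\boldsymbol\eta+\sum_{\sigma\in\mathcal F_K}\int_\sigma\Upsilon_{K\sigma}\underline{\mathbf v}\cdot\boldsymbol\eta\mathbf n_{K\sigma}.$$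 On $\sigma\in\mathcal F_\Gamma$ with positive side $K$ and negative side $L$, $[\![\underline{\mathbf v}]\!]_h=\Upsilon_{K\sigma}\underline{\mathbf v}-\Upsilon_{L\sigma}\underline{\mathbf v}$. On each cell $K$, $\boldsymbol\epsilon_h(\underline{\mathbf v})=\frac12(\mathbb G_K\underline{\mathbf v}+(\mathbb G_K\underline{\mathbf v})^T)$ and $\boldsymbol\sigma_h(\underline{\mathbf v})=\frac{E}{1+\nu}\big(\boldsymbol\epsilon_h(\underline{\mathbf v})+\frac{\nu}{1-2\nu}\operatorname{tr}(\boldsymbol\epsilon_h(\underline{\mathbf v}))\mathrm I_3\big)$. The stabilisation is $\mathbb S_h=\sum_{K\in\mathcal M}\mathbb S_K$ with $$\mathbb S_K(\underline{\mathbf u},\underline{\mathbf v})=h_K^{-1}\sum_{\sigma\in\mathcal F_K}\int_\sigma(\Upsilon_K\underline{\mathbf u}-\Upsilon_{K\sigma}\underline{\mathbf u})\cdot(\Upsilon_K\underline{\mathbf v}-\Upsilon_{K\sigma}\underline{\mathbf v})+\sum_{e\in\mathcal E_K}\int_e(\Upsilon_K\underline{\mathbf u}-\Upsilon_{Ke}\underline{\mathbf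 u})\cdot(\Upsilon_K\underline{\mathbf v}-\Upsilon_{Ke}\underline{\mathbf v})+h_K\sum_{s\in\mathcal V_K}(\Upsilon_K\underline{\mathbf u}(\mathbf x_s)-\mathbf u_{\mathcal Ks})\cdot(\Upsilon_K\underline{\mathbf v}(\mathbf x_s)-\mathbf v_{\mathcal Ks}).$$ **Proposition (existence and uniqueness).** There exists a unique $(\underline{\mathbf u}_h,\boldsymbol\lambda_h)\in X_{h,0}\times\mathcal C_{f,h}$ such that, for all $(\underline{\mathbf v}_h,\boldsymbol\mu_h)\in X_{h,0}\times\mathcal C_{f,h}$, $$\int_\Omega\boldsymbol\sigma_h(\underline{\mathbf u}_h):\boldsymbol\epsilon_h(\underline{\mathbf v}_h)+\mu_1\mathbb S_h(\underline{\mathbf u}_h,\underline{\mathbf v}_h)+\int_\Gamma\boldsymbol\lambda_h\cdot[\![\underline{\mathbf v}_h]\!]_h=\sum_{K\in\mathcal M}\int_K\mathbf f\cdot\mathbf v_K,\qquad \int_\Gamma(\boldsymbol\mu_h-\boldsymbol\lambda_h)\cdot[\![\underline{\mathbf u}_h]\!]_h\le0.$$ -/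

import Mathlib

open scoped Topology MeasureTheory
open MeasureTheory

noncomputable section

namespace DDR

/-! ### Polyhedral geometry in `ℝ³` -/

/-- `ℝ³` with its Euclidean norm. -/
abbrev R3 : Type := EuclideanSpace ℝ (Fin 3)

/-- An open polyhedron: a (nonempty) connected set which is the interior of a finite union of
convex hulls of finite sets. It is automatically bounded; it need not be convex. -/
def IsPolyhedron (X : Set R3) : Prop :=
  IsConnected X ∧
    ∃ T : Finset (Finset R3), X = interior (⋃ t ∈ T, convexHull ℝ (t : Set R3))

/-- An open planar polygon: a (nonempty) connected set, spanning a plane, which is the relative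
interior of a finite union of convex hulls of finite sets. -/
def IsPolygon (X : Set R3) : Prop :=
  IsConnected X ∧ Module.finrank ℝ (vectorSpan ℝ X) = 2 ∧
    ∃ T : Finset (Finset R3), X = intrinsicInterior ℝ (⋃ t ∈ T, convexHull ℝ (t : Set R3))

/-- The (relative) boundary of a (relatively) open polyhedron, polygon or segment. -/
def bdry (X : Set R3) : Set R3 := closure X \ X

/-- `n` is the unit vector, tangent to `X` and normal to the flat piece `Y` of the boundary of `X`,
which points out of `X` along `Y`. -/
def IsOutwardNormal (X Y : Set R3) (n : R3) : Prop :=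
  n ∈ vectorSpan ℝ X ∧ ‖n‖ = 1 ∧ (∀ w ∈ vectorSpan ℝ Y, inner ℝ n w = 0) ∧
    ∀ y ∈ Y, ∀ᶠ t in 𝓝[>] (0 : ℝ), y - t • n ∈ X ∧ y + t • n ∉ X

/-- The unit normal to `Y` pointing out of `X`: `n_{Kσ}` for `X = K` a cell and `Y = σ` a face of
it, `n_{σe}` (in the plane of the face) for `X = σ` a face and `Y = e` an edge of it. -/
def outwardNormal (X Y : Set R3) : R3 := Classical.epsilon (IsOutwardNormal X Y)

/-! ### Fracture network -/

/-- A fracture network in `Ω`: a family of flat fractures, each of which is an open simply connected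
polygon inside `Ω`, that may only intersect at their boundaries. -/
structure IsFractureNetwork {ι : Type*} (Ω : Set R3) (Γ : ι → Set R3) : Prop where
  polygon : ∀ i, IsPolygon (Γ i)
  simplyConnected : ∀ i, SimplyConnectedSpace (Γ i)
  subset : ∀ i, Γ i ⊆ Ω
  inter : ∀ i j, i ≠ j → closure (Γ i) ∩ closure (Γ j) ⊆ bdry (Γ i) ∩ bdry (Γ j)

/-- The closed set occupied by the network. -/
def network {ι : Type*} (Γ : ι → Set R3) : Set R3 := ⋃ i, closure (Γ i)

/-- `G` does not disconnect any part of `Ω` from `∂Ω`: the boundary of each connected component of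
`Ω \ G` contains a portion of `∂Ω` of nonzero area. -/
def NotDisconnecting (Ω G : Set R3) : Prop :=
  ∀ x ∈ Ω \ G, 0 < μHE[2] (frontier (connectedComponentIn (Ω \ G) x) ∩ frontier Ω)

/-! ### Polytopal meshes -/

/-- A (conforming) polytopal mesh of `Ω`: finitely many open polyhedral cells, open polygonal planar
faces, open straight edges, and vertices, all pairwise disjoint, such that the cells cover `Ω`, the
boundary of each cell is covered by its faces, the boundary of each face by its edges, and
the endpoints of the edges are vertices. -/
structure PolyMesh (Ω : Set R3) where
  cells : Finset (Set R3)
  faces : Finset (Set R3)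
  edges : Finset (Set R3)
  vertices : Finset R3
  isPolyhedron_cell : ∀ K ∈ cells, IsPolyhedron K
  isPolygon_face : ∀ σ ∈ faces, IsPolygon σ
  isSegment_edge : ∀ e ∈ edges, ∃ a ∈ vertices, ∃ b ∈ vertices, a ≠ b ∧ e = openSegment ℝ a b
  disjoint_cells : ∀ K ∈ cells, ∀ L ∈ cells, K ≠ L → Disjoint K L
  disjoint_faces : ∀ σ ∈ faces, ∀ τ ∈ faces, σ ≠ τ → Disjoint σ τ
  disjoint_edges : ∀ e ∈ edges, ∀ d ∈ edges, e ≠ d → Disjoint e d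
  disjoint_face_edge : ∀ σ ∈ faces, ∀ e ∈ edges, Disjoint σ e
  vertex_notMem_face : ∀ s ∈ vertices, ∀ σ ∈ faces, s ∉ σ
  vertex_notMem_edge : ∀ s ∈ vertices, ∀ e ∈ edges, s ∉ e
  closure_domain : closure Ω = ⋃ K ∈ cells, closure K
  bdry_cell : ∀ K ∈ cells, bdry K = ⋃ σ ∈ faces, ⋃ _ : σ ⊆ bdry K, closure σ
  bdry_face : ∀ σ ∈ faces, bdry σ = ⋃ e ∈ edges, ⋃ _ : e ⊆ bdry σ, closure e
  /-- A face is either an interface between two cells or a boundary face. -/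
  face_cases : ∀ σ ∈ faces,
    (σ ⊆ Ω ∧ ∃ K ∈ cells, ∃ L ∈ cells, K ≠ L ∧ σ ⊆ bdry K ∧ σ ⊆ bdry L) ∨
      (σ ⊆ frontier Ω ∧ ∃ K ∈ cells, σ ⊆ bdry K)
  edge_cases : ∀ e ∈ edges, ∃ σ ∈ faces, e ⊆ bdry σ
  vertex_cases : ∀ s ∈ vertices, ∃ e ∈ edges, s ∈ bdry e

namespace PolyMesh

variable {Ω : Set R3} (M : PolyMesh Ω) (G : Set R3)

/-- Faces in the boundary of `X`. -/
abbrev facesOf (X : Set R3) : Type := {σ : M.faces // (σ : Set R3) ⊆ bdry X}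

/-- Edges in the boundary of `X`. -/
abbrev edgesOf (X : Set R3) : Type := {e : M.edges // (e : Set R3) ⊆ bdry X}

/-- Vertices in the boundary of `X`. -/
abbrev vertsOf (X : Set R3) : Type := {s : M.vertices // (s : R3) ∈ bdry X}

instance (X : Set R3) : Fintype (M.facesOf X) := Fintype.ofFinite _

instance (X : Set R3) : Fintype (M.edgesOf X) := Fintype.ofFinite _

instance (X : Set R3) : Fintype (M.vertsOf X) := Fintype.ofFinite _

theorem bdry_subset_of_subset {K Y : Set R3} (hK : IsOpen K) (h : Y ⊆ bdry K) :
    bdry Y ⊆ bdry K := by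
  have hc : IsClosed (bdry K) := by
    have : bdry K = closure K ∩ Kᶜ := rfl
    rw [this]
    exact isClosed_closure.inter hK.isClosed_compl
  exact fun x hx => closure_minimal h hc hx.1

theorem isOpen_cell (K : M.cells) : IsOpen (K : Set R3) := by
  obtain ⟨-, T, hT⟩ := M.isPolyhedron_cell K.1 K.2
  rw [hT]
  exact isOpen_interior

/-- An edge of a face of `K`, as an edge of `K`. -/
def edgeOfFace {K : M.cells} {σ : M.facesOf K} (e : M.edgesOf σ.1) : M.edgesOf K :=
  ⟨e.1, fun _ hx => bdry_subset_of_subset (M.isOpen_cell K) σ.2 (e.2 hx)⟩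

/-- A vertex of an edge of `K`, as a vertex of `K`. -/
def vertOfEdge {K : M.cells} {e : M.edgesOf K} (s : M.vertsOf e.1) : M.vertsOf K :=
  ⟨s.1, bdry_subset_of_subset (M.isOpen_cell K) e.2 s.2⟩

/-- Fracture faces: the faces of the trace of the mesh on the network `G`. -/
def IsFracture (σ : M.faces) : Prop := (σ : Set R3) ⊆ G ∩ Ω

/-- The set `F_Γ` of fracture faces. -/
abbrev fracFaces : Type := {σ : M.faces // M.IsFracture G σ}

instance : Fintype (M.fracFaces G) := Fintype.ofFinite _

/-- The mesh is compliant with the network `G`: `G` is the union of the closed fracture faces. -/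
def Compliant : Prop := G = ⋃ σ : M.fracFaces G, closure (σ.1 : Set R3)

/-- The cells `K` and `L` share a face which touches the entity `z` and is not a fracture face. -/
def Linked (z : Set R3) (K L : M.cells) : Prop :=
  ∃ σ : M.faces, ¬ M.IsFracture G σ ∧ z ⊆ closure (σ : Set R3) ∧
    (σ : Set R3) ⊆ bdry K ∧ (σ : Set R3) ⊆ bdry L

/-- For cells `K` and `L` that have the mesh entity `z` (a vertex, an edge or a face) in their
boundary: `K` and `L` lie on the same side of `G` around `z`, that is, one can go from `K` to `L`
around `z` without crossing a fracture face. There is only one side if `z` is not on `G`. -/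
def SameSide (z : Set R3) (K L : M.cells) : Prop :=
  ¬ z ⊆ G ∨ Relation.EqvGen (M.Linked G z) K L

/-- Choice of the positive and of the negative side of each fracture face (in particular, the choice
can be made fracture by fracture). -/
structure Sides where
  plus : M.fracFaces G → M.cells
  minus : M.fracFaces G → M.cells
  plus_ne_minus : ∀ σ, plus σ ≠ minus σ
  mem_plus : ∀ σ, (σ.1 : Set R3) ⊆ bdry (plus σ)
  mem_minus : ∀ σ, (σ.1 : Set R3) ⊆ bdry (minus σ)

/-! ### Discrete spaces -/

/-- Families `((v_{Ks})_{s ∈ V_K}, (v_{Ke})_{e ∈ E_K}, (v_{Kσ})_{σ ∈ F_K}, v_K)_K` of vectors. -/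
abbrev Dofs : Type :=
  ((K : M.cells) → M.vertsOf K → R3) × ((K : M.cells) → M.edgesOf K → R3) ×
    ((K : M.cells) → M.facesOf K → R3) × (M.cells → R3)

variable {M}

/-- Vertex component `v_{Ks}`. -/
def Dofs.vert (v : M.Dofs) (K : M.cells) (s : M.vertsOf K) : R3 := v.1 K s

/-- Edge component `v_{Ke}`. -/
def Dofs.edge (v : M.Dofs) (K : M.cells) (e : M.edgesOf K) : R3 := v.2.1 K e

/-- Face component `v_{Kσ}`. -/
def Dofs.face (v : M.Dofs) (K : M.cells) (σ : M.facesOf K) : R3 := v.2.2.1 K σ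

/-- Cell component `v_K`. -/
def Dofs.cell (v : M.Dofs) (K : M.cells) : R3 := v.2.2.2 K

variable (M)

/-- The discrete displacement space: the components at a vertex, edge or face are the same for
all the cells on the same side of the network. -/
def dispSpace : Submodule ℝ M.Dofs where
  carrier := {v |
    (∀ (K L : M.cells) (s : M.vertices) (hK : (s : R3) ∈ bdry K) (hL : (s : R3) ∈ bdry L),
      M.SameSide G {(s : R3)} K L → Dofs.vert v K ⟨s, hK⟩ = Dofs.vert v L ⟨s, hL⟩) ∧
    (∀ (K L : M.cells) (e : M.edges) (hK : (e : Set R3) ⊆ bdry K) (hL : (e : Set R3) ⊆ bdry L),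
      M.SameSide G e K L → Dofs.edge v K ⟨e, hK⟩ = Dofs.edge v L ⟨e, hL⟩) ∧
    (∀ (K L : M.cells) (σ : M.faces) (hK : (σ : Set R3) ⊆ bdry K) (hL : (σ : Set R3) ⊆ bdry L),
      M.SameSide G σ K L → Dofs.face v K ⟨σ, hK⟩ = Dofs.face v L ⟨σ, hL⟩)}
  zero_mem' := ⟨fun _ _ _ _ _ _ => rfl, fun _ _ _ _ _ _ => rfl, fun _ _ _ _ _ _ => rfl⟩
  add_mem' hv hw :=
    ⟨fun K L s hK hL h => congrArg₂ (· + ·) (hv.1 K L s hK hL h) (hw.1 K L s hK hL h),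
      fun K L e hK hL h => congrArg₂ (· + ·) (hv.2.1 K L e hK hL h) (hw.2.1 K L e hK hL h),
      fun K L σ hK hL h => congrArg₂ (· + ·) (hv.2.2 K L σ hK hL h) (hw.2.2 K L σ hK hL h)⟩
  smul_mem' c _ hv :=
    ⟨fun K L s hK hL h => congrArg (c • ·) (hv.1 K L s hK hL h),
      fun K L e hK hL h => congrArg (c • ·) (hv.2.1 K L e hK hL h),
      fun K L σ hK hL h => congrArg (c • ·) (hv.2.2 K L σ hK hL h)⟩

/-- Families whose components at the vertices, edges and faces on `∂Ω` vanish. -/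
def zeroTrace : Submodule ℝ M.Dofs where
  carrier := {v |
    (∀ (K : M.cells) (s : M.vertsOf K), (s.1 : R3) ∈ frontier Ω → Dofs.vert v K s = 0) ∧
    (∀ (K : M.cells) (e : M.edgesOf K), (e.1 : Set R3) ⊆ frontier Ω → Dofs.edge v K e = 0) ∧
    (∀ (K : M.cells) (σ : M.facesOf K), (σ.1 : Set R3) ⊆ frontier Ω → Dofs.face v K σ = 0)}
  zero_mem' := ⟨fun _ _ _ => rfl, fun _ _ _ => rfl, fun _ _ _ => rfl⟩
  add_mem' hv hw :=
    ⟨fun K s h => (congrArg₂ (· + ·) (hv.1 K s h) (hw.1 K s h)).trans (add_zero 0),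
      fun K e h => (congrArg₂ (· + ·) (hv.2.1 K e h) (hw.2.1 K e h)).trans (add_zero 0),
      fun K σ h => (congrArg₂ (· + ·) (hv.2.2 K σ h) (hw.2.2 K σ h)).trans (add_zero 0)⟩
  smul_mem' c _ hv :=
    ⟨fun K s h => (congrArg (c • ·) (hv.1 K s h)).trans (smul_zero c),
      fun K e h => (congrArg (c • ·) (hv.2.1 K e h)).trans (smul_zero c),
      fun K σ h => (congrArg (c • ·) (hv.2.2 K σ h)).trans (smul_zero c)⟩

/-- The discrete displacement space with homogeneous Dirichlet boundary conditions. -/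
def dispSpaceZero : Submodule ℝ M.Dofs := M.dispSpace G ⊓ M.zeroTrace

/-- The multiplier space: piecewise constant vector fields on the network, given by their values on
the fracture faces. -/
abbrev multSpace : Type := M.fracFaces G → R3

end PolyMesh

/-! ### Polynomials -/

/-- Vector-valued polynomials on `ℝ³`; those on a face or an edge are their restrictions. -/
abbrev PolyVec : Type := Fin 3 → MvPolynomial (Fin 3) ℝ

/-- Matrix-valued polynomials on `ℝ³`. -/
abbrev PolyMat : Type := Fin 3 → Fin 3 → MvPolynomial (Fin 3) ℝ

/-- Value at `x` of a vector-valued polynomial. -/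
def PolyVec.at (p : PolyVec) (x : R3) : R3 :=
  WithLp.toLp 2 fun i => MvPolynomial.eval x.ofLp (p i)

/-- Value at `x` of a matrix-valued polynomial. -/
def PolyMat.at (ξ : PolyMat) (x : R3) : Matrix (Fin 3) (Fin 3) ℝ :=
  Matrix.of fun i j => MvPolynomial.eval x.ofLp (ξ i j)

/-- Total degree at most `k`. -/
def PolyVec.DegLE (k : ℕ) (p : PolyVec) : Prop := ∀ i, (p i).totalDegree ≤ k

/-- Total degree at most `k`. -/
def PolyMat.DegLE (k : ℕ) (ξ : PolyMat) : Prop := ∀ i j, (ξ i j).totalDegree ≤ k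

/-- The row-wise divergence along `X`: for `X` a face it is the surface divergence (only
the derivatives tangent to `X` enter), and for `X` a cell it is the usual divergence, since
the projection onto `vectorSpan ℝ X = ℝ³` is the identity. -/
def PolyMat.div (X : Set R3) (ξ : PolyMat) : PolyVec := fun i =>
  ∑ j, ∑ l,
    MvPolynomial.C ((vectorSpan ℝ X).starProjection (EuclideanSpace.single l (1 : ℝ)) j) *
      MvPolynomial.pderiv l (ξ i j)

/-- The matrix field with rows `q_i(x) (x - c)`, an element of `Z³` for `q` quadratic. -/
def PolyVec.cone (c : R3) (q : PolyVec) : PolyMat := fun i j =>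
  (MvPolynomial.X j - MvPolynomial.C (c j)) * q i

/-- The dot product of vectors. -/
def dot (a b : R3) : ℝ := ∑ i, a i * b i

/-- The product `A : B` of matrices. -/
def ddot (A B : Matrix (Fin 3) (Fin 3) ℝ) : ℝ := ∑ i, ∑ j, A i j * B i j

/-- The product `A n` of a matrix and a vector. -/
def mulVec (A : Matrix (Fin 3) (Fin 3) ℝ) (n : R3) : R3 := WithLp.toLp 2 (A.mulVec n.ofLp)

/-! ### Reconstructions -/

/-- Affine gradient on `X` (a face with `d = 2`, a cell with `d = 3`), from the value `w` on `X` and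
the boundary terms `b ξ`: `∫_X G : ξ = -∫_X w · div ξ + b ξ` for all affine `ξ`. -/
def gradRec (d : ℕ) (X : Set R3) (w : R3) (b : PolyMat → ℝ) : PolyMat :=
  Classical.epsilon fun H : PolyMat => H.DegLE 1 ∧ ∀ ξ : PolyMat, ξ.DegLE 1 →
    ∫ x in X, ddot (H.at x) (ξ.at x) ∂μHE[d] = -∫ x in X, dot w ((ξ.div X).at x) ∂μHE[d] + b ξ

/-- Quadratic displacement on `X`, from the gradient `H` on `X` and the boundary terms `b η`:
`∫_X p · div η = -∫_X H : η + b η` for all `η = (x - x_X) q`, `q` quadratic, `x_X` the barycenter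
of `X`. -/
def potRec (d : ℕ) (X : Set R3) (H : PolyMat) (b : PolyMat → ℝ) : PolyVec :=
  Classical.epsilon fun p : PolyVec => p.DegLE 2 ∧ ∀ q : PolyVec, q.DegLE 2 →
    let η : PolyMat := q.cone (⨍ x in X, x ∂μHE[d])
    ∫ x in X, dot (p.at x) ((η.div X).at x) ∂μHE[d] =
      -∫ x in X, ddot (H.at x) (η.at x) ∂μHE[d] + b η

namespace PolyMesh

variable {Ω : Set R3} {M : PolyMesh Ω} {G : Set R3}

/-- Quadratic displacement on the edge `e` of `K`: it has the value `v_{Ks}` at the endpoints `s`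
of `e`, and the mean value `v_{Ke}` on `e`. -/
def edgeRec (v : M.Dofs) (K : M.cells) (e : M.edgesOf K) : PolyVec :=
  Classical.epsilon fun p : PolyVec => p.DegLE 2 ∧
    (∀ s : M.vertsOf e.1, p.at s.1 = Dofs.vert v K (M.vertOfEdge s)) ∧
    ⨍ x in (e.1 : Set R3), p.at x ∂μHE[1] = Dofs.edge v K e

/-- `∑_{e ∈ E_σ} ∫_e Υ_{Ke} v · ξ n_{σe}`. -/
def faceBdryTerm (v : M.Dofs) (K : M.cells) (σ : M.facesOf K) (ξ : PolyMat) : ℝ :=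
  ∑ e : M.edgesOf σ.1, ∫ x in (e.1 : Set R3),
    dot ((edgeRec v K (M.edgeOfFace e)).at x) (mulVec (ξ.at x) (outwardNormal σ.1 e.1)) ∂μHE[1]

/-- The face gradient `G_{Kσ} v`. -/
def faceGrad (v : M.Dofs) (K : M.cells) (σ : M.facesOf K) : PolyMat :=
  gradRec 2 σ.1 (Dofs.face v K σ) (faceBdryTerm v K σ)

/-- The face displacement `Υ_{Kσ} v`. -/
def faceRec (v : M.Dofs) (K : M.cells) (σ : M.facesOf K) : PolyVec :=
  potRec 2 σ.1 (faceGrad v K σ) (faceBdryTerm v K σ)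

/-- `∑_{σ ∈ F_K} ∫_σ Υ_{Kσ} v · ξ n_{Kσ}`. -/
def cellBdryTerm (v : M.Dofs) (K : M.cells) (ξ : PolyMat) : ℝ :=
  ∑ σ : M.facesOf K, ∫ x in (σ.1 : Set R3),
    dot ((faceRec v K σ).at x) (mulVec (ξ.at x) (outwardNormal K σ.1)) ∂μHE[2]

/-- The cell gradient `G_K v`. -/
def cellGrad (v : M.Dofs) (K : M.cells) : PolyMat :=
  gradRec 3 K (Dofs.cell v K) (cellBdryTerm v K)

/-- The cell displacement `Υ_K v`. -/
def cellRec (v : M.Dofs) (K : M.cells) : PolyVec :=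
  potRec 3 K (cellGrad v K) (cellBdryTerm v K)

/-- The jump on a fracture face: the face displacement on the positive side minus the one on
the negative side. -/
def jump (S : M.Sides G) (v : M.Dofs) (σ : M.fracFaces G) (x : R3) : R3 :=
  (faceRec v (S.plus σ) ⟨σ.1, S.mem_plus σ⟩).at x -
    (faceRec v (S.minus σ) ⟨σ.1, S.mem_minus σ⟩).at x

/-! ### The scheme -/

/-- The discrete strain on the cell `K`. -/
def strain (v : M.Dofs) (K : M.cells) (x : R3) : Matrix (Fin 3) (Fin 3) ℝ :=
  (1 / 2 : ℝ) • ((cellGrad v K).at x + ((cellGrad v K).at x).transpose)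

/-- The discrete stress on the cell `K`, for the Young modulus `E` and the Poisson ratio `ν`. -/
def stress (E ν : ℝ) (v : M.Dofs) (K : M.cells) (x : R3) : Matrix (Fin 3) (Fin 3) ℝ :=
  (E / (1 + ν)) • (strain v K x +
    (ν / (1 - 2 * ν) * (strain v K x).trace) • (1 : Matrix (Fin 3) (Fin 3) ℝ))

/-- The local stabilisation bilinear form `S_K`. -/
def stabCell (u v : M.Dofs) (K : M.cells) : ℝ :=
  (Metric.diam (K : Set R3))⁻¹ * ∑ σ : M.facesOf K, ∫ x in (σ.1 : Set R3),
      dot ((cellRec u K).at x - (faceRec u K σ).at x)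
        ((cellRec v K).at x - (faceRec v K σ).at x) ∂μHE[2] +
    ∑ e : M.edgesOf K, ∫ x in (e.1 : Set R3),
      dot ((cellRec u K).at x - (edgeRec u K e).at x)
        ((cellRec v K).at x - (edgeRec v K e).at x) ∂μHE[1] +
    Metric.diam (K : Set R3) * ∑ s : M.vertsOf K,
      dot ((cellRec u K).at s.1 - Dofs.vert u K s) ((cellRec v K).at s.1 - Dofs.vert v K s)

/-- The stabilisation bilinear form `S_h`. -/
def stab (u v : M.Dofs) : ℝ := ∑ K : M.cells, stabCell u v K

/-- `∫_Ω σ_h(u) : ε_h(v)`. -/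
def elastic (E ν : ℝ) (u v : M.Dofs) : ℝ :=
  ∑ K : M.cells, ∫ x in (K : Set R3), ddot (stress E ν u K x) (strain v K x)

/-- `∫_Γ μ · ⟦v⟧_h`. -/
def contact (S : M.Sides G) (μ : M.multSpace G) (v : M.Dofs) : ℝ :=
  ∑ σ : M.fracFaces G, ∫ x in (σ.1 : Set R3), dot (μ σ) (jump S v σ x) ∂μHE[2]

/-- `∑_K ∫_K f · v_K`. -/
def load (f : R3 → R3) (v : M.Dofs) : ℝ :=
  ∑ K : M.cells, ∫ x in (K : Set R3), dot (f x) (Dofs.cell v K)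

/-- The unit normal `n⁺` on a fracture face, outward from the positive side. -/
def normalPlus (S : M.Sides G) (σ : M.fracFaces G) : R3 := outwardNormal (S.plus σ) σ.1

/-- Normal component of a multiplier. -/
def normalPart (S : M.Sides G) (μ : M.multSpace G) (σ : M.fracFaces G) : ℝ :=
  dot (μ σ) (normalPlus S σ)

/-- Tangential component of a multiplier. -/
def tangentPart (S : M.Sides G) (μ : M.multSpace G) (σ : M.fracFaces G) : R3 :=
  μ σ - normalPart S μ σ • normalPlus S σ

/-- The discrete dual cone, for the Tresca threshold with the value `g σ` on the face `σ`. -/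
def dualCone (S : M.Sides G) (g : M.fracFaces G → ℝ) : Set (M.multSpace G) :=
  {μ | ∀ σ, 0 ≤ normalPart S μ σ ∧ ‖tangentPart S μ σ‖ ≤ g σ}

/-- `(u, l)` is a solution of the discrete mixed scheme. -/
def IsSolution (S : M.Sides G) (E ν μ₁ : ℝ) (f : R3 → R3) (g : M.fracFaces G → ℝ)
    (u : M.dispSpaceZero G) (l : dualCone S g) : Prop :=
  (∀ v : M.dispSpaceZero G,
    elastic E ν (u : M.Dofs) v + μ₁ * stab (u : M.Dofs) v + contact S l (v : M.Dofs) =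
      load f (v : M.Dofs)) ∧
  ∀ m : dualCone S g, contact S (fun σ => m.1 σ - l.1 σ) (u : M.Dofs) ≤ 0

end PolyMesh

end DDR

end

/-!
The scheme is a saddle point problem on finite-dimensional spaces, with the symmetric form
`a(u, v) = elastic(u, v) + μ₁ stab(u, v)` on the displacements and the contact form `b` as
coupling. If `a` is positive definite and no nonzero multiplier is annihilated by `b`, then `a` may be taken as
an inner product, the multipliers embed into the displacements by `a(T μ, v) = b(μ, v)`, and the
solution is given by the projection of the unconstrained displacement on the closed convex set of
the `T μ`, `μ` in the dual cone (`existsUnique_saddlePoint`).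

All the reconstructions are defined by linear equations, which have to be shown to be uniquely
solvable on the piece `X` at hand (`IsFlat.isGradRec_gradRec`, `IsFlat.isPotRec_potRec`,
`IsFlat.isPotRec_unique`, `exists_isEdgeRec`). The main point is that `q ↦ div ((x - c) q)` is
injective on polynomials over `X`, hence bijective on the quadratic ones. Consequently the forms
are linear in the components, and the mean of each displacement is the corresponding component
(`IsFlat.integral_dot_potRec`).

Positive definiteness (`elastic_add_stab_pos`). If `a(v, v) = 0`, the cell displacements agree
with the face displacements on the faces. By the divergence theorem on a cell
(`integral_pderiv_cell`, proved by Fubini's theorem along the lines parallel to an axis) the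
discrete gradient is then the gradient of the cell displacement, and since the strain vanishes,
the cell displacement is a rigid motion. Two cells that share a face outside the network have the
same face displacement on it, and a rigid motion that vanishes on a piece of a plane is zero, so
these cells have the same rigid motion; in a cell with a face on `∂Ω` it is zero. Every cell can
be joined to such a cell without crossing the network (`exists_boundary_face`): cells are joined
by paths with a generic corner, which avoid the edges, and the boundary of each component of the
complement of the network contains a piece of `∂Ω` of positive area, which cannot be covered by
edges.

Injectivity of the coupling (`eq_zero_of_contact`). The two cells at a fracture face are never on
the same side of the network around that face, so the component at the face can be prescribed on
the positive side alone. As the contact form only sees the face components (`contact_eq_sum`),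
this displacement tests the multiplier on that face.
-/

open scoped Topology MeasureTheory
open MeasureTheory

noncomputable section

namespace DDR

/-! ### Flat pieces of space and their measures -/

/-- A flat piece of dimension `d` in `ℝ³`: a nonempty bounded set whose affine span has dimension
`d` and which is relatively open in its affine span. Cells (`d = 3`), faces (`d = 2`) and edges
(`d = 1`) of a mesh are such pieces. -/
structure IsFlat (d : ℕ) (X : Set R3) : Prop where
  nonempty : X.Nonempty
  isBounded : Bornology.IsBounded X
  finrank_vectorSpan : Module.finrank ℝ (vectorSpan ℝ X) = d
  exists_isOpen : ∃ O : Set R3, IsOpen O ∧ X = O ∩ affineSpan ℝ X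

namespace IsFlat

variable {d : ℕ} {X : Set R3}

theorem measurableSet (h : IsFlat d X) : MeasurableSet X := by
  obtain ⟨O, hO, hX⟩ := h.exists_isOpen
  rw [hX]
  exact hO.measurableSet.inter (AffineSubspace.closed_of_finiteDimensional _).measurableSet

/-- On the affine span of a flat piece `X`, the measure `μHE[d]` is the Lebesgue measure of the
direction of `X`. -/
theorem measure_inter_affineSpan (h : IsFlat d X) {x₀ : R3} (hx₀ : x₀ ∈ X) (A : Set R3) :
    μHE[d] (A ∩ affineSpan ℝ X) =
      volume ((fun w : vectorSpan ℝ X => (w : R3) + x₀) ⁻¹' A) := by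
  have hj : Isometry (fun w : vectorSpan ℝ X => (w : R3) + x₀) :=
    (isometry_add_right x₀).comp isometry_subtype_coe
  have hr : Set.range (fun w : vectorSpan ℝ X => (w : R3) + x₀) = affineSpan ℝ X := by
    ext y
    constructor
    · rintro ⟨w, rfl⟩
      have := (affineSpan ℝ X).vadd_mem_of_mem_direction
        (by rw [direction_affineSpan]; exact w.2) (mem_affineSpan ℝ hx₀)
      simpa using this
    · intro hy
      have := AffineSubspace.vsub_mem_direction hy (mem_affineSpan ℝ hx₀)
      rw [direction_affineSpan] at this
      exact ⟨⟨_, this⟩, by simp⟩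
  rw [← hr, ← hj.euclideanHausdorffMeasure_preimage, ← h.finrank_vectorSpan,
    InnerProductSpace.euclideanHausdorffMeasure_eq_volume]

theorem measure_inter_affineSpan_lt_top (h : IsFlat d X) {A : Set R3}
    (hA : Bornology.IsBounded A) : μHE[d] (A ∩ affineSpan ℝ X) < ⊤ := by
  obtain ⟨x₀, hx₀⟩ := h.nonempty
  rw [h.measure_inter_affineSpan hx₀]
  have hj : Isometry (fun w : vectorSpan ℝ X => (w : R3) + x₀) :=
    (isometry_add_right x₀).comp isometry_subtype_coe
  exact (hj.antilipschitz.isBounded_preimage hA).measure_lt_top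

theorem measure_lt_top (h : IsFlat d X) : μHE[d] X < ⊤ := by
  have := h.measure_inter_affineSpan_lt_top h.isBounded
  rwa [Set.inter_eq_left.2 (subset_affineSpan ℝ X)] at this

theorem measure_closure_lt_top (h : IsFlat d X) : μHE[d] (closure X) < ⊤ := by
  have := h.measure_inter_affineSpan_lt_top h.isBounded.closure
  rwa [Set.inter_eq_left.2 (closure_minimal (subset_affineSpan ℝ X)
    (AffineSubspace.closed_of_finiteDimensional _))] at this

theorem measure_inter_pos (h : IsFlat d X) {U : Set R3} (hU : IsOpen U) {x : R3} (hxU : x ∈ U)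
    (hx : x ∈ X) : 0 < μHE[d] (U ∩ X) := by
  obtain ⟨O, hO, hX⟩ := h.exists_isOpen
  have : U ∩ X = (U ∩ O) ∩ affineSpan ℝ X := by rw [Set.inter_assoc, ← hX]
  rw [this, h.measure_inter_affineSpan hx]
  have hj : Isometry (fun w : vectorSpan ℝ X => (w : R3) + x) :=
    (isometry_add_right x).comp isometry_subtype_coe
  refine ((hU.inter hO).preimage hj.continuous).measure_pos _ ⟨0, ?_⟩
  rw [hX] at hx
  simpa using ⟨hxU, hx.1⟩

theorem measure_pos (h : IsFlat d X) : 0 < μHE[d] X := by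
  obtain ⟨x, hx⟩ := h.nonempty
  simpa using h.measure_inter_pos isOpen_univ (Set.mem_univ x) hx

theorem measureReal_pos (h : IsFlat d X) : 0 < (μHE[d] : Measure R3).real X :=
  ENNReal.toReal_pos h.measure_pos.ne' h.measure_lt_top.ne

theorem isFiniteMeasure_restrict (h : IsFlat d X) :
    IsFiniteMeasure ((μHE[d] : Measure R3).restrict X) :=
  ⟨by simpa using h.measure_lt_top⟩

theorem integrableOn {F : Type*} [NormedAddCommGroup F] (h : IsFlat d X)
    {f : R3 → F} (hf : Continuous f) : IntegrableOn f X μHE[d] := by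
  have hc : IsCompact (closure X) := h.isBounded.isCompact_closure
  obtain ⟨C, hC⟩ := hc.exists_bound_of_continuousOn hf.continuousOn
  have := h.isFiniteMeasure_restrict
  exact Integrable.of_bound hf.aestronglyMeasurable C
    ((ae_restrict_iff' h.measurableSet).2 (.of_forall fun x hx => hC x (subset_closure hx)))

/-- A nonnegative continuous function with zero integral vanishes, since the relatively open sets of
a flat piece have positive measure. -/
theorem eqOn_zero_of_integral_eq_zero (h : IsFlat d X) {f : R3 → ℝ} (hf : Continuous f)
    (h0 : ∀ x, 0 ≤ f x) (hi : ∫ x in X, f x ∂μHE[d] = 0) : ∀ x ∈ X, f x = 0 := by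
  intro x hx
  by_contra hne
  have hpos : 0 < f x := lt_of_le_of_ne (h0 x) (Ne.symm hne)
  have hae := (integral_eq_zero_iff_of_nonneg h0 (h.integrableOn hf)).1 hi
  have hU : IsOpen {y | 0 < f y} := isOpen_lt continuous_const hf
  have h1 := h.measure_inter_pos hU hpos hx
  have h2 : (μHE[d] : Measure R3).restrict X {y | 0 < f y} = 0 :=
    measure_mono_null (fun y (hy : 0 < f y) => by simpa using hy.ne') (ae_iff.1 hae)
  rw [Measure.restrict_apply hU.measurableSet] at h2
  exact h1.ne' h2

theorem average_mem_affineSpan (h : IsFlat d X) : ⨍ x in X, x ∂μHE[d] ∈ affineSpan ℝ X := by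
  have := h.isFiniteMeasure_restrict
  have : NeZero ((μHE[d] : Measure R3).restrict X) :=
    ⟨by simpa [Measure.restrict_eq_zero] using h.measure_pos.ne'⟩
  refine Convex.average_mem (AffineSubspace.convex _)
    (AffineSubspace.closed_of_finiteDimensional _)
    ((ae_restrict_iff' h.measurableSet).2 (.of_forall fun x hx => mem_affineSpan ℝ hx))
    (h.integrableOn continuous_id)

/-- Moving a little from a point of a flat piece along a tangent direction does not leave it. -/
theorem eventually_add_smul_mem (h : IsFlat d X) {x w : R3} (hx : x ∈ X)
    (hw : w ∈ vectorSpan ℝ X) : ∀ᶠ t in 𝓝 (0 : ℝ), x + t • w ∈ X := by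
  obtain ⟨O, hO, hX⟩ := h.exists_isOpen
  have hc : Continuous fun t : ℝ => x + t • w := by fun_prop
  have hxO : x + (0 : ℝ) • w ∈ O := by
    rw [hX] at hx; simpa using hx.1
  filter_upwards [hc.continuousAt.preimage_mem_nhds (hO.mem_nhds hxO)] with t ht
  rw [hX]
  refine ⟨ht, ?_⟩
  have := (affineSpan ℝ X).vadd_mem_of_mem_direction
        (by rw [direction_affineSpan]; exact (vectorSpan ℝ X).smul_mem t hw) (mem_affineSpan ℝ hx)
  simpa [add_comm] using this

end IsFlat

theorem affineSpan_inter_isOpen {A : AffineSubspace ℝ R3} {O : Set R3} (hO : IsOpen O)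
    (hne : (O ∩ A).Nonempty) : affineSpan ℝ (O ∩ A) = A := by
  obtain ⟨x, hxO, hxA⟩ := hne
  refine le_antisymm (affineSpan_le.2 Set.inter_subset_right) fun y hy => ?_
  have hc : Continuous fun t : ℝ => AffineMap.lineMap x y t := AffineMap.lineMap_continuous
  have hev : ∀ᶠ t in 𝓝[≠] (0 : ℝ), AffineMap.lineMap x y t ∈ O :=
    Filter.Eventually.filter_mono nhdsWithin_le_nhds
      (hc.continuousAt.eventually (by simpa using hO.mem_nhds hxO))
  obtain ⟨t, htO, ht⟩ := (hev.and self_mem_nhdsWithin).exists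
  have hz : AffineMap.lineMap x y t ∈ affineSpan ℝ (O ∩ A) :=
    mem_affineSpan ℝ ⟨htO, AffineMap.lineMap_mem t hxA hy⟩
  have hx' : x ∈ affineSpan ℝ (O ∩ (A : Set R3)) := mem_affineSpan ℝ ⟨hxO, hxA⟩
  have := AffineMap.lineMap_mem t⁻¹ hx' hz
  have ht' : t ≠ 0 := ht
  simpa [AffineMap.lineMap_apply, smul_smul, inv_mul_cancel₀ ht'] using this

theorem isCompact_biUnion_convexHull (T : Finset (Finset R3)) :
    IsCompact (⋃ t ∈ T, convexHull ℝ (t : Set R3)) :=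
  T.isCompact_biUnion fun t _ => t.finite_toSet.isCompact_convexHull ℝ

theorem IsPolyhedron.isFlat {X : Set R3} (h : IsPolyhedron X) : IsFlat 3 X := by
  obtain ⟨hc, T, hT⟩ := h
  have ho : IsOpen X := hT ▸ isOpen_interior
  have hs : affineSpan ℝ X = ⊤ := ho.affineSpan_eq_top hc.nonempty
  refine ⟨hc.nonempty, ?_, ?_, X, ho, by simp [hs]⟩
  · rw [hT]; exact (isCompact_biUnion_convexHull T).isBounded.subset interior_subset
  · rw [← direction_affineSpan, hs, AffineSubspace.direction_top, finrank_top,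
      finrank_euclideanSpace_fin]

theorem IsPolygon.isFlat {X : Set R3} (h : IsPolygon X) : IsFlat 2 X := by
  obtain ⟨hc, hr, T, hT⟩ := h
  set C := ⋃ t ∈ T, convexHull ℝ (t : Set R3) with hC
  have key : ∃ O : Set R3, IsOpen O ∧ X = O ∩ affineSpan ℝ C := by
    have ho : IsOpen (interior ((↑) ⁻¹' C : Set (affineSpan ℝ C))) := isOpen_interior
    obtain ⟨O, hO, hOe⟩ := isOpen_induced_iff.1 ho
    refine ⟨O, hO, ?_⟩
    rw [hT, intrinsicInterior, ← hOe, Set.inter_comm]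
    exact Subtype.image_preimage_coe _ _
  refine ⟨hc.nonempty, ?_, hr, ?_⟩
  · rw [hT]; exact (isCompact_biUnion_convexHull T).isBounded.subset intrinsicInterior_subset
  · obtain ⟨O, hO, hX⟩ := key
    refine ⟨O, hO, ?_⟩
    have : affineSpan ℝ X = affineSpan ℝ C := by
      conv_lhs => rw [hX]
      exact affineSpan_inter_isOpen hO (hX ▸ hc.nonempty)
    rw [this]; exact hX

theorem isFlat_openSegment {a b : R3} (hab : a ≠ b) : IsFlat 1 (openSegment ℝ a b) := by
  have hsub : b - a ≠ 0 := sub_ne_zero.2 hab.symm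
  have hn : 0 < ‖b - a‖ ^ 2 := by positivity
  have hspan : (affineSpan ℝ {a, b} : Set R3) = Set.range fun t : ℝ => a + t • (b - a) := by
    ext x
    rw [SetLike.mem_coe, mem_affineSpan_pair_iff_exists_lineMap_eq]
    simp [AffineMap.lineMap_apply, add_comm a]
  have key : openSegment ℝ a b =
      {x | 0 < inner ℝ (b - a) (x - a) ∧ inner ℝ (b - a) (x - a) < ‖b - a‖ ^ 2} ∩
        affineSpan ℝ {a, b} := by
    rw [openSegment_eq_image', hspan]
    ext x
    constructor
    · rintro ⟨t, ht, rfl⟩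
      refine ⟨?_, t, rfl⟩
      simp only [Set.mem_ofPred_eq, add_sub_cancel_left, inner_smul_right,
        real_inner_self_eq_norm_sq]
      exact ⟨mul_pos ht.1 hn, by nlinarith [ht.2]⟩
    · rintro ⟨hx, t, rfl⟩
      simp only [Set.mem_ofPred_eq, add_sub_cancel_left, inner_smul_right,
        real_inner_self_eq_norm_sq] at hx
      exact ⟨t, ⟨by nlinarith [hx.1], by nlinarith [hx.2]⟩, rfl⟩
  have hO : IsOpen {x : R3 | 0 < inner ℝ (b - a) (x - a) ∧
      inner ℝ (b - a) (x - a) < ‖b - a‖ ^ 2} :=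
    isOpen_Ioo.preimage (f := fun x : R3 => inner ℝ (b - a) (x - a)) (by fun_prop)
  have hne : (openSegment ℝ a b).Nonempty :=
    ⟨midpoint ℝ a b, midpoint_mem_openSegment a b⟩
  have haff : affineSpan ℝ (openSegment ℝ a b) = affineSpan ℝ {a, b} := by
    conv_lhs => rw [key]
    exact affineSpan_inter_isOpen hO (key ▸ hne)
  refine ⟨hne, ?_, ?_, _, hO, by rw [haff]; exact key⟩
  · exact ((Set.toFinite {a, b}).isCompact_convexHull ℝ).isBounded.subset
      ((openSegment_subset_segment ℝ a b).trans (convexHull_pair a b).ge)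
  · rw [← direction_affineSpan, haff, direction_affineSpan, vectorSpan_pair_rev]
    exact finrank_span_singleton hsub

/-! ### Polynomials on flat pieces -/

theorem continuous_eval (p : MvPolynomial (Fin 3) ℝ) :
    Continuous fun x : R3 => MvPolynomial.eval x.ofLp p :=
  (MvPolynomial.continuous_eval p).comp (PiLp.continuous_ofLp 2 _)

/-- The derivative of a polynomial in the direction `w`. -/
def dirDeriv (w : R3) (p : MvPolynomial (Fin 3) ℝ) : MvPolynomial (Fin 3) ℝ :=
  ∑ l, MvPolynomial.C (w l) * MvPolynomial.pderiv l p

theorem dirDeriv_mul (w : R3) (p q : MvPolynomial (Fin 3) ℝ) :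
    dirDeriv w (p * q) = dirDeriv w p * q + p * dirDeriv w q := by
  simp only [dirDeriv, MvPolynomial.pderiv_mul, Finset.sum_mul, Finset.mul_sum,
    ← Finset.sum_add_distrib]
  exact Finset.sum_congr rfl fun l _ => by ring

theorem dirDeriv_add (w : R3) (p q : MvPolynomial (Fin 3) ℝ) :
    dirDeriv w (p + q) = dirDeriv w p + dirDeriv w q := by
  simp only [dirDeriv, map_add, mul_add, Finset.sum_add_distrib]

theorem dirDeriv_sum {α : Type*} (s : Finset α) (w : α → R3) (p : MvPolynomial (Fin 3) ℝ) :
    dirDeriv (∑ a ∈ s, w a) p = ∑ a ∈ s, dirDeriv (w a) p := by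
  simp only [dirDeriv, WithLp.ofLp_sum, Finset.sum_apply, map_sum, Finset.sum_mul]
  rw [Finset.sum_comm]

theorem dirDeriv_smul_left (c : ℝ) (w : R3) (p : MvPolynomial (Fin 3) ℝ) :
    dirDeriv (c • w) p = MvPolynomial.C c * dirDeriv w p := by
  simp [dirDeriv, Finset.mul_sum, mul_assoc]

theorem dirDeriv_X (w : R3) (j : Fin 3) :
    dirDeriv w (MvPolynomial.X j) = MvPolynomial.C (w j) := by
  simp [dirDeriv, MvPolynomial.pderiv_X, Pi.single_apply]

theorem dirDeriv_C (w : R3) (a : ℝ) : dirDeriv w (MvPolynomial.C a) = 0 := by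
  simp [dirDeriv]

theorem hasDerivAt_eval_line (p : MvPolynomial (Fin 3) ℝ) (x w : R3) (t : ℝ) :
    HasDerivAt (fun t : ℝ => MvPolynomial.eval (x + t • w).ofLp p)
      (MvPolynomial.eval (x + t • w).ofLp (dirDeriv w p)) t := by
  induction p using MvPolynomial.induction_on with
  | C a => simpa [dirDeriv_C] using hasDerivAt_const t a
  | add p q hp hq =>
    simp only [dirDeriv_add, map_add]
    exact hp.add hq
  | mul_X p j hp =>
    have hX : HasDerivAt (fun t : ℝ => x j + t * w j) (w j) t := by
      simpa using ((hasDerivAt_id t).mul_const (w j)).const_add (x j)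
    have h : HasDerivAt (fun t : ℝ => MvPolynomial.eval (x + t • w).ofLp p * (x j + t * w j)) _ t :=
      hp.mul hX
    simp only [dirDeriv_mul, dirDeriv_X, map_add, map_mul, MvPolynomial.eval_X,
      MvPolynomial.eval_C]
    simpa using h

/-- Along a line, a polynomial of total degree at most `k` is a polynomial of degree at most `k`
in the parameter. -/
theorem exists_polynomial_eval_line (p : MvPolynomial (Fin 3) ℝ) (x w : R3) :
    ∃ q : Polynomial ℝ, q.natDegree ≤ p.totalDegree ∧
      ∀ t : ℝ, MvPolynomial.eval (x + t • w).ofLp p = q.eval t := by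
  refine ⟨MvPolynomial.aeval (fun i => Polynomial.C (x i) + Polynomial.C (w i) * Polynomial.X) p,
    ?_, fun t => ?_⟩
  · rw [MvPolynomial.aeval_def, MvPolynomial.eval₂_eq]
    refine Polynomial.natDegree_sum_le_of_forall_le _ _ fun m hm => ?_
    have hlin : ∀ i : Fin 3,
        (Polynomial.C (x i) + Polynomial.C (w i) * Polynomial.X : Polynomial ℝ).natDegree ≤ 1 :=
      fun i => by
        rw [add_comm]
        exact Polynomial.natDegree_linear_le
    calc _ ≤ 0 + ∑ i ∈ m.support, m i := by
          refine Polynomial.natDegree_mul_le_of_le (by simp) ?_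
          refine (Polynomial.natDegree_prod_le _ _).trans (Finset.sum_le_sum fun i _ => ?_)
          exact (Polynomial.natDegree_pow_le_of_le _ (hlin i)).trans (by simp)
      _ ≤ p.totalDegree := by
          rw [zero_add]; exact MvPolynomial.le_totalDegree hm
  · have : ((Polynomial.aeval t).toRingHom.comp (MvPolynomial.aeval
        (fun i => Polynomial.C (x i) + Polynomial.C (w i) * Polynomial.X)).toRingHom) =
        MvPolynomial.eval (x + t • w).ofLp := by
      refine MvPolynomial.ringHom_ext (fun r => ?_) fun i => ?_
      · simp
      · simp only [AlgHom.toRingHom_eq_coe, RingHom.coe_comp, RingHom.coe_coe,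
          Function.comp_apply, MvPolynomial.aeval_X, map_add, map_mul, Polynomial.aeval_C,
          Polynomial.aeval_X, MvPolynomial.eval_X, PiLp.add_apply, PiLp.smul_apply, smul_eq_mul,
          Algebra.algebraMap_self, RingHom.id_apply, mul_comm t]
    rw [← this]
    rfl

namespace IsFlat

variable {d : ℕ} {X : Set R3}

theorem eval_eq_zero_of_mem_affineSpan (h : IsFlat d X) {p : MvPolynomial (Fin 3) ℝ}
    (hp : ∀ x ∈ X, MvPolynomial.eval x.ofLp p = 0) {y : R3} (hy : y ∈ affineSpan ℝ X) :
    MvPolynomial.eval y.ofLp p = 0 := by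
  obtain ⟨x, hx⟩ := h.nonempty
  have hw : y - x ∈ vectorSpan ℝ X := by
    rw [← direction_affineSpan]
    exact AffineSubspace.vsub_mem_direction hy (mem_affineSpan ℝ hx)
  obtain ⟨q, -, hq⟩ := exists_polynomial_eval_line p x (y - x)
  have hev : ∀ᶠ t in 𝓝 (0 : ℝ), q.eval t = 0 :=
    (h.eventually_add_smul_mem hx hw).mono fun t ht => by rw [← hq, hp _ ht]
  have hq0 : q = 0 := by
    refine Polynomial.eq_zero_of_infinite_isRoot q ?_
    exact infinite_of_mem_nhds 0 hev
  have := hq 1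
  rw [hq0, one_smul, add_sub_cancel] at this
  simpa using this

theorem eval_dirDeriv_eq_zero (h : IsFlat d X) {p : MvPolynomial (Fin 3) ℝ}
    (hp : ∀ x ∈ X, MvPolynomial.eval x.ofLp p = 0) {w : R3} (hw : w ∈ vectorSpan ℝ X) :
    ∀ x ∈ X, MvPolynomial.eval x.ofLp (dirDeriv w p) = 0 := by
  intro x hx
  have h1 := hasDerivAt_eval_line p x w 0
  have h2 : (fun t : ℝ => MvPolynomial.eval (x + t • w).ofLp p) =ᶠ[𝓝 0] fun _ => 0 :=
    (h.eventually_add_smul_mem hx hw).mono fun t ht => hp _ ht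
  have h3 := h1.congr_of_eventuallyEq h2.symm
  simpa using h3.unique (hasDerivAt_const 0 0)

end IsFlat

/-- The projection of the `j`-th coordinate vector on the direction of `X`. -/
def tangentBasis (X : Set R3) (j : Fin 3) : R3 :=
  (vectorSpan ℝ X).starProjection (EuclideanSpace.single j (1 : ℝ))

theorem tangentBasis_mem (X : Set R3) (j : Fin 3) : tangentBasis X j ∈ vectorSpan ℝ X :=
  (vectorSpan ℝ X).starProjection_apply_mem _

theorem tangentBasis_comm (X : Set R3) (j l : Fin 3) : tangentBasis X j l = tangentBasis X l j := by
  have h := (vectorSpan ℝ X).inner_starProjection_left_eq_right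
    (EuclideanSpace.single j (1 : ℝ)) (EuclideanSpace.single l (1 : ℝ))
  rw [EuclideanSpace.inner_single_left, EuclideanSpace.inner_single_right] at h
  simpa [tangentBasis] using h

theorem sum_tangentBasis (X : Set R3) :
    ∑ j, tangentBasis X j j = Module.finrank ℝ (vectorSpan ℝ X) := by
  have hp : LinearMap.IsProj (vectorSpan ℝ X)
      ((vectorSpan ℝ X).starProjection : R3 →L[ℝ] R3).toLinearMap :=
    ⟨fun x => (vectorSpan ℝ X).starProjection_apply_mem x,
      fun x hx => Submodule.starProjection_eq_self_iff.2 hx⟩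
  rw [← hp.trace, LinearMap.trace_eq_matrix_trace ℝ (EuclideanSpace.basisFun (Fin 3) ℝ).toBasis,
    Matrix.trace]
  refine Finset.sum_congr rfl fun j _ => ?_
  simp [LinearMap.toMatrix_apply, tangentBasis]

theorem sum_smul_tangentBasis {X : Set R3} {w : R3} (hw : w ∈ vectorSpan ℝ X) :
    ∑ j, w j • tangentBasis X j = w := by
  have h1 : w = ∑ j, w j • EuclideanSpace.single j (1 : ℝ) := by
    ext i; simp [Pi.single_apply]
  conv_rhs => rw [← Submodule.starProjection_eq_self_iff.2 hw, h1]
  simp [map_sum, tangentBasis]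

theorem div_eq_sum_dirDeriv (X : Set R3) (ξ : PolyMat) (i : Fin 3) :
    ξ.div X i = ∑ j, dirDeriv (tangentBasis X j) (ξ i j) := by
  unfold PolyMat.div dirDeriv
  refine Finset.sum_congr rfl fun j _ => Finset.sum_congr rfl fun l _ => ?_
  rw [tangentBasis_comm]
  rfl

theorem div_add (X : Set R3) (ξ η : PolyMat) : (ξ + η).div X = ξ.div X + η.div X := by
  ext1 i
  simp only [PolyMat.div, Pi.add_apply, map_add, mul_add, Finset.sum_add_distrib]

theorem div_smul (X : Set R3) (c : ℝ) (ξ : PolyMat) : (c • ξ).div X = c • ξ.div X := by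
  ext1 i
  simp only [PolyMat.div, Pi.smul_apply, Derivation.map_smul, mul_smul_comm, Finset.smul_sum]

theorem PolyVec.at_add (p q : PolyVec) (x : R3) : PolyVec.at (p + q) x = p.at x + q.at x := by
  ext i; simp [PolyVec.at]

theorem PolyVec.at_smul (c : ℝ) (p : PolyVec) (x : R3) : PolyVec.at (c • p) x = c • p.at x := by
  ext i; simp [PolyVec.at, MvPolynomial.smul_eval]

theorem PolyMat.at_add (p q : PolyMat) (x : R3) : PolyMat.at (p + q) x = p.at x + q.at x := by
  ext i j; simp [PolyMat.at]

theorem PolyMat.at_smul (c : ℝ) (p : PolyMat) (x : R3) : PolyMat.at (c • p) x = c • p.at x := by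
  ext i j; simp [PolyMat.at, MvPolynomial.smul_eval]

theorem PolyVec.continuous_at (p : PolyVec) : Continuous fun x => p.at x :=
  (PiLp.continuous_toLp 2 _).comp (continuous_pi fun i => continuous_eval (p i))

theorem PolyMat.continuous_at (p : PolyMat) : Continuous fun x => p.at x :=
  continuous_matrix fun i j => continuous_eval (p i j)

theorem PolyVec.at_eq_zero_iff {p : PolyVec} {x : R3} :
    p.at x = 0 ↔ ∀ i, MvPolynomial.eval x.ofLp (p i) = 0 := by
  refine ⟨fun h i => congrArg (fun v : R3 => v i) h, fun h => ?_⟩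
  ext i; exact h i

theorem PolyMat.at_eq_zero_iff {p : PolyMat} {x : R3} :
    p.at x = 0 ↔ ∀ i j, MvPolynomial.eval x.ofLp (p i j) = 0 := by
  refine ⟨fun h i j => congrFun (congrFun h i) j, fun h => ?_⟩
  ext i j; exact h i j

theorem IsFlat.div_at_eq_zero {d : ℕ} {X : Set R3} (h : IsFlat d X) {ξ : PolyMat}
    (hξ : ∀ x ∈ X, ξ.at x = 0) : ∀ x ∈ X, (ξ.div X).at x = 0 := by
  intro x hx
  rw [PolyVec.at_eq_zero_iff]
  intro i
  rw [div_eq_sum_dirDeriv, map_sum]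
  exact Finset.sum_eq_zero fun j _ => h.eval_dirDeriv_eq_zero
    (fun y hy => PolyMat.at_eq_zero_iff.1 (hξ y hy) i j) (tangentBasis_mem X j) x hx

theorem cone_add (c : R3) (p q : PolyVec) : PolyVec.cone c (p + q) = p.cone c + q.cone c := by
  ext1 i; ext1 j; simp [PolyVec.cone, mul_add]

theorem cone_smul (c : R3) (a : ℝ) (p : PolyVec) : PolyVec.cone c (a • p) = a • p.cone c := by
  ext1 i; ext1 j; simp [PolyVec.cone]

theorem IsFlat.eval_div_cone {d : ℕ} {X : Set R3} (h : IsFlat d X) {c x : R3}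
    (hc : c ∈ affineSpan ℝ X) (hx : x ∈ affineSpan ℝ X) (q : PolyVec) (i : Fin 3) :
    MvPolynomial.eval x.ofLp ((q.cone c).div X i) =
      d * MvPolynomial.eval x.ofLp (q i) + MvPolynomial.eval x.ofLp (dirDeriv (x - c) (q i)) := by
  have hw : x - c ∈ vectorSpan ℝ X := by
    rw [← direction_affineSpan]
    exact AffineSubspace.vsub_mem_direction hx hc
  have hd : ∀ (w : R3) (j : Fin 3), dirDeriv w (MvPolynomial.X j - MvPolynomial.C (c j)) =
      MvPolynomial.C (w j) := fun w j => by
    rw [sub_eq_add_neg, ← MvPolynomial.C_neg, dirDeriv_add, dirDeriv_X, dirDeriv_C, add_zero]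
  rw [div_eq_sum_dirDeriv]
  simp only [PolyVec.cone, dirDeriv_mul, hd, map_sum, map_add, map_mul, MvPolynomial.eval_C,
    Finset.sum_add_distrib]
  rw [← Finset.sum_mul, sum_tangentBasis, h.finrank_vectorSpan]
  congr 1
  conv_rhs => rw [← sum_smul_tangentBasis hw, dirDeriv_sum]
  simp [dirDeriv_smul_left]

/-- The divergence is injective on the fields `(x - c) q`: along the ray from `c` to `x`, the
equation `div ((x - c) q) = 0` says that `t ^ d q (c + t (x - c))` is constant. -/
theorem IsFlat.at_eq_zero_of_div_cone {d : ℕ} (hd : d ≠ 0) {X : Set R3} (h : IsFlat d X) {c : R3}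
    (hc : c ∈ affineSpan ℝ X) {q : PolyVec} (hq : ∀ x ∈ X, ((q.cone c).div X).at x = 0) :
    ∀ x ∈ X, q.at x = 0 := by
  intro x hx
  rw [PolyVec.at_eq_zero_iff]
  intro i
  have hw : x - c ∈ vectorSpan ℝ X := by
    rw [← direction_affineSpan]
    exact AffineSubspace.vsub_mem_direction (mem_affineSpan ℝ hx) hc
  set f : ℝ → ℝ := fun t => MvPolynomial.eval (c + t • (x - c)).ofLp (q i) with hf
  have hder : ∀ t, HasDerivAt (fun t => t ^ d * f t) 0 t := fun t => by
    have hmem : c + t • (x - c) ∈ affineSpan ℝ X := by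
      have := (affineSpan ℝ X).vadd_mem_of_mem_direction
        (by rw [direction_affineSpan]; exact (vectorSpan ℝ X).smul_mem t hw) hc
      simpa [add_comm] using this
    have h0 := h.eval_eq_zero_of_mem_affineSpan
      (fun y hy => PolyVec.at_eq_zero_iff.1 (hq y hy) i) hmem
    rw [h.eval_div_cone hc hmem, add_sub_cancel_left, dirDeriv_smul_left, map_mul,
      MvPolynomial.eval_C] at h0
    have h1 := (hasDerivAt_pow d t).mul (hasDerivAt_eval_line (q i) c (x - c) t)
    refine h1.congr_deriv ?_
    obtain ⟨k, rfl⟩ := Nat.exists_eq_succ_of_ne_zero hd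
    simp only [Nat.succ_eq_add_one, Nat.add_sub_cancel, pow_succ] at h0 ⊢
    linear_combination t ^ k * h0
  have hconst := is_const_of_deriv_eq_zero (fun t => (hder t).differentiableAt)
    (fun t => (hder t).deriv) 1 0
  simpa [hf, hd] using hconst

/-! ### Products of vectors and matrices -/

theorem dot_add_left (a b c : R3) : dot (a + b) c = dot a c + dot b c := by
  simp [dot, add_mul, Finset.sum_add_distrib]

theorem dot_add_right (a b c : R3) : dot a (b + c) = dot a b + dot a c := by
  simp [dot, mul_add, Finset.sum_add_distrib]

theorem dot_smul_left (r : ℝ) (a b : R3) : dot (r • a) b = r * dot a b := by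
  simp [dot, Finset.mul_sum, mul_assoc]

theorem dot_smul_right (r : ℝ) (a b : R3) : dot a (r • b) = r * dot a b := by
  simp [dot, Finset.mul_sum, mul_left_comm]

theorem dot_comm (a b : R3) : dot a b = dot b a := by
  simp [dot, mul_comm]

theorem dot_self (a : R3) : dot a a = ‖a‖ ^ 2 := by
  rw [EuclideanSpace.norm_sq_eq]
  simp [dot, sq]

theorem dot_eq_inner (a b : R3) : dot a b = inner ℝ a b := by
  rw [dot_comm]
  simp [dot, PiLp.inner_apply]

theorem dot_zero_left (a : R3) : dot 0 a = 0 := by simp [dot]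

theorem dot_zero_right (a : R3) : dot a 0 = 0 := by simp [dot]

theorem dot_self_nonneg (a : R3) : 0 ≤ dot a a := by rw [dot_self]; positivity

theorem dot_self_eq_zero {a : R3} : dot a a = 0 ↔ a = 0 := by simp [dot_self]

theorem eq_zero_of_forall_dot {a : R3} (h : ∀ c, dot a c = 0) : a = 0 := dot_self_eq_zero.1 (h a)

theorem _root_.Continuous.dot {α : Type*} [TopologicalSpace α] {f g : α → R3} (hf : Continuous f)
    (hg : Continuous g) : Continuous fun x => dot (f x) (g x) := by
  simp only [dot_eq_inner]
  exact hf.inner hg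

theorem ddot_add_left (A B C : Matrix (Fin 3) (Fin 3) ℝ) :
    ddot (A + B) C = ddot A C + ddot B C := by
  simp [ddot, add_mul, Finset.sum_add_distrib]

theorem ddot_add_right (A B C : Matrix (Fin 3) (Fin 3) ℝ) :
    ddot A (B + C) = ddot A B + ddot A C := by
  simp [ddot, mul_add, Finset.sum_add_distrib]

theorem ddot_smul_left (r : ℝ) (A B : Matrix (Fin 3) (Fin 3) ℝ) :
    ddot (r • A) B = r * ddot A B := by
  simp [ddot, Finset.mul_sum, mul_assoc]

theorem ddot_smul_right (r : ℝ) (A B : Matrix (Fin 3) (Fin 3) ℝ) :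
    ddot A (r • B) = r * ddot A B := by
  simp [ddot, Finset.mul_sum, mul_left_comm]

theorem ddot_comm (A B : Matrix (Fin 3) (Fin 3) ℝ) : ddot A B = ddot B A := by
  simp [ddot, mul_comm]

theorem ddot_zero_right (A : Matrix (Fin 3) (Fin 3) ℝ) : ddot A 0 = 0 := by simp [ddot]

theorem ddot_self_nonneg (A : Matrix (Fin 3) (Fin 3) ℝ) : 0 ≤ ddot A A :=
  Finset.sum_nonneg fun _ _ => Finset.sum_nonneg fun _ _ => mul_self_nonneg _

theorem ddot_self_eq_zero {A : Matrix (Fin 3) (Fin 3) ℝ} : ddot A A = 0 ↔ A = 0 := by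
  refine ⟨fun h => ?_, fun h => by simp [h, ddot]⟩
  ext i j
  have h1 := (Finset.sum_eq_zero_iff_of_nonneg fun i _ =>
    Finset.sum_nonneg fun j _ => mul_self_nonneg (A i j)).1 h i (Finset.mem_univ i)
  have h2 := (Finset.sum_eq_zero_iff_of_nonneg fun j _ => mul_self_nonneg (A i j)).1 h1 j
    (Finset.mem_univ j)
  simpa using h2

theorem _root_.Continuous.ddot {α : Type*} [TopologicalSpace α]
    {f g : α → Matrix (Fin 3) (Fin 3) ℝ} (hf : Continuous f) (hg : Continuous g) :
    Continuous fun x => ddot (f x) (g x) :=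
  continuous_finsetSum _ fun i _ => continuous_finsetSum _ fun j _ =>
    (hf.matrix_elem i j).mul (hg.matrix_elem i j)

/-! ### Existence and uniqueness of the reconstructions -/

/-- Matrix-valued polynomials of total degree at most `k`. -/
def PolyMat.degLE (k : ℕ) : Submodule ℝ PolyMat where
  carrier := {ξ | ξ.DegLE k}
  zero_mem' := fun _ _ => by simp
  add_mem' hξ hη := fun i j => (MvPolynomial.totalDegree_add _ _).trans (max_le (hξ i j) (hη i j))
  smul_mem' _ _ hξ := fun i j => (MvPolynomial.totalDegree_smul_le _ _).trans (hξ i j)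

/-- Vector-valued polynomials of total degree at most `k`. -/
def PolyVec.degLE (k : ℕ) : Submodule ℝ PolyVec where
  carrier := {p | p.DegLE k}
  zero_mem' := fun _ => by simp
  add_mem' hp hq := fun i => (MvPolynomial.totalDegree_add _ _).trans (max_le (hp i) (hq i))
  smul_mem' _ _ hp := fun i => (MvPolynomial.totalDegree_smul_le _ _).trans (hp i)

instance (k : ℕ) : FiniteDimensional ℝ (PolyVec.degLE k) :=
  FiniteDimensional.of_injective (V₂ := Fin 3 → MvPolynomial.restrictTotalDegree (Fin 3) ℝ k)
    { toFun := fun p i => ⟨p.1 i, (MvPolynomial.mem_restrictTotalDegree _ _ _).2 (p.2 i)⟩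
      map_add' := fun _ _ => rfl
      map_smul' := fun _ _ => rfl }
    fun _ _ h => Subtype.ext (funext fun i => congrArg Subtype.val (congrFun h i))

instance (k : ℕ) : FiniteDimensional ℝ (PolyMat.degLE k) :=
  FiniteDimensional.of_injective
    (V₂ := Fin 3 → Fin 3 → MvPolynomial.restrictTotalDegree (Fin 3) ℝ k)
    { toFun := fun p i j => ⟨p.1 i j, (MvPolynomial.mem_restrictTotalDegree _ _ _).2 (p.2 i j)⟩
      map_add' := fun _ _ => rfl
      map_smul' := fun _ _ => rfl }
    fun _ _ h => Subtype.ext (funext fun i => funext fun j =>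
      congrArg Subtype.val (congrFun (congrFun h i) j))

/-- A finite-dimensional linear system `B q p = ℓ q` (for all `q`) has a solution `p` as soon as `ℓ`
vanishes on the left kernel of `B`. -/
theorem exists_forall_bilin_eq {V W : Type*} [AddCommGroup V] [Module ℝ V] [AddCommGroup W]
    [Module ℝ W] [FiniteDimensional ℝ V] [FiniteDimensional ℝ W] (B : V →ₗ[ℝ] W →ₗ[ℝ] ℝ)
    (ℓ : V →ₗ[ℝ] ℝ) (h : ∀ q, (∀ p, B q p = 0) → ℓ q = 0) : ∃ p, ∀ q, B q p = ℓ q := by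
  have hmem : ℓ ∈ B.ker.dualAnnihilator := by
    rw [Submodule.mem_dualAnnihilator]
    exact fun q hq => h q fun p => by rw [LinearMap.mem_ker.1 hq]; rfl
  rw [← LinearMap.range_dualMap_eq_dualAnnihilator_ker] at hmem
  obtain ⟨φ, hφ⟩ := hmem
  obtain ⟨p, rfl⟩ := (Module.evalEquiv ℝ W).surjective φ
  exact ⟨p, fun q => by rw [← hφ]; rfl⟩

/-- A linear form on matrix-valued polynomials which depends only on the restriction to `X`. -/
structure IsTraceForm (X : Set R3) (b : PolyMat → ℝ) : Prop where
  map_add : ∀ ξ η, b (ξ + η) = b ξ + b η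
  map_smul : ∀ (c : ℝ) ξ, b (c • ξ) = c * b ξ
  map_zero_on : ∀ ξ : PolyMat, (∀ x ∈ X, ξ.at x = 0) → b ξ = 0

/-- The equations that define the gradient of the value `w` and the boundary terms `b`. -/
def IsGradRec (d : ℕ) (X : Set R3) (w : R3) (b : PolyMat → ℝ) (H : PolyMat) : Prop :=
  H.DegLE 1 ∧ ∀ ξ : PolyMat, ξ.DegLE 1 →
    ∫ x in X, ddot (H.at x) (ξ.at x) ∂μHE[d] = -∫ x in X, dot w ((ξ.div X).at x) ∂μHE[d] + b ξ

/-- The equations that define the displacement with gradient `H` and boundary terms `b`. -/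
def IsPotRec (d : ℕ) (X : Set R3) (H : PolyMat) (b : PolyMat → ℝ) (p : PolyVec) : Prop :=
  p.DegLE 2 ∧ ∀ q : PolyVec, q.DegLE 2 →
    ∫ x in X, dot (p.at x) (((q.cone (⨍ x in X, x ∂μHE[d])).div X).at x) ∂μHE[d] =
      -∫ x in X, ddot (H.at x) ((q.cone (⨍ x in X, x ∂μHE[d])).at x) ∂μHE[d] +
        b (q.cone (⨍ x in X, x ∂μHE[d]))

section

variable {d : ℕ} {X : Set R3}

theorem IsFlat.integral_add (h : IsFlat d X) {f g : R3 → ℝ} (hf : Continuous f)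
    (hg : Continuous g) : ∫ x in X, (f x + g x) ∂μHE[d] =
      ∫ x in X, f x ∂μHE[d] + ∫ x in X, g x ∂μHE[d] :=
  MeasureTheory.integral_add (h.integrableOn hf) (h.integrableOn hg)

/-- The `L²` product of matrix-valued polynomials on a flat piece. -/
def IsFlat.ddotForm (h : IsFlat d X) : PolyMat →ₗ[ℝ] PolyMat →ₗ[ℝ] ℝ :=
  LinearMap.mk₂ ℝ (fun ξ η => ∫ x in X, ddot (ξ.at x) (η.at x) ∂μHE[d])
    (fun ξ η ζ => by
      simp only [PolyMat.at_add, ddot_add_left]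
      exact h.integral_add (ξ.continuous_at.ddot ζ.continuous_at)
        (η.continuous_at.ddot ζ.continuous_at))
    (fun c ξ η => by
      simp only [PolyMat.at_smul, ddot_smul_left]
      exact integral_const_mul _ _)
    (fun ξ η ζ => by
      simp only [PolyMat.at_add, ddot_add_right]
      exact h.integral_add (ξ.continuous_at.ddot η.continuous_at)
        (ξ.continuous_at.ddot ζ.continuous_at))
    (fun c ξ η => by
      simp only [PolyMat.at_smul, ddot_smul_right]
      exact integral_const_mul _ _)

/-- The `L²` product of vector-valued polynomials on a flat piece. -/
def IsFlat.dotForm (h : IsFlat d X) : PolyVec →ₗ[ℝ] PolyVec →ₗ[ℝ] ℝ :=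
  LinearMap.mk₂ ℝ (fun p q => ∫ x in X, dot (p.at x) (q.at x) ∂μHE[d])
    (fun p q r => by
      simp only [PolyVec.at_add, dot_add_left]
      exact h.integral_add (p.continuous_at.dot r.continuous_at)
        (q.continuous_at.dot r.continuous_at))
    (fun c p q => by
      simp only [PolyVec.at_smul, dot_smul_left]
      exact integral_const_mul _ _)
    (fun p q r => by
      simp only [PolyVec.at_add, dot_add_right]
      exact h.integral_add (p.continuous_at.dot q.continuous_at)
        (p.continuous_at.dot r.continuous_at))
    (fun c p q => by
      simp only [PolyVec.at_smul, dot_smul_right]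
      exact integral_const_mul _ _)

theorem IsFlat.ddotForm_apply (h : IsFlat d X) (ξ η : PolyMat) :
    h.ddotForm ξ η = ∫ x in X, ddot (ξ.at x) (η.at x) ∂μHE[d] := rfl

theorem IsFlat.dotForm_apply (h : IsFlat d X) (p q : PolyVec) :
    h.dotForm p q = ∫ x in X, dot (p.at x) (q.at x) ∂μHE[d] := rfl

theorem IsFlat.at_eq_zero_of_ddotForm_self (h : IsFlat d X) {ξ : PolyMat}
    (h0 : h.ddotForm ξ ξ = 0) : ∀ x ∈ X, ξ.at x = 0 := fun x hx =>
  ddot_self_eq_zero.1 (h.eqOn_zero_of_integral_eq_zero (ξ.continuous_at.ddot ξ.continuous_at)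
    (fun _ => ddot_self_nonneg _) h0 x hx)

theorem IsFlat.at_eq_zero_of_dotForm_self (h : IsFlat d X) {p : PolyVec}
    (h0 : h.dotForm p p = 0) : ∀ x ∈ X, p.at x = 0 := fun x hx =>
  dot_self_eq_zero.1 (h.eqOn_zero_of_integral_eq_zero (p.continuous_at.dot p.continuous_at)
    (fun _ => dot_self_nonneg _) h0 x hx)

/-- The constant vector-valued polynomial. -/
def constVec (w : R3) : PolyVec := fun i => MvPolynomial.C (w i)

@[simp] theorem constVec_at (w x : R3) : (constVec w).at x = w := by
  ext i; simp [constVec, PolyVec.at]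

theorem constVec_add (v w : R3) : constVec (v + w) = constVec v + constVec w := by
  ext1 i; simp [constVec]

theorem constVec_smul (c : ℝ) (w : R3) : constVec (c • w) = c • constVec w := by
  ext1 i; simp [constVec, MvPolynomial.smul_eq_C_mul]

/-- The right-hand side of the equations for the gradient, as a linear form in `ξ`. -/
def gradRhs (h : IsFlat d X) (w : R3) {b : PolyMat → ℝ} (hb : IsTraceForm X b) :
    PolyMat →ₗ[ℝ] ℝ where
  toFun ξ := -h.dotForm (constVec w) (ξ.div X) + b ξ
  map_add' ξ η := by rw [div_add, map_add, hb.map_add]; ring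
  map_smul' c ξ := by
    rw [div_smul, map_smul, hb.map_smul, RingHom.id_apply, smul_eq_mul, smul_eq_mul]; ring

theorem isGradRec_iff (h : IsFlat d X) {w : R3} {b : PolyMat → ℝ} (hb : IsTraceForm X b)
    {H : PolyMat} : IsGradRec d X w b H ↔
      H.DegLE 1 ∧ ∀ ξ : PolyMat, ξ.DegLE 1 → h.ddotForm H ξ = gradRhs h w hb ξ := by
  simp [IsGradRec, h.ddotForm_apply, gradRhs, h.dotForm_apply]

/-- The gradient is well defined: a field which is orthogonal to itself vanishes on `X`, and then so
does its divergence along `X`. -/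
theorem IsFlat.isGradRec_gradRec (h : IsFlat d X) (w : R3) {b : PolyMat → ℝ}
    (hb : IsTraceForm X b) : IsGradRec d X w b (gradRec d X w b) := by
  refine Classical.epsilon_spec (p := IsGradRec d X w b) ?_
  obtain ⟨H, hH⟩ := exists_forall_bilin_eq
    (((h.ddotForm.domRestrict (PolyMat.degLE 1)).flip.domRestrict (PolyMat.degLE 1)))
    ((gradRhs h w hb).domRestrict (PolyMat.degLE 1)) (fun ξ hξ => by
      have h0 := h.at_eq_zero_of_ddotForm_self (ξ := ξ.1) (hξ ξ)
      have h1 := h.div_at_eq_zero h0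
      change -h.dotForm (constVec w) (ξ.1.div X) + b ξ = 0
      rw [hb.map_zero_on _ h0, h.dotForm_apply, add_zero, neg_eq_zero]
      refine setIntegral_eq_zero_of_forall_eq_zero fun x hx => ?_
      rw [h1 x hx, dot_zero_right])
  exact ⟨H, (isGradRec_iff h hb).2 ⟨H.2, fun ξ hξ => hH ⟨ξ, hξ⟩⟩⟩

theorem IsFlat.isGradRec_unique (h : IsFlat d X) {w : R3} {b : PolyMat → ℝ}
    {H H' : PolyMat} (hH : IsGradRec d X w b H)
    (hH' : IsGradRec d X w b H') : ∀ x ∈ X, H.at x = H'.at x := by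
  have hmem : H - H' ∈ PolyMat.degLE 1 := Submodule.sub_mem _ hH.1 hH'.1
  have h0 : h.ddotForm (H - H') (H - H') = 0 := by
    rw [LinearMap.map_sub₂, h.ddotForm_apply, h.ddotForm_apply, hH.2 _ hmem,
      hH'.2 _ hmem, sub_self]
  intro x hx
  have h1 := h.at_eq_zero_of_ddotForm_self h0 x hx
  rw [sub_eq_add_neg, ← neg_one_smul ℝ, PolyMat.at_add, PolyMat.at_smul, neg_one_smul,
    ← sub_eq_add_neg] at h1
  exact sub_eq_zero.1 h1

theorem IsFlat.isGradRec_add_smul (h : IsFlat d X) {w w' : R3} {b b' : PolyMat → ℝ}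
    {H H' : PolyMat} (hH : IsGradRec d X w b H) (hH' : IsGradRec d X w' b' H') (c : ℝ) :
    IsGradRec d X (w + c • w') (fun ξ => b ξ + c * b' ξ) (H + c • H') := by
  refine ⟨Submodule.add_mem (PolyMat.degLE 1) hH.1 (Submodule.smul_mem _ c hH'.1),
    fun ξ hξ => ?_⟩
  have e1 := hH.2 ξ hξ
  have e2 := hH'.2 ξ hξ
  have e3 : ∀ v, ∫ x in X, dot v ((ξ.div X).at x) ∂μHE[d] = h.dotForm (constVec v) (ξ.div X) :=
    fun v => by simp [h.dotForm_apply]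
  rw [e3, ← h.ddotForm_apply] at e1 e2 ⊢
  rw [constVec_add, constVec_smul, map_add, map_add, map_smul, map_smul, LinearMap.add_apply,
    LinearMap.add_apply, LinearMap.smul_apply, LinearMap.smul_apply, e1, e2, smul_eq_mul,
    smul_eq_mul]
  ring

/-- The right-hand side of the equations for the displacement, as a linear form in `q`. -/
def potRhs (h : IsFlat d X) (H : PolyMat) {b : PolyMat → ℝ} (hb : IsTraceForm X b) :
    PolyVec →ₗ[ℝ] ℝ where
  toFun q := -h.ddotForm H (q.cone (⨍ x in X, x ∂μHE[d])) + b (q.cone (⨍ x in X, x ∂μHE[d]))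
  map_add' p q := by rw [cone_add, map_add, hb.map_add]; ring
  map_smul' c p := by
    rw [cone_smul, map_smul, hb.map_smul, RingHom.id_apply, smul_eq_mul, smul_eq_mul]; ring

/-- The map `q ↦ div ((x - c) q)`. -/
def divCone (X : Set R3) (c : R3) : PolyVec →ₗ[ℝ] PolyVec where
  toFun q := (q.cone c).div X
  map_add' p q := by rw [cone_add, div_add]
  map_smul' r p := by rw [cone_smul, div_smul]; rfl

theorem IsFlat.at_cone_eq_zero {c : R3} {q : PolyVec}
    (hq : ∀ x ∈ X, q.at x = 0) : ∀ x ∈ X, (q.cone c).at x = 0 := by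
  intro x hx
  rw [PolyMat.at_eq_zero_iff]
  intro i j
  simp [PolyVec.cone, PolyVec.at_eq_zero_iff.1 (hq x hx) i]

theorem totalDegree_X_sub_C_le (j : Fin 3) (a : ℝ) :
    (MvPolynomial.X j - MvPolynomial.C a : MvPolynomial (Fin 3) ℝ).totalDegree ≤ 1 :=
  (MvPolynomial.totalDegree_sub _ _).trans (by simp)

theorem totalDegree_pderiv_le (l : Fin 3) (p : MvPolynomial (Fin 3) ℝ) :
    (MvPolynomial.pderiv l p).totalDegree ≤ p.totalDegree - 1 := by
  rw [MvPolynomial.totalDegree]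
  refine Finset.sup_le fun m hm => ?_
  have hc : MvPolynomial.coeff (m + Finsupp.single l 1) p ≠ 0 := by
    intro h0
    rw [MvPolynomial.mem_support_iff, MvPolynomial.coeff_pderiv, h0, zero_mul] at hm
    exact hm rfl
  have h1 := MvPolynomial.le_totalDegree (MvPolynomial.mem_support_iff.2 hc)
  rw [Finsupp.sum_add_index' (fun _ => rfl) (fun _ _ _ => rfl), Finsupp.sum_single_index rfl] at h1
  omega

theorem dirDeriv_totalDegree_le (w : R3) (p : MvPolynomial (Fin 3) ℝ) :
    (dirDeriv w p).totalDegree ≤ p.totalDegree - 1 := by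
  refine MvPolynomial.totalDegree_finsetSum_le fun l _ => ?_
  refine (MvPolynomial.totalDegree_mul _ _).trans ?_
  rw [MvPolynomial.totalDegree_C, zero_add]
  exact totalDegree_pderiv_le l p

theorem divCone_degLE {k : ℕ} {c : R3} {q : PolyVec} (hq : q.DegLE k) :
    (divCone X c q).DegLE k := by
  intro i
  change ((q.cone c).div X i).totalDegree ≤ k
  rw [div_eq_sum_dirDeriv]
  refine MvPolynomial.totalDegree_finsetSum_le fun j _ => ?_
  refine (dirDeriv_totalDegree_le _ _).trans ?_
  have h1 := (MvPolynomial.totalDegree_mul (MvPolynomial.X j - MvPolynomial.C (c j)) (q i)).trans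
    (add_le_add (totalDegree_X_sub_C_le j (c j)) (hq i))
  change (((MvPolynomial.X j - MvPolynomial.C (c j)) * q i).totalDegree) - 1 ≤ k
  omega

/-- The displacement is well defined: on quadratic fields over `X` the map `q ↦ div ((x - c) q)` is
injective, hence every quadratic field is such a divergence. -/
theorem IsFlat.isPotRec_potRec (hd : d ≠ 0) (h : IsFlat d X) (H : PolyMat) {b : PolyMat → ℝ}
    (hb : IsTraceForm X b) : IsPotRec d X H b (potRec d X H b) := by
  refine Classical.epsilon_spec (p := IsPotRec d X H b) ?_
  set c := ⨍ x in X, x ∂μHE[d] with hc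
  obtain ⟨p, hp⟩ := exists_forall_bilin_eq
    ((((h.dotForm.domRestrict (PolyVec.degLE 2)).flip ∘ₗ divCone X c).domRestrict
      (PolyVec.degLE 2)))
    ((potRhs h H hb).domRestrict (PolyVec.degLE 2)) (fun q hq => by
      have h0 := h.at_eq_zero_of_dotForm_self (hq ⟨divCone X c q, divCone_degLE q.2⟩)
      have h1 := IsFlat.at_cone_eq_zero (c := c)
        (h.at_eq_zero_of_div_cone hd h.average_mem_affineSpan h0)
      change -h.ddotForm H (q.1.cone c) + b (q.1.cone c) = 0
      rw [hb.map_zero_on _ h1, h.ddotForm_apply, add_zero, neg_eq_zero]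
      refine setIntegral_eq_zero_of_forall_eq_zero fun x hx => ?_
      rw [h1 x hx, ddot_zero_right])
  exact ⟨p, p.2, fun q hq => hp ⟨q, hq⟩⟩

theorem IsFlat.isPotRec_add_smul (h : IsFlat d X) {H H' : PolyMat} {b b' : PolyMat → ℝ}
    {p p' : PolyVec} (hp : IsPotRec d X H b p) (hp' : IsPotRec d X H' b' p') (c : ℝ) :
    IsPotRec d X (H + c • H') (fun ξ => b ξ + c * b' ξ) (p + c • p') := by
  refine ⟨Submodule.add_mem (PolyVec.degLE 2) hp.1 (Submodule.smul_mem _ c hp'.1),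
    fun q hq => ?_⟩
  have e1 := hp.2 q hq
  have e2 := hp'.2 q hq
  rw [← h.ddotForm_apply, ← h.dotForm_apply] at e1 e2 ⊢
  rw [map_add, map_add, map_smul, map_smul, LinearMap.add_apply,
    LinearMap.add_apply, LinearMap.smul_apply, LinearMap.smul_apply, e1, e2, smul_eq_mul,
    smul_eq_mul]
  ring

/-- The displacement depends only on the values of the gradient on `X`. -/
theorem IsPotRec.congr (h : IsFlat d X) {H H' : PolyMat} {b : PolyMat → ℝ} {p : PolyVec}
    (hp : IsPotRec d X H b p) (hH : ∀ x ∈ X, H.at x = H'.at x) : IsPotRec d X H' b p := by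
  refine ⟨hp.1, fun q hq => ?_⟩
  rw [hp.2 q hq]
  congr 2
  exact setIntegral_congr_fun h.measurableSet fun x hx => by simp only [hH x hx]

theorem PolyVec.at_sub (p q : PolyVec) (x : R3) : PolyVec.at (p - q) x = p.at x - q.at x := by
  ext i; simp [PolyVec.at]

/-- The displacement is determined on `X`. -/
theorem IsFlat.isPotRec_unique (hd : d ≠ 0) (h : IsFlat d X) {H : PolyMat} {b : PolyMat → ℝ}
    {p p' : PolyVec} (hp : IsPotRec d X H b p)
    (hp' : IsPotRec d X H b p') : ∀ x ∈ X, p.at x = p'.at x := by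
  set c := ⨍ x in X, x ∂μHE[d] with hc
  set D : PolyVec.degLE 2 →ₗ[ℝ] PolyVec.degLE 2 :=
    (divCone X c).restrict (fun q hq => divCone_degLE hq) with hD
  let N : Submodule ℝ (PolyVec.degLE 2) :=
    { carrier := {q | ∀ x ∈ X, q.1.at x = 0}
      zero_mem' := fun x _ => by simp [PolyVec.at_eq_zero_iff]
      add_mem' := fun {q r} hq hr x hx => by
        change PolyVec.at (q.1 + r.1) x = 0
        rw [PolyVec.at_add, hq x hx, hr x hx, add_zero]
      smul_mem' := fun a q hq x hx => by
        change PolyVec.at (a • q.1) x = 0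
        rw [PolyVec.at_smul, hq x hx, smul_zero] }
  -- a dimension count: the divergence is onto, up to fields that vanish on `X`
  have hker : (N.mkQ ∘ₗ D).ker ≤ N := fun q hq => by
    have h1 : D q ∈ N := by
      simpa [LinearMap.mem_ker, Submodule.Quotient.mk_eq_zero] using hq
    exact h.at_eq_zero_of_div_cone hd h.average_mem_affineSpan h1
  have hsurj : (N.mkQ ∘ₗ D).range = ⊤ := by
    refine Submodule.eq_top_of_finrank_eq (le_antisymm (Submodule.finrank_le _) ?_)
    have e1 := (N.mkQ ∘ₗ D).finrank_range_add_finrank_ker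
    have e2 := N.finrank_quotient_add_finrank
    have e3 := Submodule.finrank_mono hker
    omega
  have hmem : p - p' ∈ PolyVec.degLE 2 := Submodule.sub_mem _ hp.1 hp'.1
  obtain ⟨q, hq⟩ := LinearMap.range_eq_top.1 hsurj (N.mkQ ⟨p - p', hmem⟩)
  have hq' : ∀ x ∈ X, PolyVec.at (D q).1 x = PolyVec.at (p - p') x := by
    have h1 : D q - ⟨p - p', hmem⟩ ∈ N := (Submodule.Quotient.eq N).1 hq
    intro x hx
    have h2 := h1 x hx
    change PolyVec.at ((D q).1 - (p - p')) x = 0 at h2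
    rw [PolyVec.at_sub] at h2
    exact sub_eq_zero.1 h2
  have h0 : h.dotForm (p - p') (p - p') = 0 := by
    have e1 : h.dotForm (p - p') (D q).1 = 0 := by
      rw [LinearMap.map_sub₂]
      exact sub_eq_zero.2 ((hp.2 q q.2).trans (hp'.2 q q.2).symm)
    rw [← e1, h.dotForm_apply, h.dotForm_apply]
    exact setIntegral_congr_fun h.measurableSet fun x hx => by simp only [hq' x hx]
  intro x hx
  have h1 := h.at_eq_zero_of_dotForm_self h0 x hx
  rw [PolyVec.at_sub] at h1
  exact sub_eq_zero.1 h1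

/-- The value `w` on `X` is the mean of the displacement: test both equations with the fields
`(x - c) a`, `a` constant, whose divergence is `d a`. -/
theorem IsFlat.integral_dot_potRec (hd : d ≠ 0) (h : IsFlat d X) {w : R3} {H : PolyMat}
    {b : PolyMat → ℝ} {p : PolyVec} (hH : IsGradRec d X w b H) (hp : IsPotRec d X H b p) (a : R3) :
    ∫ x in X, dot (p.at x) a ∂μHE[d] = (μHE[d] : Measure R3).real X * dot w a := by
  set c := ⨍ x in X, x ∂μHE[d] with hc
  have hq : (constVec a).DegLE 2 := fun i => by simp [constVec]
  have hη : ((constVec a).cone c).DegLE 1 := fun i j => by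
    refine (MvPolynomial.totalDegree_mul _ _).trans ?_
    simpa [constVec] using totalDegree_X_sub_C_le j (c j)
  have hdiv : ∀ x ∈ X, (((constVec a).cone c).div X).at x = (d : ℝ) • a := by
    intro x hx
    ext i
    change MvPolynomial.eval x.ofLp (((constVec a).cone c).div X i) = _
    rw [h.eval_div_cone h.average_mem_affineSpan (mem_affineSpan ℝ hx)]
    simp [constVec, dirDeriv_C]
  have e1 := hp.2 _ hq
  rw [hH.2 _ hη, neg_add, neg_neg, neg_add_cancel_right] at e1
  have hI : ∀ f : R3 → R3, ∫ x in X, dot (f x) ((((constVec a).cone c).div X).at x) ∂μHE[d] =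
      (d : ℝ) * ∫ x in X, dot (f x) a ∂μHE[d] := fun f => by
    rw [← integral_const_mul]
    refine setIntegral_congr_fun h.measurableSet fun x hx => ?_
    simp only [hdiv x hx, dot_smul_right]
  rw [← hc, hI, hI fun _ => w, setIntegral_const, smul_eq_mul] at e1
  have hd' : (d : ℝ) ≠ 0 := Nat.cast_ne_zero.2 hd
  exact mul_left_cancel₀ hd' e1

end

/-! ### Geometry of the mesh and outward normals -/

theorem euclideanHausdorffMeasure_three : (μHE[3] : Measure R3) = volume :=
  EuclideanSpace.euclideanHausdorffMeasure_eq_volume 3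

theorem bdry_openSegment {a b : R3} (hab : a ≠ b) : bdry (openSegment ℝ a b) = {a, b} := by
  rw [bdry, closure_openSegment]
  ext x
  constructor
  · rintro ⟨h1, h2⟩
    rw [← insert_endpoints_openSegment] at h1
    rcases h1 with rfl | rfl | h1
    · simp
    · simp
    · exact absurd h1 h2
  · rintro (rfl | rfl)
    · exact ⟨left_mem_segment ℝ _ _, fun h => hab (left_mem_openSegment_iff.1 h)⟩
    · exact ⟨right_mem_segment ℝ _ _, fun h => hab (right_mem_openSegment_iff.1 h)⟩

theorem eventually_add_smul_mem {U : Set R3} (hU : IsOpen U) {x : R3} (hx : x ∈ U) (m : R3) :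
    ∀ᶠ t in 𝓝[>] (0 : ℝ), x + t • m ∈ U := by
  have hc : Continuous fun t : ℝ => x + t • m := by fun_prop
  exact ((hc.tendsto' 0 x (by simp)).mono_left nhdsWithin_le_nhds).eventually_mem (hU.mem_nhds hx)

/-- A connected set that meets both `K` and its complement meets the frontier of `K`. -/
theorem exists_mem_frontier {S K : Set R3} (hS : IsPreconnected S) {x y : R3} (hx : x ∈ S)
    (hxK : x ∈ K) (hy : y ∈ S) (hyK : y ∉ K) : ∃ z ∈ S, z ∈ frontier K := by
  by_contra! h
  have hcov : S ⊆ interior K ∪ (closure K)ᶜ := fun z hz => by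
    by_contra! hn
    simp only [Set.mem_union, Set.mem_compl_iff, not_or, not_not] at hn
    exact h z hz ⟨hn.2, hn.1⟩
  obtain ⟨z, -, h1, h2⟩ := hS _ _ isOpen_interior isClosed_closure.isOpen_compl hcov
    ⟨x, hx, (hcov hx).resolve_right fun hn => hn (subset_closure hxK)⟩
    ⟨y, hy, (hcov hy).resolve_left fun hn => hyK (interior_subset hn)⟩
  exact h2 (subset_closure (interior_subset h1))

theorem closure_eq_union_bdry (X : Set R3) : closure X = X ∪ bdry X :=
  (Set.union_sdiff_cancel subset_closure).symm

theorem bdry_eq_frontier {X : Set R3} (hX : IsOpen X) : bdry X = frontier X := by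
  rw [bdry, frontier, hX.interior_eq]

/-- In a polyhedron, the interior of the closure is the polyhedron itself. -/
theorem IsPolyhedron.mem_of_ball_subset_closure {X : Set R3} (h : IsPolyhedron X) {y : R3}
    {r : ℝ} (hr : 0 < r) (hy : Metric.ball y r ⊆ closure X) : y ∈ X := by
  obtain ⟨-, T, hT⟩ := h
  rw [hT]
  refine mem_interior.2 ⟨_, hy.trans ?_, Metric.isOpen_ball, Metric.mem_ball_self hr⟩
  refine closure_minimal ?_ (isCompact_biUnion_convexHull T).isClosed
  rw [hT]
  exact interior_subset

/-- The plane of a two-dimensional flat piece is described by a unit normal vector. -/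
theorem IsFlat.mem_vectorSpan_iff {X : Set R3} (h : IsFlat 2 X) {n : R3} (hn : ‖n‖ = 1)
    (hX : ∀ w ∈ vectorSpan ℝ X, inner ℝ n w = 0) {w : R3} :
    w ∈ vectorSpan ℝ X ↔ inner ℝ n w = 0 := by
  have hle : vectorSpan ℝ X ≤ (ℝ ∙ n)ᗮ := fun w hw =>
    Submodule.mem_orthogonal_singleton_iff_inner_right.2 (hX w hw)
  have : Fact (Module.finrank ℝ R3 = 2 + 1) := ⟨by simp⟩
  have hn0 : n ≠ 0 := by rintro rfl; simp at hn
  have heq : vectorSpan ℝ X = (ℝ ∙ n)ᗮ :=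
    Submodule.eq_of_le_of_finrank_eq hle
      (by rw [h.finrank_vectorSpan, Submodule.finrank_orthogonal_span_singleton (n := 2) hn0])
  rw [heq, Submodule.mem_orthogonal_singleton_iff_inner_right]

theorem IsFlat.exists_unit_normal {X : Set R3} (h : IsFlat 2 X) :
    ∃ n : R3, ‖n‖ = 1 ∧ ∀ w ∈ vectorSpan ℝ X, inner ℝ n w = 0 := by
  have hne : (vectorSpan ℝ X)ᗮ ≠ ⊥ := by
    intro h0
    have h1 := (vectorSpan ℝ X).finrank_add_finrank_orthogonal
    rw [h0, h.finrank_vectorSpan] at h1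
    simp at h1
  obtain ⟨m, hm, hm0⟩ := Submodule.exists_mem_ne_zero_of_ne_bot hne
  refine ⟨‖m‖⁻¹ • m, by simp [norm_smul, hm0], fun w hw => ?_⟩
  rw [inner_smul_left, (Submodule.mem_orthogonal' _ _).1 hm w hw, mul_zero]

namespace PolyMesh

variable {Ω : Set R3} (M : PolyMesh Ω)

theorem isFlat_cell (K : M.cells) : IsFlat 3 (K : Set R3) := (M.isPolyhedron_cell K.1 K.2).isFlat

theorem isFlat_face (σ : M.faces) : IsFlat 2 (σ : Set R3) := (M.isPolygon_face σ.1 σ.2).isFlat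

theorem isFlat_edge (e : M.edges) : IsFlat 1 (e : Set R3) := by
  obtain ⟨a, -, b, -, hab, he⟩ := M.isSegment_edge e.1 e.2
  rw [he]
  exact isFlat_openSegment hab

theorem bdry_edge_subset (e : M.edges) : bdry (e : Set R3) ⊆ M.vertices := by
  obtain ⟨a, ha, b, hb, hab, he⟩ := M.isSegment_edge e.1 e.2
  rw [he, bdry_openSegment hab]
  rintro x (rfl | rfl)
  exacts [ha, hb]

theorem closure_edge_subset (e : M.edges) : closure (e : Set R3) ⊆ e ∪ M.vertices := by
  rw [closure_eq_union_bdry]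
  exact Set.union_subset_union_right _ (M.bdry_edge_subset e)

/-- The union of the closed edges. -/
def skeleton : Set R3 := ⋃ e : M.edges, closure (e : Set R3)

theorem bdry_face_subset_skeleton (σ : M.faces) : bdry (σ : Set R3) ⊆ M.skeleton := by
  rw [M.bdry_face σ.1 σ.2]
  intro x hx
  simp only [Set.mem_iUnion] at hx
  obtain ⟨e, he, -, hx⟩ := hx
  exact Set.mem_iUnion.2 ⟨⟨e, he⟩, hx⟩

theorem disjoint_face_skeleton (σ : M.faces) : Disjoint (σ : Set R3) M.skeleton := by
  rw [Set.disjoint_left]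
  intro x hx hs
  obtain ⟨e, he⟩ := Set.mem_iUnion.1 hs
  rcases M.closure_edge_subset e he with h | h
  · exact Set.disjoint_left.1 (M.disjoint_face_edge σ.1 σ.2 e.1 e.2) hx h
  · exact M.vertex_notMem_face x h σ.1 σ.2 hx

/-- An open face meets no other closed face. -/
theorem eq_of_mem_closure_face {σ τ : M.faces} {x : R3} (hx : x ∈ (σ : Set R3))
    (hτ : x ∈ closure (τ : Set R3)) : σ = τ := by
  by_contra hne
  rw [closure_eq_union_bdry] at hτ
  rcases hτ with h | h
  · exact Set.disjoint_left.1 (M.disjoint_faces σ.1 σ.2 τ.1 τ.2 (fun h => hne (Subtype.ext h))) hx h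
  · exact Set.disjoint_left.1 (M.disjoint_face_skeleton σ) hx (M.bdry_face_subset_skeleton τ h)

theorem exists_face_of_mem_bdry {K : M.cells} {x : R3} (hx : x ∈ bdry (K : Set R3))
    (hs : x ∉ M.skeleton) : ∃ σ : M.facesOf K, x ∈ (σ.1 : Set R3) := by
  rw [M.bdry_cell K.1 K.2] at hx
  simp only [Set.mem_iUnion] at hx
  obtain ⟨σ, hσ, hσK, hx⟩ := hx
  refine ⟨⟨⟨σ, hσ⟩, hσK⟩, ?_⟩
  rw [closure_eq_union_bdry] at hx
  exact hx.resolve_right fun h => hs (M.bdry_face_subset_skeleton ⟨σ, hσ⟩ h)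

/-- Near a point of a face of a cell, the boundary of the cell is contained in the face. -/
theorem exists_ball_inter_bdry_subset {K : M.cells} (σ : M.facesOf K) {y : R3}
    (hy : y ∈ (σ.1 : Set R3)) :
    ∃ r > 0, Metric.ball y r ∩ bdry K ⊆ (σ.1 : Set R3) := by
  have hc : IsClosed (⋃ τ ∈ {τ : M.faces | τ ≠ σ.1}, closure (τ : Set R3)) :=
    (Set.toFinite _).isClosed_biUnion fun τ _ => isClosed_closure
  have hcE : IsClosed (M.skeleton) := isClosed_iUnion_of_finite fun e => isClosed_closure
  have hyn : y ∉ (⋃ τ ∈ {τ : M.faces | τ ≠ σ.1}, closure (τ : Set R3)) ∪ M.skeleton := by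
    rintro (h | h)
    · simp only [Set.mem_iUnion] at h
      obtain ⟨τ, hτ, h⟩ := h
      exact hτ (M.eq_of_mem_closure_face hy h).symm
    · exact Set.disjoint_left.1 (M.disjoint_face_skeleton σ.1) hy h
  obtain ⟨r, hr, hb⟩ := Metric.isOpen_iff.1 (hc.union hcE).isOpen_compl y hyn
  refine ⟨r, hr, fun x hx => ?_⟩
  have hxn := hb hx.1
  obtain ⟨τ, hτ⟩ := M.exists_face_of_mem_bdry hx.2 fun h => hxn (Or.inr h)
  have : τ.1 = σ.1 := by
    by_contra hne
    exact hxn (Or.inl (Set.mem_biUnion hne (subset_closure hτ)))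
  rwa [this] at hτ

/-- Near a point of a face, a cell is a half-ball. -/
theorem exists_local_side {K : M.cells} (σ : M.facesOf K) {n : R3} (hn : ‖n‖ = 1)
    (hσ : ∀ w ∈ vectorSpan ℝ (σ.1 : Set R3), inner ℝ n w = 0) {y : R3}
    (hy : y ∈ (σ.1 : Set R3)) :
    ∃ r > 0, (∀ x ∈ Metric.ball y r, x ∈ (K : Set R3) ↔ inner ℝ n (x - y) < 0) ∨
      (∀ x ∈ Metric.ball y r, x ∈ (K : Set R3) ↔ 0 < inner ℝ n (x - y)) := by
  obtain ⟨r₁, hr₁, hb₁⟩ := M.exists_ball_inter_bdry_subset σ hy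
  obtain ⟨O, hO, hX⟩ := (M.isFlat_face σ.1).exists_isOpen
  obtain ⟨r₂, hr₂, hb₂⟩ := Metric.isOpen_iff.1 hO y (hX ▸ hy).1
  set r := min r₁ r₂ with hr
  have hr0 : 0 < r := lt_min hr₁ hr₂
  have hKo := M.isOpen_cell K
  have hflat := M.isFlat_face σ.1
  have hyspan : y ∈ affineSpan ℝ (σ.1 : Set R3) := mem_affineSpan ℝ hy
  have hzero : ∀ x ∈ (σ.1 : Set R3), inner ℝ n (x - y) = 0 := fun x hx =>
    hσ _ (by
      rw [← direction_affineSpan]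
      exact AffineSubspace.vsub_mem_direction (mem_affineSpan ℝ hx) hyspan)
  have hplane : ∀ x ∈ Metric.ball y r, inner ℝ n (x - y) = 0 → x ∉ (K : Set R3) := by
    intro x hx h0
    have hxs : x ∈ (σ.1 : Set R3) := by
      rw [hX]
      refine ⟨hb₂ (Metric.ball_subset_ball (min_le_right _ _) hx), ?_⟩
      have hw := (hflat.mem_vectorSpan_iff hn hσ).2 h0
      have := (affineSpan ℝ (σ.1 : Set R3)).vadd_mem_of_mem_direction
        (by rw [direction_affineSpan]; exact hw) hyspan
      simpa using this
    exact (σ.2 hxs).2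
  have hfr : ∀ x ∈ Metric.ball y r, inner ℝ n (x - y) ≠ 0 → x ∉ frontier (K : Set R3) := by
    intro x hx h0 hxf
    rw [← bdry_eq_frontier hKo] at hxf
    exact h0 (hzero x (hb₁ ⟨Metric.ball_subset_ball (min_le_left _ _) hx, hxf⟩))
  -- a half-ball does not meet the frontier of the cell, so it lies on one side of it
  have hhalf : ∀ m : R3, (m = n ∨ m = -n) →
      (∀ x ∈ Metric.ball y r, 0 < inner ℝ m (x - y) → x ∈ (K : Set R3)) ∨
      (∀ x ∈ Metric.ball y r, 0 < inner ℝ m (x - y) → x ∉ (K : Set R3)) := by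
    intro m hm
    by_contra! hcon
    obtain ⟨⟨x₁, hx₁, h₁, hK₁⟩, x₂, hx₂, h₂, hK₂⟩ := hcon
    have hconv : Convex ℝ (Metric.ball y r ∩ {x | 0 < inner ℝ m (x - y)}) := by
      refine (convex_ball y r).inter ?_
      have : {x | 0 < inner ℝ m (x - y)} = {x | inner ℝ m y < inner ℝ m x} := by
        ext x; simp [inner_sub_right]
      rw [this]
      exact convex_halfSpace_gt (f := fun x : R3 => inner ℝ m x)
        (IsLinearMap.mk (fun a b => inner_add_right _ _ _) fun c a => inner_smul_right _ _ _) _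
    obtain ⟨z, hz, hzf⟩ := exists_mem_frontier hconv.isPreconnected ⟨hx₂, h₂⟩ hK₂ ⟨hx₁, h₁⟩ hK₁
    refine hfr z hz.1 ?_ hzf
    have h3 : 0 < inner ℝ m (z - y) := hz.2
    rcases hm with rfl | rfl
    · exact h3.ne'
    · rw [inner_neg_left] at h3
      exact (neg_pos.1 h3).ne
  have hnn : inner ℝ n n = (1 : ℝ) := by rw [real_inner_self_eq_norm_sq, hn, one_pow]
  have hmove : ∀ (x : R3), x ∈ Metric.ball y r → ∀ U : Set R3, IsOpen U → x ∈ U →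
      ∃ t > (0 : ℝ), x + t • n ∈ Metric.ball y r ∩ U := by
    intro x hx U hU hxU
    obtain ⟨t, h1, h2⟩ := ((eventually_add_smul_mem (Metric.isOpen_ball.inter hU)
      ⟨hx, hxU⟩ n).and self_mem_nhdsWithin).exists
    exact ⟨t, h2, h1⟩
  refine ⟨r, hr0, ?_⟩
  rcases hhalf n (Or.inl rfl) with hp | hp <;> rcases hhalf (-n) (Or.inr rfl) with hm | hm
  · -- the cell cannot lie on both sides of its boundary
    exfalso
    have hsub : Metric.ball y r ⊆ closure (K : Set R3) := by
      intro x hx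
      rcases lt_trichotomy (inner ℝ n (x - y)) 0 with h | h | h
      · exact subset_closure (hm x hx (by rw [inner_neg_left]; linarith))
      · rw [mem_closure_iff]
        intro U hU hxU
        obtain ⟨t, ht, hmem⟩ := hmove x hx U hU hxU
        refine ⟨_, hmem.2, hp _ hmem.1 ?_⟩
        rw [add_sub_right_comm, inner_add_right, h, inner_smul_right, hnn]
        linarith
      · exact subset_closure (hp x hx h)
    exact (σ.2 hy).2 ((M.isPolyhedron_cell K.1 K.2).mem_of_ball_subset_closure hr0 hsub)
  · right
    intro x hx
    refine ⟨fun hK => ?_, hp x hx⟩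
    rcases lt_trichotomy (inner ℝ n (x - y)) 0 with h | h | h
    · exact absurd hK (hm x hx (by rw [inner_neg_left]; linarith))
    · exact absurd hK (hplane x hx h)
    · exact h
  · left
    intro x hx
    refine ⟨fun hK => ?_, fun h => hm x hx (by rw [inner_neg_left]; linarith)⟩
    rcases lt_trichotomy (inner ℝ n (x - y)) 0 with h | h | h
    · exact h
    · exact absurd hK (hplane x hx h)
    · exact absurd hK (hp x hx h)
  · -- nor can it miss both of the half-balls
    exfalso
    obtain ⟨z, hzb, hzK⟩ := mem_closure_iff.1 (σ.2 hy).1 _ Metric.isOpen_ball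
      (Metric.mem_ball_self hr0)
    rcases lt_trichotomy (inner ℝ n (z - y)) 0 with h | h | h
    · exact hm z hzb (by rw [inner_neg_left]; linarith) hzK
    · exact hplane z hzb h hzK
    · exact hp z hzb h hzK

theorem exists_isOutwardNormal {K : M.cells} (σ : M.facesOf K) :
    ∃ n, IsOutwardNormal (K : Set R3) (σ.1 : Set R3) n := by
  obtain ⟨n, hn, hσ⟩ := (M.isFlat_face σ.1).exists_unit_normal
  have hnn : inner ℝ n n = (1 : ℝ) := by rw [real_inner_self_eq_norm_sq, hn, one_pow]
  have hspan : vectorSpan ℝ (K : Set R3) = ⊤ := by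
    rw [← direction_affineSpan, (M.isOpen_cell K).affineSpan_eq_top (M.isFlat_cell K).nonempty,
      AffineSubspace.direction_top]
  -- the points of the face with the cell on the side of `-m`
  set P : R3 → R3 → ℝ → Prop := fun m y r =>
    ∀ x ∈ Metric.ball y r, x ∈ (K : Set R3) ↔ inner ℝ m (x - y) < 0 with hP
  set U : R3 → Set R3 := fun m => ⋃ y ∈ (σ.1 : Set R3), ⋃ r ∈ {r : ℝ | 0 < r ∧ P m y r},
    Metric.ball y r with hU
  have hUo : ∀ m, IsOpen (U m) := fun m =>
    isOpen_biUnion fun y _ => isOpen_biUnion fun r _ => Metric.isOpen_ball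
  have hside : ∀ y ∈ (σ.1 : Set R3), ∃ r > 0, P n y r ∨ P (-n) y r := by
    intro y hy
    obtain ⟨r, hr, h | h⟩ := M.exists_local_side σ hn hσ hy
    · exact ⟨r, hr, Or.inl h⟩
    · exact ⟨r, hr, Or.inr fun x hx => by rw [h x hx, inner_neg_left, neg_lt_zero]⟩
  have hzero : ∀ x ∈ (σ.1 : Set R3), ∀ y ∈ (σ.1 : Set R3), inner ℝ n (x - y) = 0 :=
    fun x hx y hy => hσ _ (vsub_mem_vectorSpan ℝ hx hy)
  -- the sign does not change along the face, which is connected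
  have hconst : (∀ y ∈ (σ.1 : Set R3), ∃ r > 0, P n y r) ∨
      (∀ y ∈ (σ.1 : Set R3), ∃ r > 0, P (-n) y r) := by
    by_contra! hcon
    obtain ⟨⟨y₁, hy₁, h₁⟩, y₂, hy₂, h₂⟩ := hcon
    have hcov : (σ.1 : Set R3) ⊆ U n ∪ U (-n) := by
      intro y hy
      obtain ⟨r, hr, h | h⟩ := hside y hy
      · exact Or.inl (Set.mem_biUnion hy (Set.mem_biUnion ⟨hr, h⟩ (Metric.mem_ball_self hr)))
      · exact Or.inr (Set.mem_biUnion hy (Set.mem_biUnion ⟨hr, h⟩ (Metric.mem_ball_self hr)))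
    have hm₁ : ((σ.1 : Set R3) ∩ U (-n)).Nonempty := by
      obtain ⟨r, hr, h | h⟩ := hside y₁ hy₁
      · exact absurd h (h₁ r hr)
      · exact ⟨y₁, hy₁, Set.mem_biUnion hy₁ (Set.mem_biUnion ⟨hr, h⟩ (Metric.mem_ball_self hr))⟩
    have hm₂ : ((σ.1 : Set R3) ∩ U n).Nonempty := by
      obtain ⟨r, hr, h | h⟩ := hside y₂ hy₂
      · exact ⟨y₂, hy₂, Set.mem_biUnion hy₂ (Set.mem_biUnion ⟨hr, h⟩ (Metric.mem_ball_self hr))⟩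
      · exact absurd h (h₂ r hr)
    obtain ⟨z, hz, hz1, hz2⟩ := (M.isPolygon_face σ.1.1 σ.1.2).1.isPreconnected _ _ (hUo n)
      (hUo (-n)) hcov hm₂ hm₁
    simp only [hU, Set.mem_iUnion] at hz1 hz2
    obtain ⟨a, ha, ra, ⟨-, hPa⟩, hza⟩ := hz1
    obtain ⟨b, hb, rb, ⟨-, hPb⟩, hzb⟩ := hz2
    obtain ⟨t, ⟨hta, htb⟩, ht⟩ :=
      (((eventually_add_smul_mem Metric.isOpen_ball hza (-n)).and
        (eventually_add_smul_mem Metric.isOpen_ball hzb (-n))).and self_mem_nhdsWithin).exists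
    have ht0 : 0 < t := ht
    have e1 : inner ℝ n (z + t • -n - a) = -t := by
      rw [add_sub_right_comm, inner_add_right, hzero z hz a ha, inner_smul_right,
        inner_neg_right, hnn]; ring
    have e2 : inner ℝ n (z + t • -n - b) = -t := by
      rw [add_sub_right_comm, inner_add_right, hzero z hz b hb, inner_smul_right,
        inner_neg_right, hnn]; ring
    have i1 := (hPa _ hta).2 (by rw [e1]; linarith)
    have i2 := (hPb _ htb).1 i1
    rw [inner_neg_left, e2] at i2
    linarith
  have hfin : ∀ m : R3, inner ℝ m m = (1 : ℝ) → (∀ y ∈ (σ.1 : Set R3), ∃ r > 0, P m y r) →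
      ∀ y ∈ (σ.1 : Set R3), ∀ᶠ t in 𝓝[>] (0 : ℝ), y - t • m ∈ (K : Set R3) ∧
        y + t • m ∉ (K : Set R3) := by
    intro m hm h y hy
    obtain ⟨r, hr, hp⟩ := h y hy
    filter_upwards [eventually_add_smul_mem Metric.isOpen_ball (Metric.mem_ball_self hr) (-m),
      eventually_add_smul_mem Metric.isOpen_ball (Metric.mem_ball_self hr) m,
      self_mem_nhdsWithin] with t h1 h2 ht
    have ht0 : 0 < t := ht
    have h1' := hp _ h1
    have h2' := hp _ h2
    rw [add_sub_cancel_left, inner_smul_right, hm, mul_one] at h2'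
    rw [add_sub_cancel_left, inner_smul_right, inner_neg_right, hm, smul_neg,
      ← sub_eq_add_neg] at h1'
    exact ⟨h1'.2 (by linarith), fun h => by linarith [h2'.1 h]⟩
  rcases hconst with h | h
  · exact ⟨n, by rw [hspan]; trivial, hn, hσ, hfin n hnn h⟩
  · refine ⟨-n, by rw [hspan]; trivial, by rw [norm_neg, hn],
      fun w hw => by rw [inner_neg_left, hσ w hw, neg_zero],
      hfin (-n) (by rw [inner_neg_neg, hnn]) h⟩

/-- The unit outward normal exists, and near each point of the face the cell is the half-ball on the
inner side of it. -/
theorem outwardNormal_spec {K : M.cells} (σ : M.facesOf K) :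
    ‖outwardNormal (K : Set R3) (σ.1 : Set R3)‖ = 1 ∧
      (∀ w ∈ vectorSpan ℝ (σ.1 : Set R3),
        inner ℝ (outwardNormal (K : Set R3) (σ.1 : Set R3)) w = 0) ∧
      ∀ y ∈ (σ.1 : Set R3), ∃ r > 0, ∀ x ∈ Metric.ball y r,
        x ∈ (K : Set R3) ↔ inner ℝ (outwardNormal (K : Set R3) (σ.1 : Set R3)) (x - y) < 0 := by
  obtain ⟨-, hn, hσ, h⟩ : IsOutwardNormal (K : Set R3) (σ.1 : Set R3)
      (outwardNormal (K : Set R3) (σ.1 : Set R3)) :=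
    Classical.epsilon_spec (M.exists_isOutwardNormal σ)
  set n := outwardNormal (K : Set R3) (σ.1 : Set R3)
  refine ⟨hn, hσ, fun y hy => ?_⟩
  obtain ⟨r, hr, hs | hs⟩ := M.exists_local_side σ hn hσ hy
  · exact ⟨r, hr, hs⟩
  · exfalso
    have hev := eventually_add_smul_mem Metric.isOpen_ball (Metric.mem_ball_self (x := y) hr) (-n)
    obtain ⟨t, ⟨h1, h2⟩, ht⟩ := (((h y hy).and hev).and self_mem_nhdsWithin).exists
    have ht0 : 0 < t := ht
    rw [smul_neg, ← sub_eq_add_neg] at h2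
    have h3 := (hs _ h2).1 h1.1
    rw [sub_sub_cancel_left, inner_neg_right, inner_smul_right,
      real_inner_self_eq_norm_sq, hn] at h3
    linarith

end PolyMesh

/-! ### The divergence theorem on a cell -/

/-- The fundamental theorem of calculus on a bounded open set `U` of `ℝ` with finitely many boundary
points `t i`, where `U` lies to the left (`ε i = 1`) or to the right (`ε i = -1`) of `t i`. The
indicator function of `U` is minus the sum of the jumps `ε i` over the points `t i` on the left. -/
theorem integral_deriv_eq_sum_of_frontier {U : Set ℝ} (hU : IsOpen U)
    (hb : Bornology.IsBounded U) {ι : Type*} (A : Finset ι) (t ε : ι → ℝ) (hinj : Set.InjOn t A)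
    (hloc : ∀ i ∈ A, (ε i = 1 ∧ ∀ᶠ x in 𝓝 (t i), x ∈ U ↔ x < t i) ∨
      (ε i = -1 ∧ ∀ᶠ x in 𝓝 (t i), x ∈ U ↔ t i < x))
    (hfr : ∀ x ∈ frontier U, ∃ i ∈ A, x = t i) {f f' : ℝ → ℝ}
    (hf : ∀ x, HasDerivAt f (f' x) x) (hf' : Continuous f') :
    ∫ x in U, f' x = ∑ i ∈ A, ε i * f (t i) := by
  classical
  set step : ι → ℝ → ℝ := fun i x =>
    if ε i = 1 then (if t i ≤ x then 1 else 0) else (if t i < x then -1 else 0) with hstep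
  -- at each `t i` the jump of `step i` compensates that of the indicator function
  set H : ℝ → ℝ := fun x => U.indicator 1 x + ∑ i ∈ A, step i x with hH
  have hstep_loc : ∀ i x, t i ≠ x → ∀ᶠ y in 𝓝 x, step i y = step i x := by
    intro i x hne
    rcases lt_or_gt_of_ne hne with h | h
    · filter_upwards [lt_mem_nhds h] with y hy
      simp only [hstep, h, hy, h.le, hy.le, if_true]
    · filter_upwards [gt_mem_nhds h] with y hy
      simp only [hstep, not_le.2 h, not_le.2 hy, not_lt.2 h.le, not_lt.2 hy.le, if_false]
  have hlc : IsLocallyConstant H := by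
    rw [IsLocallyConstant.iff_eventually_eq]
    intro x
    by_cases hx : ∃ k ∈ A, x = t k
    · obtain ⟨k, hk, rfl⟩ := hx
      have h1 : ∀ᶠ y in 𝓝 (t k), ∀ i ∈ A.erase k, step i y = step i (t k) := by
        rw [Filter.eventually_all_finset]
        intro i hi
        rw [Finset.mem_erase] at hi
        exact hstep_loc i _ fun h => hi.1 (hinj hi.2 hk h)
      have h2 : ∀ᶠ y in 𝓝 (t k), U.indicator (1 : ℝ → ℝ) y + step k y =
          U.indicator (1 : ℝ → ℝ) (t k) + step k (t k) := by
        rcases hloc k hk with ⟨he, hev⟩ | ⟨he, hev⟩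
        · have hval : ∀ y, (y ∈ U ↔ y < t k) → U.indicator (1 : ℝ → ℝ) y + step k y = 1 := by
            intro y hy
            by_cases h : y < t k
            · simp [hstep, he, hy.2 h, not_le.2 h]
            · simp [hstep, he, mt hy.1 h, not_lt.1 h]
          filter_upwards [hev] with y hy
          rw [hval y hy, hval _ hev.self_of_nhds]
        · have hval : ∀ y, (y ∈ U ↔ t k < y) → U.indicator (1 : ℝ → ℝ) y + step k y = 0 := by
            intro y hy
            have hne : ¬ ((-1 : ℝ) = 1) := by norm_num
            by_cases h : t k < y
            · simp [hstep, he, hy.2 h, h, hne]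
            · simp [hstep, he, mt hy.1 h, h, hne]
          filter_upwards [hev] with y hy
          rw [hval y hy, hval _ hev.self_of_nhds]
      filter_upwards [h1, h2] with y hy1 hy2
      simp only [hH]
      rw [← Finset.add_sum_erase A _ hk, ← Finset.add_sum_erase A _ hk, Finset.sum_congr rfl hy1,
        ← add_assoc, ← add_assoc, hy2]
    · push Not at hx
      have h1 : ∀ᶠ y in 𝓝 x, ∀ i ∈ A, step i y = step i x := by
        rw [Filter.eventually_all_finset]
        exact fun i hi => hstep_loc i x (hx i hi).symm
      have h2 : ∀ᶠ y in 𝓝 x, U.indicator (1 : ℝ → ℝ) y = U.indicator (1 : ℝ → ℝ) x := by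
        by_cases hxU : x ∈ U
        · filter_upwards [hU.mem_nhds hxU] with y hy
          rw [Set.indicator_of_mem hy, Set.indicator_of_mem hxU]; rfl
        · have hxc : x ∉ closure U := fun hc => by
            obtain ⟨i, hi, hxi⟩ := hfr x ⟨hc, by rwa [hU.interior_eq]⟩
            exact hx i hi hxi
          filter_upwards [isClosed_closure.isOpen_compl.mem_nhds hxc] with y hy
          rw [Set.indicator_of_notMem (fun h => hy (subset_closure h)),
            Set.indicator_of_notMem hxU]
      filter_upwards [h1, h2] with y hy1 hy2
      simp only [hH]
      rw [Finset.sum_congr rfl hy1, hy2]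
  obtain ⟨R, hR⟩ := (hb.union (A.finite_toSet.image t).isBounded).subset_ball (0 : ℝ)
  have hRU : ∀ x ∈ U, -R < x ∧ x < R := fun x hx => by
    have := hR (Or.inl hx)
    rwa [Metric.mem_ball, dist_zero_right, Real.norm_eq_abs, abs_lt] at this
  have hRt : ∀ i ∈ A, -R < t i ∧ t i < R := fun i hi => by
    have := hR (Or.inr (Set.mem_image_of_mem t hi))
    rwa [Metric.mem_ball, dist_zero_right, Real.norm_eq_abs, abs_lt] at this
  have hH0 : ∀ x, H x = 0 := by
    intro x
    rw [hlc.apply_eq_of_preconnectedSpace x (-R)]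
    simp only [hH]
    rw [Set.indicator_of_notMem fun h => lt_irrefl _ (hRU _ h).1, zero_add]
    refine Finset.sum_eq_zero fun i hi => ?_
    simp [hstep, not_le.2 (hRt i hi).1, (hRt i hi).1.le]
  -- to the right of `U` and of all the `t i`, this says that the jumps add up to zero
  have hε : ∑ i ∈ A, ε i = 0 := by
    have h := hH0 R
    simp only [hH] at h
    rw [Set.indicator_of_notMem fun h => lt_irrefl _ (hRU _ h).2, zero_add] at h
    rw [← h]
    refine Finset.sum_congr rfl fun i hi => ?_
    rcases hloc i hi with ⟨he, -⟩ | ⟨he, -⟩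
    · simp [hstep, he, (hRt i hi).2.le]
    · have hne : ¬ ((-1 : ℝ) = 1) := by norm_num
      simp [hstep, he, (hRt i hi).2, hne]
  have hstep_int : ∀ i ∈ A, (∀ᵐ x, x ∈ Set.Ioc (-R) R →
      step i x * f' x = (Set.Ioc (t i) R).indicator (fun x => ε i * f' x) x) := by
    intro i hi
    filter_upwards [compl_mem_ae_iff.2 (measure_singleton (t i))] with x hx hxR
    have hx' : x ≠ t i := hx
    rcases lt_or_gt_of_ne hx' with h | h
    · rw [Set.indicator_of_notMem fun h' => absurd h'.1 (not_lt.2 h.le)]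
      simp [hstep, not_le.2 h, not_lt.2 h.le]
    · rw [Set.indicator_of_mem (show x ∈ Set.Ioc (t i) R from ⟨h, hxR.2⟩)]
      rcases hloc i hi with ⟨he, -⟩ | ⟨he, -⟩
      · simp [hstep, he, h.le]
      · have hne : ¬ ((-1 : ℝ) = 1) := by norm_num
        simp [hstep, he, h, hne]
  have hint : ∀ a b, IntegrableOn f' (Set.Ioc a b) := fun a b =>
    hf'.integrableOn_Ioc
  have hUsub : U ⊆ Set.Ioc (-R) R := fun x hx => ⟨(hRU x hx).1, (hRU x hx).2.le⟩
  calc ∫ x in U, f' x = ∫ x in Set.Ioc (-R) R, U.indicator f' x := by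
        rw [setIntegral_indicator hU.measurableSet, Set.inter_eq_right.2 hUsub]
    _ = ∫ x in Set.Ioc (-R) R,
          -∑ i ∈ A, (Set.Ioc (t i) R).indicator (fun x => ε i * f' x) x := by
        refine setIntegral_congr_ae measurableSet_Ioc ?_
        have hall := (Filter.eventually_all_finset A).2 hstep_int
        filter_upwards [hall] with x hx hxR
        rw [← Finset.sum_congr rfl fun i hi => hx i hi hxR, ← Finset.sum_mul]
        have h := hH0 x
        simp only [hH] at h
        rw [← neg_mul, ← eq_neg_of_add_eq_zero_left h]
        by_cases hxU : x ∈ U <;> simp [hxU]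
    _ = -∑ i ∈ A, ∫ x in Set.Ioc (-R) R,
          (Set.Ioc (t i) R).indicator (fun x => ε i * f' x) x := by
        rw [integral_neg, integral_finsetSum]
        exact fun i _ => (IntegrableOn.indicator ((hint _ _).const_mul _) measurableSet_Ioc)
    _ = -∑ i ∈ A, ε i * (f R - f (t i)) := by
        congr 1
        refine Finset.sum_congr rfl fun i hi => ?_
        rw [setIntegral_indicator measurableSet_Ioc, integral_const_mul,
          Set.inter_eq_right.2 (Set.Ioc_subset_Ioc_left (hRt i hi).1.le),
          ← intervalIntegral.integral_of_le (hRt i hi).2.le,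
          intervalIntegral.integral_eq_sub_of_hasDerivAt (fun x _ => hf x)
            (hf'.intervalIntegrable _ _)]
    _ = ∑ i ∈ A, ε i * f (t i) := by
        simp only [mul_sub, Finset.sum_sub_distrib, ← Finset.sum_mul, hε]
        ring

/-- The Euclidean plane. -/
abbrev R2 : Type := EuclideanSpace ℝ (Fin 2)

/-- The point of `ℝ³` with `j`-th coordinate `t` and remaining coordinates `y`. -/
def coordPoint (j : Fin 3) (t : ℝ) (y : R2) : R3 :=
  WithLp.toLp 2 (Fin.insertNth (α := fun _ => ℝ) j t y.ofLp)

@[simp] theorem coordPoint_apply_same (j : Fin 3) (t : ℝ) (y : R2) : coordPoint j t y j = t := by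
  simp [coordPoint]

@[simp] theorem coordPoint_apply_succAbove (j : Fin 3) (t : ℝ) (y : R2) (k : Fin 2) :
    coordPoint j t y (j.succAbove k) = y k := by
  simp [coordPoint]

theorem ext_succAbove (j : Fin 3) {x y : R3} (h : x j = y j)
    (h' : ∀ k, x (j.succAbove k) = y (j.succAbove k)) : x = y := by
  ext i
  exact Fin.succAboveCases j (α := fun i => x i = y i) h h' i

/-- The coordinates other than the `j`-th one. -/
def dropCoord (j : Fin 3) : R3 →ₗ[ℝ] R2 where
  toFun x := WithLp.toLp 2 fun k => x (j.succAbove k)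
  map_add' _ _ := rfl
  map_smul' _ _ := rfl

@[simp] theorem dropCoord_apply (j : Fin 3) (x : R3) (k : Fin 2) :
    dropCoord j x k = x (j.succAbove k) := rfl

@[simp] theorem dropCoord_coordPoint (j : Fin 3) (t : ℝ) (y : R2) :
    dropCoord j (coordPoint j t y) = y := by
  ext k; simp

theorem coordPoint_eq_add (j : Fin 3) (t : ℝ) (y : R2) :
    coordPoint j t y = coordPoint j 0 y + t • EuclideanSpace.single j (1 : ℝ) := by
  refine ext_succAbove j ?_ fun k => ?_
  · simp
  · simp [Fin.succAbove_ne j k]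

theorem inner_coordPoint (j : Fin 3) (n : R3) (t : ℝ) (y : R2) :
    inner ℝ n (coordPoint j t y) = n j * t + ∑ k, n (j.succAbove k) * y k := by
  rw [← dot_eq_inner, dot, Fin.sum_univ_succAbove _ j]
  simp

theorem continuous_coordPoint (j : Fin 3) : Continuous fun z : ℝ × R2 => coordPoint j z.1 z.2 := by
  refine (PiLp.continuous_toLp 2 _).comp (continuous_pi fun i => ?_)
  refine Fin.succAboveCases j (α := fun i => Continuous fun z : ℝ × R2 =>
    Fin.insertNth (α := fun _ => ℝ) j z.1 z.2.ofLp i) ?_ (fun k => ?_) i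
  · simpa using continuous_fst
  · simp only [Fin.insertNth_apply_succAbove]
    fun_prop

theorem measurePreserving_coordPoint (j : Fin 3) :
    MeasurePreserving (fun z : ℝ × R2 => coordPoint j z.1 z.2) := by
  have h1 : MeasurePreserving (Prod.map id (@WithLp.ofLp 2 (Fin 2 → ℝ)) : ℝ × R2 → _) :=
    (MeasurePreserving.id volume).prod (PiLp.volume_preserving_ofLp (Fin 2))
  have h2 := (volume_preserving_piFinSuccAbove (fun _ : Fin 3 => ℝ) j).symm
  exact (PiLp.volume_preserving_toLp (Fin 3)).comp (h2.comp h1)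

/-- Fubini's theorem along the lines parallel to a coordinate axis. -/
theorem setIntegral_eq_integral_coordPoint (j : Fin 3) {K : Set R3} (hK : MeasurableSet K)
    {f : R3 → ℝ} (hf : IntegrableOn f K) :
    ∫ x in K, f x = ∫ y : R2, ∫ t in {t | coordPoint j t y ∈ K}, f (coordPoint j t y) := by
  have hm := measurePreserving_coordPoint j
  have hi : Integrable (K.indicator f) := (integrable_indicator_iff hK).2 hf
  rw [← integral_indicator hK, ← hm.map_eq, integral_map hm.measurable.aemeasurable
    (by rw [hm.map_eq]; exact hi.aestronglyMeasurable)]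
  have hi' : Integrable (fun z : ℝ × R2 => K.indicator f (coordPoint j z.1 z.2))
      (volume.prod volume) := hm.integrable_comp_of_integrable hi
  rw [Measure.volume_eq_prod, integral_prod_symm _ hi']
  refine integral_congr_ae (.of_forall fun y => ?_)
  have hKy : MeasurableSet {t | coordPoint j t y ∈ K} := by
    have : Measurable fun t => coordPoint j t y :=
      ((continuous_coordPoint j).comp (by fun_prop : Continuous fun t : ℝ => (t, y))).measurable
    exact this hK
  simp only
  rw [← integral_indicator hKy]
  rfl

/-- The linear parametrization of the plane orthogonal to `n` by the coordinates other than the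
`j`-th one. -/
def planeParam (j : Fin 3) (n : R3) : R2 →ₗ[ℝ] R3 where
  toFun y := coordPoint j (-(∑ k, n (j.succAbove k) * y k) / n j) y
  map_add' y z := by
    refine ext_succAbove j ?_ fun k => ?_
    · simp [mul_add, Finset.sum_add_distrib]; ring
    · simp
  map_smul' c y := by
    refine ext_succAbove j ?_ fun k => ?_
    · simp; ring
    · simp

/-- The area factor of the graph parametrization is the inverse of the `j`-th component of the unit
normal. -/
theorem normDet_planeParam {j : Fin 3} {n : R3} (hn : ‖n‖ = 1) (hj : n j ≠ 0) :
    (planeParam j n).normDet = |n j|⁻¹ := by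
  have h := (planeParam j n).normDet_sq_eq_det_gram (EuclideanSpace.basisFun (Fin 2) ℝ)
  have hsum : n j ^ 2 + (n (j.succAbove 0) ^ 2 + n (j.succAbove 1) ^ 2) = 1 := by
    have h1 := dot_self n
    rw [hn, one_pow, dot, Fin.sum_univ_succAbove _ j, Fin.sum_univ_two] at h1
    linarith [h1]
  have hin : ∀ a b, inner ℝ (planeParam j n (EuclideanSpace.basisFun (Fin 2) ℝ a))
      (planeParam j n (EuclideanSpace.basisFun (Fin 2) ℝ b)) =
      n (j.succAbove a) * n (j.succAbove b) / n j ^ 2 + if b = a then 1 else 0 := by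
    intro a b
    change inner ℝ (coordPoint j _ _) (coordPoint j _ _) = _
    rw [inner_coordPoint]
    simp
    field_simp
  rw [Matrix.det_fin_two] at h
  simp only [Matrix.gram_apply, hin] at h
  have h2 : (planeParam j n).normDet ^ 2 = (|n j|⁻¹) ^ 2 := by
    rw [inv_pow, sq_abs]
    have h' : (planeParam j n).normDet ^ 2 =
      (n (j.succAbove 0) * n (j.succAbove 0) / n j ^ 2 + 1) *
      (n (j.succAbove 1) * n (j.succAbove 1) / n j ^ 2 + 1) -
      (n (j.succAbove 0) * n (j.succAbove 1) / n j ^ 2) *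
      (n (j.succAbove 1) * n (j.succAbove 0) / n j ^ 2) := by simpa using h
    rw [h']
    field_simp
    linear_combination n j ^ 2 * hsum
  exact (pow_left_inj₀ (planeParam j n).normDet_nonneg (by positivity) two_ne_zero).1 h2

/-- The height over `y`, in the direction of the `j`-th axis, of the plane `n · x = c`. -/
def planeHeight (j : Fin 3) (n : R3) (c : ℝ) (y : R2) : ℝ :=
  (c - ∑ k, n (j.succAbove k) * y k) / n j

theorem inner_coordPoint_eq_iff {j : Fin 3} {n : R3} (hj : n j ≠ 0) (c t : ℝ) (y : R2) :
    inner ℝ n (coordPoint j t y) = c ↔ t = planeHeight j n c y := by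
  rw [inner_coordPoint, planeHeight, eq_div_iff hj]
  constructor <;> intro h <;> linarith

theorem continuous_coordPoint_planeHeight (j : Fin 3) (n : R3) (c : ℝ) :
    Continuous fun y => coordPoint j (planeHeight j n c y) y := by
  refine (continuous_coordPoint j).comp (Continuous.prodMk ?_ continuous_id)
  fun_prop

theorem coordPoint_planeHeight {j : Fin 3} {n : R3} (c : ℝ) (y : R2) :
    coordPoint j (planeHeight j n c y) y =
      planeParam j n y + (c / n j) • EuclideanSpace.single j (1 : ℝ) := by
  change _ = coordPoint j _ y + _
  rw [coordPoint_eq_add, coordPoint_eq_add j (-(∑ k, n (j.succAbove k) * y k) / n j) y, add_assoc,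
    ← add_smul, planeHeight]
  congr 2
  ring

/-- Integrals over a piece of a plane in terms of its projection along a coordinate axis: the area
is multiplied by the corresponding component of the unit normal. -/
theorem setIntegral_plane {j : Fin 3} {n : R3} (hn : ‖n‖ = 1) (hj : n j ≠ 0) (c : ℝ) {X : Set R3}
    (hX : MeasurableSet X) (hXc : ∀ x ∈ X, inner ℝ n x = c) {f : R3 → ℝ} (hf : Continuous f) :
    |n j| * ∫ x in X, f x ∂μHE[2] =
      ∫ y in {y | coordPoint j (planeHeight j n c y) y ∈ X},
        f (coordPoint j (planeHeight j n c y) y) := by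
  set ψ : R2 → R3 := fun y => coordPoint j (planeHeight j n c y) y with hψ
  have hψc : Continuous ψ := continuous_coordPoint_planeHeight j n c
  have himg : ∀ s : Set R2, μHE[2] (ψ '' s) = ENNReal.ofReal |n j|⁻¹ * volume s := by
    intro s
    have h1 := (planeParam j n).euclideanHausdorffMeasure_image_eq_normDet_mul_volume s
    rw [finrank_euclideanSpace_fin, normDet_planeParam hn hj] at h1
    rw [← h1]
    have h2 : ψ '' s = (fun x => x + (c / n j) • EuclideanSpace.single j (1 : ℝ)) ''
        (planeParam j n '' s) := by
      rw [Set.image_image]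
      exact Set.image_congr fun y _ => coordPoint_planeHeight c y
    rw [h2, (isometry_add_right _).euclideanHausdorffMeasure_image]
  have hsub : X ⊆ Set.range ψ := by
    intro x hx
    refine ⟨dropCoord j x, ?_⟩
    have hx' : x = coordPoint j (x j) (dropCoord j x) :=
      ext_succAbove j (by simp) fun k => by simp
    have h := hXc x hx
    rw [hx', inner_coordPoint_eq_iff hj] at h
    simp only [hψ]
    rw [← h]
    exact hx'.symm
  have hmap : (μHE[2] : Measure R3).restrict X =
      (ENNReal.ofReal |n j|⁻¹ • (volume : Measure R2).map ψ).restrict X := by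
    ext A hA
    rw [Measure.restrict_apply hA, Measure.restrict_apply hA, Measure.smul_apply,
      Measure.map_apply hψc.measurable (hA.inter hX), smul_eq_mul, ← himg,
      Set.image_preimage_eq_of_subset (Set.inter_subset_right.trans hsub)]
  rw [hmap, Measure.restrict_smul, integral_smul_measure,
    setIntegral_map hX hf.aestronglyMeasurable hψc.aemeasurable,
    ENNReal.toReal_ofReal (by positivity), smul_eq_mul, ← mul_assoc,
    mul_inv_cancel₀ (abs_ne_zero.2 hj), one_mul]
  rfl

/-- The projection of a flat piece on a coordinate plane is negligible if it is not onto. -/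
theorem volume_dropCoord_eq_zero {j : Fin 3} {X : Set R3}
    (hX : (vectorSpan ℝ X).map (dropCoord j) ≠ ⊤) :
    volume (dropCoord j '' (affineSpan ℝ X : Set R3)) = 0 := by
  have hne : (affineSpan ℝ X).map (dropCoord j).toAffineMap ≠ ⊤ := by
    intro h
    apply hX
    have h1 := congrArg AffineSubspace.direction h
    rw [AffineSubspace.map_direction, AffineSubspace.direction_top, direction_affineSpan] at h1
    simpa using h1
  exact measure_mono_null (by simp) (Measure.addHaar_affineSubspace volume _ hne)

theorem dirDeriv_single (j : Fin 3) (p : MvPolynomial (Fin 3) ℝ) :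
    dirDeriv (EuclideanSpace.single j (1 : ℝ)) p = MvPolynomial.pderiv j p := by
  simp [dirDeriv]

theorem hasDerivAt_eval_coordPoint (p : MvPolynomial (Fin 3) ℝ) (j : Fin 3) (y : R2) (t : ℝ) :
    HasDerivAt (fun t => MvPolynomial.eval (coordPoint j t y).ofLp p)
      (MvPolynomial.eval (coordPoint j t y).ofLp (MvPolynomial.pderiv j p)) t := by
  have h := hasDerivAt_eval_line p (coordPoint j 0 y) (EuclideanSpace.single j (1 : ℝ)) t
  rw [dirDeriv_single] at h
  simpa only [← coordPoint_eq_add] using h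

namespace PolyMesh

variable {Ω : Set R3} (M : PolyMesh Ω)

/-- Almost every line parallel to a coordinate axis misses the edges. -/
theorem ae_coordPoint_notMem_skeleton (j : Fin 3) :
    ∀ᵐ y : R2, ∀ t, coordPoint j t y ∉ M.skeleton := by
  have hnull : volume (⋃ e : M.edges, dropCoord j '' (affineSpan ℝ (e : Set R3) : Set R3)) = 0 := by
    refine measure_iUnion_null fun e => volume_dropCoord_eq_zero fun h => ?_
    have h1 := Submodule.finrank_map_le (dropCoord j) (vectorSpan ℝ (e : Set R3))
    rw [h, (M.isFlat_edge e).finrank_vectorSpan] at h1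
    simp at h1
  filter_upwards [compl_mem_ae_iff.2 hnull] with y hy t ht
  obtain ⟨e, he⟩ := Set.mem_iUnion.1 ht
  refine hy (Set.mem_iUnion.2 ⟨e, coordPoint j t y, ?_, dropCoord_coordPoint j t y⟩)
  exact closure_minimal (subset_affineSpan ℝ _) (AffineSubspace.closed_of_finiteDimensional _) he

/-- Almost every line parallel to a coordinate axis misses the faces parallel to it. -/
theorem ae_coordPoint_notMem_face {K : M.cells} (j : Fin 3) (σ : M.facesOf K)
    (hσ : outwardNormal (K : Set R3) (σ.1 : Set R3) j = 0) :
    ∀ᵐ y : R2, ∀ t, coordPoint j t y ∉ (σ.1 : Set R3) := by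
  obtain ⟨hn, hns, -⟩ := M.outwardNormal_spec σ
  set n := outwardNormal (K : Set R3) (σ.1 : Set R3)
  have hnull : volume (dropCoord j '' (affineSpan ℝ (σ.1 : Set R3) : Set R3)) = 0 := by
    refine volume_dropCoord_eq_zero fun h => ?_
    -- the projected plane would contain the projection of the normal, to which it is orthogonal
    obtain ⟨w, hw, hwn⟩ := (h ▸ Submodule.mem_top : dropCoord j n ∈
      (vectorSpan ℝ (σ.1 : Set R3)).map (dropCoord j))
    have hwn' : ∀ k, w (j.succAbove k) = n (j.succAbove k) := fun k => by
      have := congrArg (fun z : R2 => z k) hwn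
      simpa using this
    have h1 := hns w hw
    have h2 := dot_self n
    rw [← dot_eq_inner, dot, Fin.sum_univ_succAbove _ j, hσ] at h1
    rw [hn, dot, Fin.sum_univ_succAbove _ j, hσ] at h2
    simp only [hwn', zero_mul] at h1
    rw [mul_zero, h1] at h2
    norm_num at h2
  filter_upwards [compl_mem_ae_iff.2 hnull] with y hy t ht
  exact hy ⟨coordPoint j t y, mem_affineSpan ℝ ht, dropCoord_coordPoint j t y⟩

/-- The divergence theorem for polynomials on a cell: integrate along the lines parallel to the
`j`-th axis. A generic line crosses the boundary only at points of faces that are not parallel to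
it, and the factor `|n j|` of `setIntegral_plane` combines with the sign of the crossing to give
`n j`. -/
theorem integral_pderiv_cell (K : M.cells) (p : MvPolynomial (Fin 3) ℝ) (j : Fin 3) :
    ∫ x in (K : Set R3), MvPolynomial.eval x.ofLp (MvPolynomial.pderiv j p) =
      ∑ σ : M.facesOf K, outwardNormal (K : Set R3) (σ.1 : Set R3) j *
        ∫ x in (σ.1 : Set R3), MvPolynomial.eval x.ofLp p ∂μHE[2] := by
  classical
  have hKo := M.isOpen_cell K
  set n : M.facesOf K → R3 := fun σ => outwardNormal (K : Set R3) (σ.1 : Set R3) with hn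
  have hspec : ∀ σ, ‖n σ‖ = 1 ∧ (∀ w ∈ vectorSpan ℝ (σ.1 : Set R3), inner ℝ (n σ) w = 0) ∧
      ∀ y ∈ (σ.1 : Set R3), ∃ r > 0, ∀ x ∈ Metric.ball y r,
        x ∈ (K : Set R3) ↔ inner ℝ (n σ) (x - y) < 0 := fun σ => M.outwardNormal_spec σ
  choose z hz using fun σ : M.facesOf K => (M.isFlat_face σ.1).nonempty
  set c : M.facesOf K → ℝ := fun σ => inner ℝ (n σ) (z σ) with hc
  have hplane : ∀ σ, ∀ x ∈ (σ.1 : Set R3), inner ℝ (n σ) x = c σ := fun σ x hx => by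
    have := (hspec σ).2.1 _ (vsub_mem_vectorSpan ℝ hx (hz σ))
    rwa [vsub_eq_sub, inner_sub_right, sub_eq_zero] at this
  set ψ : M.facesOf K → R2 → R3 := fun σ y => coordPoint j (planeHeight j (n σ) (c σ) y) y with hψ
  set P : M.facesOf K → Set R2 := fun σ => {y | ψ σ y ∈ (σ.1 : Set R3)} with hP
  set f : R3 → ℝ := fun x => MvPolynomial.eval x.ofLp p with hf
  have hfc : Continuous f := continuous_eval p
  have hψc : ∀ σ, Continuous (ψ σ) := fun σ => continuous_coordPoint_planeHeight j (n σ) (c σ)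
  have hPm : ∀ σ, MeasurableSet (P σ) := fun σ =>
    (hψc σ).measurable (M.isFlat_face σ.1).measurableSet
  -- the inner integral along a generic line
  have hline : ∀ᵐ y : R2, ∫ t in {t | coordPoint j t y ∈ (K : Set R3)},
      MvPolynomial.eval (coordPoint j t y).ofLp (MvPolynomial.pderiv j p) =
        ∑ σ : M.facesOf K, if n σ j = 0 then 0 else
          (SignType.sign (n σ j) : ℝ) * (P σ).indicator (fun y => f (ψ σ y)) y := by
    have hall : ∀ᵐ y : R2, ∀ σ : M.facesOf K, n σ j = 0 →
        ∀ t, coordPoint j t y ∉ (σ.1 : Set R3) := by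
      rw [ae_all_iff]
      intro σ
      by_cases h : n σ j = 0
      · filter_upwards [M.ae_coordPoint_notMem_face j σ h] with y hy _ using hy
      · exact .of_forall fun y h' => absurd h' h
    filter_upwards [hall, M.ae_coordPoint_notMem_skeleton j] with y hy1 hy2
    have hcy : Continuous fun t : ℝ => coordPoint j t y :=
      (continuous_coordPoint j).comp (by fun_prop : Continuous fun t : ℝ => (t, y))
    set A : Finset (M.facesOf K) := {σ | n σ j ≠ 0 ∧ y ∈ P σ} with hA
    have hmem : ∀ σ, σ ∈ A ↔ n σ j ≠ 0 ∧ y ∈ P σ := fun σ => by simp [hA]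
    have key := integral_deriv_eq_sum_of_frontier (hKo.preimage hcy) ?_ A
      (fun σ => planeHeight j (n σ) (c σ) y) (fun σ => (SignType.sign (n σ j) : ℝ)) ?_ ?_ ?_
      (fun t => hasDerivAt_eval_coordPoint p j y t) ((continuous_eval _).comp hcy)
    · refine key.trans ?_
      rw [hA, Finset.sum_filter]
      refine Finset.sum_congr rfl fun σ _ => ?_
      by_cases h : n σ j = 0
      · simp [h]
      · by_cases h' : y ∈ P σ
        · simp only [h, h', ne_eq, not_false_eq_true, and_self, if_true, if_false,
            Set.indicator_of_mem]
          rfl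
        · simp [h, h']
    · -- the line meets the cell in a bounded set
      obtain ⟨R, hR⟩ := (M.isFlat_cell K).isBounded.exists_norm_le
      refine isBounded_iff_forall_norm_le.2 ⟨R, fun t ht => ?_⟩
      have h1 := PiLp.norm_apply_le (coordPoint j t y) j
      rw [coordPoint_apply_same] at h1
      exact h1.trans (hR _ ht)
    · intro σ hσ τ hτ hst
      have h1 : y ∈ P σ := ((hmem σ).1 hσ).2
      have h2 : y ∈ P τ := ((hmem τ).1 hτ).2
      have h3 : ψ σ y = ψ τ y := congrArg (fun t => coordPoint j t y) hst
      simp only [hP, Set.mem_ofPred_eq] at h1 h2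
      rw [← h3] at h2
      exact Subtype.ext (M.eq_of_mem_closure_face h1 (subset_closure h2))
    · intro σ hσ
      obtain ⟨hj, hPσ⟩ := (hmem σ).1 hσ
      obtain ⟨r, hr, hloc⟩ := (hspec σ).2.2 _ hPσ
      have hev : ∀ᶠ t in 𝓝 (planeHeight j (n σ) (c σ) y),
          (coordPoint j t y ∈ (K : Set R3) ↔
            n σ j * (t - planeHeight j (n σ) (c σ) y) < 0) := by
        filter_upwards [hcy.continuousAt.preimage_mem_nhds (Metric.ball_mem_nhds _ hr)] with t ht
        rw [hloc _ ht, inner_sub_right]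
        simp only [hψ, inner_coordPoint]
        ring_nf
      rcases lt_or_gt_of_ne hj with h | h
      · right
        refine ⟨by simp [sign_neg h], hev.mono fun t ht => ?_⟩
        refine ht.trans ⟨fun h' => ?_, fun h' => mul_neg_of_neg_of_pos h (sub_pos.2 h')⟩
        exact sub_pos.1 (pos_of_mul_neg_right h' h.le)
      · left
        refine ⟨by simp [sign_pos h], hev.mono fun t ht => ?_⟩
        refine ht.trans ⟨fun h' => ?_, fun h' => mul_neg_of_pos_of_neg h (sub_neg.2 h')⟩
        exact sub_neg.1 (neg_of_mul_neg_right h' h.le)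
    · intro t ht
      have h1 : coordPoint j t y ∈ bdry (K : Set R3) := by
        rw [bdry_eq_frontier hKo]
        exact hcy.frontier_preimage_subset _ ht
      obtain ⟨σ, hσ⟩ := M.exists_face_of_mem_bdry h1 (hy2 t)
      have hj : n σ j ≠ 0 := fun h => hy1 σ h t hσ
      have ht' : t = planeHeight j (n σ) (c σ) y :=
        (inner_coordPoint_eq_iff hj _ _ _).1 (hplane σ _ hσ)
      refine ⟨σ, (hmem σ).2 ⟨hj, ?_⟩, ht'⟩
      simp only [hP, hψ, Set.mem_ofPred_eq]
      rwa [← ht']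
  have hPint : ∀ σ, n σ j ≠ 0 → IntegrableOn (fun y => f (ψ σ y)) (P σ) := by
    intro σ hj
    have hb : Bornology.IsBounded (P σ) := by
      obtain ⟨R, hR⟩ := (M.isFlat_face σ.1).isBounded.exists_norm_le
      have hL := (dropCoord j).toContinuousLinearMap.le_opNorm
      refine isBounded_iff_forall_norm_le.2 ⟨‖(dropCoord j).toContinuousLinearMap‖ * R,
        fun y hy => ?_⟩
      have h1 := hL (ψ σ y)
      simp only [hψ, LinearMap.coe_toContinuousLinearMap', dropCoord_coordPoint] at h1
      exact h1.trans (mul_le_mul_of_nonneg_left (hR _ hy) (norm_nonneg _))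
    exact ((hfc.comp (hψc σ)).continuousOn.integrableOn_compact hb.isCompact_closure).mono_set
      subset_closure
  have hvol : IntegrableOn (fun x : R3 => MvPolynomial.eval x.ofLp (MvPolynomial.pderiv j p))
      (K : Set R3) := by
    have := (M.isFlat_cell K).integrableOn (continuous_eval (MvPolynomial.pderiv j p))
    rwa [euclideanHausdorffMeasure_three] at this
  rw [setIntegral_eq_integral_coordPoint j hKo.measurableSet hvol, integral_congr_ae hline,
    integral_finsetSum]
  · refine Finset.sum_congr rfl fun σ _ => ?_
    by_cases hj : n σ j = 0
    · simp only [hj, if_true, integral_zero]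
      change 0 = n σ j * _
      rw [hj, zero_mul]
    · simp only [hj, if_false]
      rw [integral_const_mul, integral_indicator (hPm σ),
        ← setIntegral_plane (hspec σ).1 hj (c σ) (M.isFlat_face σ.1).measurableSet (hplane σ) hfc,
        ← mul_assoc, sign_mul_abs]
  · intro σ _
    by_cases hj : n σ j = 0
    · simp [hj]
    · simp only [hj, if_false]
      exact ((hPint σ hj).integrable_indicator (hPm σ)).const_mul _

end PolyMesh

namespace PolyMesh

variable {Ω : Set R3} (M : PolyMesh Ω) (G : Set R3)

/-! ### Reaching the boundary without crossing the network -/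

/-- Two cells are neighbours if they share a face which is not a fracture face. -/
def Neighbours (K L : M.cells) : Prop :=
  ∃ σ : M.faces, ¬ M.IsFracture G σ ∧ (σ : Set R3) ⊆ bdry K ∧ (σ : Set R3) ⊆ bdry L

theorem closure_cell_subset (K : M.cells) : closure (K : Set R3) ⊆ closure Ω := by
  rw [M.closure_domain]
  exact fun x hx => Set.mem_biUnion K.2 hx

theorem cell_subset (hΩ : IsPolyhedron Ω) (K : M.cells) : (K : Set R3) ⊆ Ω := by
  intro x hx
  obtain ⟨r, hr, hb⟩ := Metric.isOpen_iff.1 (M.isOpen_cell K) x hx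
  exact hΩ.mem_of_ball_subset_closure hr
    (hb.trans (subset_closure.trans (M.closure_cell_subset K)))

theorem isOpen_domain (hΩ : IsPolyhedron Ω) : IsOpen Ω := by
  obtain ⟨-, T, hT⟩ := hΩ
  rw [hT]
  exact isOpen_interior

theorem eq_of_mem_closure_cell {K L : M.cells} {x : R3} (hx : x ∈ (K : Set R3))
    (hL : x ∈ closure (L : Set R3)) : K = L := by
  by_contra hne
  obtain ⟨y, hyK, hyL⟩ := mem_closure_iff.1 hL _ (M.isOpen_cell K) hx
  exact Set.disjoint_left.1 (M.disjoint_cells K.1 K.2 L.1 L.2 fun h => hne (Subtype.ext h)) hyK hyL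

theorem disjoint_cell_face (hΩ : IsPolyhedron Ω) (K : M.cells) (σ : M.faces) :
    Disjoint (K : Set R3) σ := by
  rw [Set.disjoint_left]
  intro x hxK hxσ
  rcases M.face_cases σ.1 σ.2 with ⟨-, K₁, h₁, K₂, h₂, hne, hs₁, hs₂⟩ | ⟨hs, -⟩
  · have e1 := M.eq_of_mem_closure_cell (L := ⟨K₁, h₁⟩) hxK (hs₁ hxσ).1
    have e2 := M.eq_of_mem_closure_cell (L := ⟨K₂, h₂⟩) hxK (hs₂ hxσ).1
    exact hne (congrArg Subtype.val (e1.symm.trans e2))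
  · have h := hs hxσ
    rw [frontier, (isOpen_domain hΩ).interior_eq] at h
    exact h.2 (M.cell_subset hΩ K hxK)

theorem disjoint_cell_closure_face (hΩ : IsPolyhedron Ω) (K : M.cells) (σ : M.faces) :
    Disjoint (K : Set R3) (closure σ) :=
  (M.disjoint_cell_face hΩ K σ).closure_right (M.isOpen_cell K)

theorem disjoint_cell_skeleton (hΩ : IsPolyhedron Ω) (K : M.cells) :
    Disjoint (K : Set R3) M.skeleton := by
  rw [skeleton, Set.disjoint_iUnion_right]
  intro e
  obtain ⟨σ, hσ, he⟩ := M.edge_cases e.1 e.2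
  exact (M.disjoint_cell_closure_face hΩ K ⟨σ, hσ⟩).mono_right
    (closure_minimal (he.trans Set.sdiff_subset) isClosed_closure)

variable {G}

theorem Compliant.isClosed (hM : M.Compliant G) : IsClosed G := by
  rw [Compliant] at hM
  rw [hM]
  exact isClosed_iUnion_of_finite fun σ => isClosed_closure

theorem Compliant.disjoint_cell (hM : M.Compliant G) (hΩ : IsPolyhedron Ω) (K : M.cells) :
    Disjoint (K : Set R3) G := by
  rw [Compliant] at hM
  rw [hM, Set.disjoint_iUnion_right]
  exact fun σ => M.disjoint_cell_closure_face hΩ K σ.1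

theorem skeleton_null : μHE[2] M.skeleton = 0 := by
  refine measure_iUnion_null fun e => ?_
  refine (Measure.euclideanHausdorffMeasure_zero_or_top one_lt_two _).resolve_right ?_
  exact (M.isFlat_edge e).measure_closure_lt_top.ne

/-- Almost every point can be joined to a given point by a segment that avoids the edges. -/
theorem ae_disjoint_segment_skeleton {a : R3} (ha : a ∉ M.skeleton) :
    ∀ᵐ c : R3, Disjoint (segment ℝ a c) M.skeleton := by
  -- the exceptional points lie in the planes spanned by `a` and the edges
  have hnull : volume (⋃ e : M.edges, (affineSpan ℝ (insert a (e : Set R3)) : Set R3)) = 0 := by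
    refine measure_iUnion_null fun e => Measure.addHaar_affineSubspace _ _ fun h => ?_
    have h1 := finrank_vectorSpan_insert_le_set ℝ (e : Set R3) a
    rw [← direction_affineSpan, h, AffineSubspace.direction_top,
      (M.isFlat_edge e).finrank_vectorSpan] at h1
    simp at h1
  filter_upwards [compl_mem_ae_iff.2 hnull] with c hc
  rw [Set.disjoint_left]
  intro x hx hxs
  obtain ⟨e, he⟩ := Set.mem_iUnion.1 hxs
  refine hc (Set.mem_iUnion.2 ⟨e, ?_⟩)
  rw [segment_eq_image_lineMap] at hx
  obtain ⟨t, -, rfl⟩ := hx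
  have ht : t ≠ 0 := by
    rintro rfl
    rw [AffineMap.lineMap_apply_zero] at hxs
    exact ha hxs
  have hmem : AffineMap.lineMap a c t ∈ affineSpan ℝ (insert a (e : Set R3)) :=
    closure_minimal ((Set.subset_insert _ _).trans (subset_affineSpan ℝ _))
      (AffineSubspace.closed_of_finiteDimensional _) he
  have := AffineMap.lineMap_mem t⁻¹ (mem_affineSpan ℝ (Set.mem_insert a (e : Set R3))) hmem
  simpa [AffineMap.lineMap_apply, smul_smul, inv_mul_cancel₀ ht] using this

/-- All the cells that meet a ball which does not meet the network are on the same side: join two of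
them by a path with a generic corner, which avoids the edges. -/
theorem neighbours_of_ball (hΩ : IsPolyhedron Ω) {z : R3} {r : ℝ} (hb : Metric.ball z r ⊆ Ω \ G)
    {K L : M.cells} (hK : (Metric.ball z r ∩ K).Nonempty) (hL : (Metric.ball z r ∩ L).Nonempty) :
    Relation.EqvGen (M.Neighbours G) K L := by
  obtain ⟨a, hab, haK⟩ := hK
  obtain ⟨b, hbb, hbL⟩ := hL
  have hae := (M.ae_disjoint_segment_skeleton (a := a)
    fun h => Set.disjoint_left.1 (M.disjoint_cell_skeleton hΩ K) haK h).and
    (M.ae_disjoint_segment_skeleton (a := b)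
      fun h => Set.disjoint_left.1 (M.disjoint_cell_skeleton hΩ L) hbL h)
  obtain ⟨c, hcb, hc1, hc2⟩ : ∃ c ∈ Metric.ball z r, Disjoint (segment ℝ a c) M.skeleton ∧
      Disjoint (segment ℝ b c) M.skeleton := by
    by_contra! hcon
    have hz : volume (Metric.ball z r) = 0 :=
      measure_mono_null (fun c hc (h : _ ∧ _) => hcon c hc h.1 h.2) (ae_iff.1 hae)
    exact (Metric.isOpen_ball.measure_pos volume ⟨a, hab⟩).ne' hz
  by_contra hnot
  have hcl : ∀ p : M.cells → Prop, IsClosed (⋃ N ∈ {N | p N}, closure (N : Set R3)) := fun p =>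
    (Set.toFinite _).isClosed_biUnion fun N _ => isClosed_closure
  have hS : IsPreconnected (segment ℝ a c ∪ segment ℝ b c) :=
    IsPreconnected.union c (right_mem_segment ℝ a c) (right_mem_segment ℝ b c)
      (convex_segment a c).isPreconnected (convex_segment b c).isPreconnected
  have hSb : segment ℝ a c ∪ segment ℝ b c ⊆ Metric.ball z r :=
    Set.union_subset ((convex_ball z r).segment_subset hab hcb)
      ((convex_ball z r).segment_subset hbb hcb)
  obtain ⟨y, hyS, hy1, hy2⟩ := isPreconnected_closed_iff.1 hS _ _
    (hcl fun N => Relation.EqvGen (M.Neighbours G) K N)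
    (hcl fun N => ¬ Relation.EqvGen (M.Neighbours G) K N) (fun y hy => by
      have hyΩ := subset_closure (hb (hSb hy)).1
      rw [M.closure_domain] at hyΩ
      simp only [Set.mem_iUnion] at hyΩ
      obtain ⟨N, hN, hyN⟩ := hyΩ
      by_cases h : Relation.EqvGen (M.Neighbours G) K ⟨N, hN⟩
      · exact Or.inl (Set.mem_biUnion (x := (⟨N, hN⟩ : M.cells)) h hyN)
      · exact Or.inr (Set.mem_biUnion (x := (⟨N, hN⟩ : M.cells)) h hyN))
    ⟨a, Or.inl (left_mem_segment ℝ a c),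
      Set.mem_biUnion (x := K) (Relation.EqvGen.refl K) (subset_closure haK)⟩
    ⟨b, Or.inr (left_mem_segment ℝ b c), Set.mem_biUnion (x := L) hnot (subset_closure hbL)⟩
  simp only [Set.mem_iUnion] at hy1 hy2
  obtain ⟨K₁, hK₁, hy1⟩ := hy1
  obtain ⟨K₂, hK₂, hy2⟩ := hy2
  have hne : K₁ ≠ K₂ := fun h => hK₂ (h ▸ hK₁)
  have hys : y ∉ M.skeleton := by
    rcases hyS with h | h
    · exact Set.disjoint_left.1 hc1 h
    · exact Set.disjoint_left.1 hc2 h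
  have hb1 : y ∈ bdry (K₁ : Set R3) := ⟨hy1, fun h => hne (M.eq_of_mem_closure_cell h hy2)⟩
  have hb2 : y ∈ bdry (K₂ : Set R3) := ⟨hy2, fun h => hne (M.eq_of_mem_closure_cell h hy1).symm⟩
  obtain ⟨σ, hσ⟩ := M.exists_face_of_mem_bdry hb1 hys
  obtain ⟨τ, hτ⟩ := M.exists_face_of_mem_bdry hb2 hys
  have hστ : σ.1 = τ.1 := M.eq_of_mem_closure_face hσ (subset_closure hτ)
  refine hK₂ (hK₁.trans _ _ _ (Relation.EqvGen.rel _ _ ⟨σ.1, fun hf => ?_, σ.2, ?_⟩))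
  · exact (hb (hSb hyS)).2 (hf hσ).1
  · rw [hστ]
    exact τ.2

/-- Starting from any cell, one reaches a cell with a face on `∂Ω` by crossing faces that are
not fracture faces: the closed cells that can be reached cover the connected component of the
starting cell, whose boundary contains a point of `∂Ω` off the edges, as these have no area. -/
theorem exists_boundary_face (hΩ : IsPolyhedron Ω) (hM : M.Compliant G)
    (hdisc : NotDisconnecting Ω G) (K : M.cells) :
    ∃ L : M.cells, Relation.EqvGen (M.Neighbours G) K L ∧
      ∃ σ : M.facesOf L, (σ.1 : Set R3) ⊆ frontier Ω := by
  have hΩo := isOpen_domain hΩ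
  have hGo : IsOpen (Ω \ G) := hΩo.sdiff hM.isClosed
  obtain ⟨x, hx⟩ := (M.isFlat_cell K).nonempty
  have hxG : x ∈ Ω \ G :=
    ⟨M.cell_subset hΩ K hx, Set.disjoint_left.1 (hM.disjoint_cell M hΩ K) hx⟩
  set C := connectedComponentIn (Ω \ G) x with hC
  -- the union of the balls off the network that meet a cell with the property `p`
  set U : (M.cells → Prop) → Set R3 := fun p => ⋃ N ∈ {N | p N}, ⋃ z, ⋃ r ∈
    {r : ℝ | Metric.ball z r ⊆ Ω \ G ∧ (Metric.ball z r ∩ N).Nonempty}, Metric.ball z r with hU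
  have hUo : ∀ p, IsOpen (U p) := fun p => isOpen_biUnion fun N _ => isOpen_iUnion fun z =>
    isOpen_biUnion fun r _ => Metric.isOpen_ball
  have hUmem : ∀ (p : M.cells → Prop) (N : M.cells), p N → ∀ y ∈ Ω \ G, y ∈ closure (N : Set R3) →
      y ∈ U p := by
    intro p N hN y hy hyN
    obtain ⟨r, hr, hb⟩ := Metric.isOpen_iff.1 hGo y hy
    refine Set.mem_biUnion hN (Set.mem_iUnion.2 ⟨y, Set.mem_biUnion ⟨hb, ?_⟩
      (Metric.mem_ball_self hr)⟩)
    exact mem_closure_iff.1 hyN _ Metric.isOpen_ball (Metric.mem_ball_self hr)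
  have hcell : ∀ y ∈ Ω, ∃ N : M.cells, y ∈ closure (N : Set R3) := by
    intro y hy
    have hyΩ := subset_closure hy
    rw [M.closure_domain] at hyΩ
    simp only [Set.mem_iUnion] at hyΩ
    obtain ⟨N, hN, hyN⟩ := hyΩ
    exact ⟨⟨N, hN⟩, hyN⟩
  have hCsub : C ⊆ Ω \ G := connectedComponentIn_subset _ _
  set R : M.cells → Prop := fun N => Relation.EqvGen (M.Neighbours G) K N with hR
  have hCcov : C ⊆ ⋃ N ∈ {N | R N}, closure (N : Set R3) := by
    intro y hy
    obtain ⟨N, hN⟩ := hcell y (hCsub hy).1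
    by_cases h : R N
    · exact Set.mem_biUnion (x := N) h hN
    · exfalso
      obtain ⟨w, hwC, hw1, hw2⟩ := isPreconnected_connectedComponentIn (U R) (U fun N => ¬ R N)
        (hUo _) (hUo _) (fun v hv => by
          obtain ⟨N', hN'⟩ := hcell v (hCsub hv).1
          by_cases h' : R N'
          · exact Or.inl (hUmem _ N' h' v (hCsub hv) hN')
          · exact Or.inr (hUmem _ N' h' v (hCsub hv) hN'))
        ⟨x, mem_connectedComponentIn hxG, hUmem R K (Relation.EqvGen.refl K) x hxG
          (subset_closure hx)⟩
        ⟨y, hy, hUmem _ N h y (hCsub hy) hN⟩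
      simp only [hU, Set.mem_iUnion] at hw1 hw2
      obtain ⟨K₁, hK₁, z₁, r₁, ⟨hb₁, hn₁⟩, hw1⟩ := hw1
      obtain ⟨K₂, hK₂, z₂, r₂, ⟨hb₂, hn₂⟩, hw2⟩ := hw2
      obtain ⟨K₃, hK₃⟩ := hcell w (hCsub hwC).1
      have e1 := M.neighbours_of_ball hΩ hb₁ hn₁
        (mem_closure_iff.1 hK₃ _ Metric.isOpen_ball hw1)
      have e2 := M.neighbours_of_ball hΩ hb₂
        (mem_closure_iff.1 hK₃ _ Metric.isOpen_ball hw2) hn₂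
      exact hK₂ (Relation.EqvGen.trans _ _ _ (Relation.EqvGen.trans _ _ _ hK₁ e1) e2)
  have hclosed : IsClosed (⋃ N ∈ {N | R N}, closure (N : Set R3)) :=
    (Set.toFinite _).isClosed_biUnion fun N _ => isClosed_closure
  obtain ⟨z, ⟨hzC, hzΩ⟩, hzs⟩ : ∃ z ∈ frontier C ∩ frontier Ω, z ∉ M.skeleton := by
    by_contra! hcon
    exact (hdisc x hxG).ne' (measure_mono_null hcon M.skeleton_null)
  have hzcov := closure_minimal hCcov hclosed hzC.1
  simp only [Set.mem_iUnion] at hzcov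
  obtain ⟨L, hL, hzL⟩ := hzcov
  have hzn : z ∉ Ω := by
    rw [frontier, hΩo.interior_eq] at hzΩ
    exact hzΩ.2
  obtain ⟨σ, hσ⟩ := M.exists_face_of_mem_bdry (K := L)
    ⟨hzL, fun h => hzn (M.cell_subset hΩ L h)⟩ hzs
  refine ⟨L, hL, σ, ?_⟩
  rcases M.face_cases σ.1.1 σ.1.2 with ⟨h, -⟩ | ⟨h, -⟩
  · exact absurd (h hσ) hzn
  · exact h

end PolyMesh

/-! ### Boundary fluxes and edge displacements -/

theorem mulVec_add (A B : Matrix (Fin 3) (Fin 3) ℝ) (n : R3) :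
    mulVec (A + B) n = mulVec A n + mulVec B n := by
  ext i; simp [mulVec, Matrix.add_mulVec]

theorem mulVec_smul (c : ℝ) (A : Matrix (Fin 3) (Fin 3) ℝ) (n : R3) :
    mulVec (c • A) n = c • mulVec A n := by
  ext i; simp [mulVec, Matrix.smul_mulVec]

theorem mulVec_zero (n : R3) : mulVec 0 n = 0 := by
  ext i; simp [mulVec]

theorem _root_.Continuous.ddrMulVec {α : Type*} [TopologicalSpace α]
    {f : α → Matrix (Fin 3) (Fin 3) ℝ} (hf : Continuous f) (n : R3) :
    Continuous fun x => mulVec (f x) n :=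
  (PiLp.continuous_toLp 2 _).comp (hf.matrix_mulVec continuous_const)

theorem IsFlat.setIntegral_add_smul {d : ℕ} {X : Set R3} (h : IsFlat d X) {F f g : R3 → ℝ}
    (hf : Continuous f) (hg : Continuous g) (c : ℝ) (hF : ∀ x ∈ X, F x = f x + c * g x) :
    ∫ x in X, F x ∂μHE[d] = ∫ x in X, f x ∂μHE[d] + c * ∫ x in X, g x ∂μHE[d] := by
  rw [setIntegral_congr_fun h.measurableSet hF, ← integral_const_mul]
  exact h.integral_add hf (continuous_const.mul hg)

theorem IsTraceForm.sum {X : Set R3} {α : Type*} (s : Finset α) {b : α → PolyMat → ℝ}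
    (hb : ∀ a ∈ s, IsTraceForm X (b a)) : IsTraceForm X fun ξ => ∑ a ∈ s, b a ξ where
  map_add ξ η := by
    rw [← Finset.sum_add_distrib]
    exact Finset.sum_congr rfl fun a ha => (hb a ha).map_add ξ η
  map_smul c ξ := by
    rw [Finset.mul_sum]
    exact Finset.sum_congr rfl fun a ha => (hb a ha).map_smul c ξ
  map_zero_on ξ hξ := Finset.sum_eq_zero fun a ha => (hb a ha).map_zero_on ξ hξ

/-- The flux through a piece `Y` of the boundary of `X`, weighted by a polynomial `p`, depends
linearly on the values on `X` of a matrix-valued polynomial, since these determine the values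
on `Y`. -/
theorem IsFlat.isTraceForm_flux {d k : ℕ} {X Y : Set R3} (hX : IsFlat d X) (hY : IsFlat k Y)
    (hYX : Y ⊆ closure X) (p : PolyVec) (n : R3) :
    IsTraceForm X fun ξ => ∫ x in Y, dot (p.at x) (mulVec (ξ.at x) n) ∂μHE[k] where
  map_add ξ η := by
    have := hY.setIntegral_add_smul (p.continuous_at.dot (ξ.continuous_at.ddrMulVec n))
      (p.continuous_at.dot (η.continuous_at.ddrMulVec n)) 1
      (F := fun x => dot (p.at x) (mulVec (PolyMat.at (ξ + η) x) n))
      fun x _ => by rw [PolyMat.at_add, mulVec_add, dot_add_right, one_mul]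
    rwa [one_mul] at this
  map_smul c ξ := by
    simp only [PolyMat.at_smul, mulVec_smul, dot_smul_right]
    exact integral_const_mul _ _
  map_zero_on ξ hξ := by
    refine setIntegral_eq_zero_of_forall_eq_zero fun x hx => ?_
    have hxX : x ∈ affineSpan ℝ X := closure_minimal (subset_affineSpan ℝ X)
      (AffineSubspace.closed_of_finiteDimensional _) (hYX hx)
    have h0 : ξ.at x = 0 := PolyMat.at_eq_zero_iff.2 fun i j =>
      hX.eval_eq_zero_of_mem_affineSpan (fun y hy => PolyMat.at_eq_zero_iff.1 (hξ y hy) i j) hxX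
    rw [h0, mulVec_zero, dot_zero_right]

/-- The affine function with the values `0` at `a` and `1` at `b` on the line through `a`, `b`. -/
def lineCoord (a b : R3) : MvPolynomial (Fin 3) ℝ :=
  ∑ l, MvPolynomial.C ((b - a) l / ‖b - a‖ ^ 2) * (MvPolynomial.X l - MvPolynomial.C (a l))

theorem eval_lineCoord {a b : R3} (hab : a ≠ b) (t : ℝ) :
    MvPolynomial.eval (a + t • (b - a)).ofLp (lineCoord a b) = t := by
  have hn : ‖b - a‖ ^ 2 ≠ 0 := pow_ne_zero _ (norm_ne_zero_iff.2 (sub_ne_zero.2 hab.symm))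
  have h := dot_self (b - a)
  simp only [dot] at h
  simp only [lineCoord, map_sum, map_mul, MvPolynomial.eval_C, map_sub, MvPolynomial.eval_X]
  calc _ = t * (∑ l, (b - a) l * (b - a) l) / ‖b - a‖ ^ 2 := by
        rw [Finset.mul_sum, Finset.sum_div]
        refine Finset.sum_congr rfl fun l _ => ?_
        simp only [PiLp.add_apply, PiLp.smul_apply, smul_eq_mul]
        ring
    _ = t := by rw [h, mul_div_cancel_right₀ _ hn]

theorem totalDegree_lineCoord_le (a b : R3) : (lineCoord a b).totalDegree ≤ 1 := by
  refine MvPolynomial.totalDegree_finsetSum_le fun l _ => ?_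
  refine (MvPolynomial.totalDegree_mul _ _).trans ?_
  rw [MvPolynomial.totalDegree_C, zero_add]
  exact totalDegree_X_sub_C_le l _

/-- The quadratic bubble on the segment with endpoints `a`, `b`. -/
def bubble (a b : R3) : MvPolynomial (Fin 3) ℝ := lineCoord a b * (1 - lineCoord a b)

theorem integral_bubble_pos {a b : R3} (hab : a ≠ b) :
    0 < ∫ x in openSegment ℝ a b, MvPolynomial.eval x.ofLp (bubble a b) ∂μHE[1] := by
  have hflat := isFlat_openSegment hab
  have hpos : ∀ x ∈ openSegment ℝ a b, 0 < MvPolynomial.eval x.ofLp (bubble a b) := by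
    intro x hx
    rw [openSegment_eq_image'] at hx
    obtain ⟨t, ht, rfl⟩ := hx
    simp only [bubble, map_mul, map_sub, map_one, eval_lineCoord hab]
    exact mul_pos ht.1 (sub_pos.2 ht.2)
  refine (setIntegral_pos_iff_support_of_nonneg_ae
    ((ae_restrict_iff' hflat.measurableSet).2 (.of_forall fun x hx => (hpos x hx).le))
    (hflat.integrableOn (continuous_eval _))).2 ?_
  rw [Set.inter_eq_right.2 (show openSegment ℝ a b ⊆ Function.support _ from
    fun x hx => (hpos x hx).ne')]
  exact hflat.measure_pos

namespace PolyMesh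

variable {Ω : Set R3} {M : PolyMesh Ω} {G : Set R3}

/-- The equations that define the displacement on an edge. -/
def IsEdgeRec (e : M.edges) (A : M.vertsOf e → R3) (m : R3) (p : PolyVec) : Prop :=
  p.DegLE 2 ∧ (∀ s : M.vertsOf e, p.at s.1 = A s) ∧ ⨍ x in (e : Set R3), p.at x ∂μHE[1] = m

theorem exists_isEdgeRec (e : M.edges) (A : M.vertsOf e → R3) (m : R3) :
    ∃ p, IsEdgeRec e A m p := by
  obtain ⟨a, ha, b, hb, hab, he⟩ := M.isSegment_edge e.1 e.2
  have hbd : bdry (e : Set R3) = {a, b} := by rw [he, bdry_openSegment hab]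
  have hflat := M.isFlat_edge e
  set sa : M.vertsOf e := ⟨⟨a, ha⟩, by rw [hbd]; simp⟩
  set sb : M.vertsOf e := ⟨⟨b, hb⟩, by rw [hbd]; simp⟩
  set β := ∫ x in (e : Set R3), MvPolynomial.eval x.ofLp (bubble a b) ∂μHE[1] with hβ
  have hβ0 : β ≠ 0 := by rw [hβ, he]; exact (integral_bubble_pos hab).ne'
  set p₀ : PolyVec := fun i =>
    MvPolynomial.C (A sa i) + MvPolynomial.C (A sb i - A sa i) * lineCoord a b with hp₀
  -- the coefficient of the bubble is fixed by the mean value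
  set γ : R3 := β⁻¹ • ((μHE[1] : Measure R3).real (e : Set R3) • m -
    ∫ x in (e : Set R3), p₀.at x ∂μHE[1]) with hγ
  set q : PolyVec := fun i => MvPolynomial.C (γ i) * bubble a b with hq
  have hqat : ∀ x, q.at x = MvPolynomial.eval x.ofLp (bubble a b) • γ := fun x => by
    ext i; simp [q, PolyVec.at, mul_comm]
  have hC : ∀ r : ℝ, (MvPolynomial.C r : MvPolynomial (Fin 3) ℝ).totalDegree ≤ 0 := fun r => by
    rw [MvPolynomial.totalDegree_C]
  have hd1 := totalDegree_lineCoord_le a b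
  refine ⟨p₀ + q, Submodule.add_mem (PolyVec.degLE 2) (fun i => ?_) (fun i => ?_),
    fun s => ?_, ?_⟩
  · refine (MvPolynomial.totalDegree_add _ _).trans (max_le ((hC _).trans (by simp)) ?_)
    refine (MvPolynomial.totalDegree_mul _ _).trans ?_
    have := hC (A sb i - A sa i)
    omega
  · refine (MvPolynomial.totalDegree_mul _ _).trans ?_
    have h1 := hC (γ i)
    have h2 := MvPolynomial.totalDegree_mul (lineCoord a b) (1 - lineCoord a b)
    have h3 := MvPolynomial.totalDegree_sub (1 : MvPolynomial (Fin 3) ℝ) (lineCoord a b)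
    rw [MvPolynomial.totalDegree_one] at h3
    change (MvPolynomial.C (γ i)).totalDegree +
      (lineCoord a b * (1 - lineCoord a b)).totalDegree ≤ 2
    omega
  · have e0 : MvPolynomial.eval a.ofLp (lineCoord a b) = 0 := by
      simpa using eval_lineCoord hab 0
    have e1 : MvPolynomial.eval b.ofLp (lineCoord a b) = 1 := by
      simpa using eval_lineCoord hab 1
    have hs : (s.1 : R3) ∈ ({a, b} : Set R3) := hbd ▸ s.2
    rw [PolyVec.at_add, hqat]
    rcases hs with hs | hs
    · have hsa : s = sa := Subtype.ext (Subtype.ext hs)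
      rw [hsa]
      ext i
      simp [sa, p₀, PolyVec.at, bubble, e0]
    · have hsb : s = sb := Subtype.ext (Subtype.ext hs)
      rw [hsb]
      ext i
      simp [sb, p₀, PolyVec.at, bubble, e1]
  · rw [setAverage_eq]
    simp only [PolyVec.at_add, hqat]
    have hc : Continuous fun x : R3 => MvPolynomial.eval x.ofLp (bubble a b) • γ :=
      (continuous_eval _).smul continuous_const
    rw [integral_add (hflat.integrableOn p₀.continuous_at) (hflat.integrableOn hc),
      integral_smul_const, ← hβ,
      hγ, smul_smul, mul_inv_cancel₀ hβ0, one_smul, add_sub_cancel, smul_smul,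
      inv_mul_cancel₀ hflat.measureReal_pos.ne', one_smul]

theorem IsEdgeRec.add_smul {e : M.edges} {A A' : M.vertsOf e → R3} {m m' : R3} {p p' : PolyVec}
    (h : IsEdgeRec e A m p) (h' : IsEdgeRec e A' m' p') (c : ℝ) :
    IsEdgeRec e (fun s => A s + c • A' s) (m + c • m') (p + c • p') := by
  have hflat := M.isFlat_edge e
  refine ⟨Submodule.add_mem (PolyVec.degLE 2) h.1 (Submodule.smul_mem _ c h'.1), fun s => ?_, ?_⟩
  · rw [PolyVec.at_add, PolyVec.at_smul, h.2.1, h'.2.1]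
  · rw [← h.2.2, ← h'.2.2, setAverage_eq, setAverage_eq, setAverage_eq]
    simp only [PolyVec.at_add, PolyVec.at_smul]
    have hc : Continuous fun x => c • p'.at x := p'.continuous_at.const_smul c
    rw [integral_add (hflat.integrableOn p.continuous_at) (hflat.integrableOn hc), integral_smul,
      smul_add, smul_comm c]

theorem IsEdgeRec.unique {e : M.edges} {A : M.vertsOf e → R3} {m : R3} {p p' : PolyVec}
    (h : IsEdgeRec e A m p) (h' : IsEdgeRec e A m p') : ∀ x ∈ (e : Set R3), p.at x = p'.at x := by
  obtain ⟨a, ha, b, hb, hab, he⟩ := M.isSegment_edge e.1 e.2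
  have hbd : bdry (e : Set R3) = {a, b} := by rw [he, bdry_openSegment hab]
  have hflat := M.isFlat_edge e
  have hq := h.add_smul h' (-1)
  have hat : ∀ x, (p + (-1 : ℝ) • p').at x = p.at x - p'.at x := fun x => by
    rw [PolyVec.at_add, PolyVec.at_smul, neg_one_smul, ← sub_eq_add_neg]
  set q := p + (-1 : ℝ) • p'
  have hqa : q.at a = 0 :=
    (hq.2.1 ⟨⟨a, ha⟩, by rw [hbd]; simp⟩).trans (by simp)
  have hqb : q.at b = 0 :=
    (hq.2.1 ⟨⟨b, hb⟩, by rw [hbd]; simp⟩).trans (by simp)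
  -- a quadratic polynomial that vanishes at the endpoints is a multiple of the bubble
  have hγ : ∀ i, ∃ γ : ℝ, ∀ t : ℝ,
      MvPolynomial.eval (a + t • (b - a)).ofLp (q i) = t * (1 - t) * γ := by
    intro i
    obtain ⟨Q, hQd, hQ⟩ := exists_polynomial_eval_line (q i) a (b - a)
    have hQ2 : Q.natDegree < 3 := by have := hq.1 i; omega
    have hQe : ∀ t, Q.eval t = Q.coeff 0 + Q.coeff 1 * t + Q.coeff 2 * t ^ 2 := fun t => by
      rw [Polynomial.eval_eq_sum_range' hQ2, Finset.sum_range_succ, Finset.sum_range_succ,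
        Finset.sum_range_one]
      ring
    have h0 : Q.eval 0 = 0 := by
      rw [← hQ]; simpa using PolyVec.at_eq_zero_iff.1 hqa i
    have h1 : Q.eval 1 = 0 := by
      rw [← hQ]; simpa using PolyVec.at_eq_zero_iff.1 hqb i
    rw [hQe] at h0 h1
    refine ⟨Q.coeff 1, fun t => ?_⟩
    rw [hQ, hQe]
    linear_combination (1 - t ^ 2) * h0 + t ^ 2 * h1
  choose γ hγ using hγ
  have hqe : ∀ x ∈ (e : Set R3), q.at x =
      MvPolynomial.eval x.ofLp (bubble a b) • (WithLp.toLp 2 γ : R3) := by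
    intro x hx
    rw [he, openSegment_eq_image'] at hx
    obtain ⟨t, -, rfl⟩ := hx
    ext i
    change MvPolynomial.eval (a + t • (b - a)).ofLp (q i) = _
    rw [hγ, bubble]
    simp only [map_mul, map_sub, map_one, eval_lineCoord hab, PiLp.smul_apply, smul_eq_mul]
  have hint : (∫ x in (e : Set R3), MvPolynomial.eval x.ofLp (bubble a b) ∂μHE[1]) •
      (WithLp.toLp 2 γ : R3) = 0 := by
    rw [← integral_smul_const, ← setIntegral_congr_fun hflat.measurableSet hqe]
    have := hq.2.2
    rw [neg_one_smul, add_neg_cancel, setAverage_eq] at this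
    exact (smul_eq_zero.1 this).resolve_left (inv_ne_zero hflat.measureReal_pos.ne')
  rw [he] at hint
  have hγ0 := (smul_eq_zero.1 hint).resolve_left (integral_bubble_pos hab).ne'
  intro x hx
  have := hqe x hx
  rw [hγ0, smul_zero, hat] at this
  exact sub_eq_zero.1 this

/-! ### Linearity of the reconstructions -/

theorem isEdgeRec_edgeRec (v : M.Dofs) (K : M.cells) (e : M.edgesOf K) :
    IsEdgeRec e.1 (fun s => Dofs.vert v K (M.vertOfEdge s)) (Dofs.edge v K e) (edgeRec v K e) :=
  Classical.epsilon_spec (p := IsEdgeRec e.1 (fun s => Dofs.vert v K (M.vertOfEdge s))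
    (Dofs.edge v K e)) (exists_isEdgeRec _ _ _)

theorem edgeRec_add_smul (v w : M.Dofs) (c : ℝ) (K : M.cells) (e : M.edgesOf K) :
    ∀ x ∈ (e.1 : Set R3),
      (edgeRec (v + c • w) K e).at x = (edgeRec v K e).at x + c • (edgeRec w K e).at x := by
  intro x hx
  rw [← PolyVec.at_smul, ← PolyVec.at_add]
  exact (isEdgeRec_edgeRec (v + c • w) K e).unique
    ((isEdgeRec_edgeRec v K e).add_smul (isEdgeRec_edgeRec w K e) c) x hx

theorem isTraceForm_faceBdryTerm (v : M.Dofs) (K : M.cells) (σ : M.facesOf K) :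
    IsTraceForm (σ.1 : Set R3) (faceBdryTerm v K σ) :=
  IsTraceForm.sum _ fun e _ => (M.isFlat_face σ.1).isTraceForm_flux (M.isFlat_edge e.1)
    (e.2.trans Set.sdiff_subset) _ _

theorem faceBdryTerm_add_smul (v w : M.Dofs) (c : ℝ) (K : M.cells) (σ : M.facesOf K) :
    faceBdryTerm (v + c • w) K σ =
      fun ξ => faceBdryTerm v K σ ξ + c * faceBdryTerm w K σ ξ := by
  ext ξ
  unfold faceBdryTerm
  rw [Finset.mul_sum, ← Finset.sum_add_distrib]
  refine Finset.sum_congr rfl fun e _ => ?_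
  refine (M.isFlat_edge e.1).setIntegral_add_smul
    ((PolyVec.continuous_at _).dot (ξ.continuous_at.ddrMulVec _))
    ((PolyVec.continuous_at _).dot (ξ.continuous_at.ddrMulVec _)) c fun x hx => ?_
  rw [edgeRec_add_smul v w c K (M.edgeOfFace e) x hx, dot_add_left, dot_smul_left]

theorem isGradRec_faceGrad (v : M.Dofs) (K : M.cells) (σ : M.facesOf K) :
    IsGradRec 2 (σ.1 : Set R3) (Dofs.face v K σ) (faceBdryTerm v K σ) (faceGrad v K σ) :=
  (M.isFlat_face σ.1).isGradRec_gradRec _ (isTraceForm_faceBdryTerm v K σ)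

theorem isPotRec_faceRec (v : M.Dofs) (K : M.cells) (σ : M.facesOf K) :
    IsPotRec 2 (σ.1 : Set R3) (faceGrad v K σ) (faceBdryTerm v K σ) (faceRec v K σ) :=
  (M.isFlat_face σ.1).isPotRec_potRec two_ne_zero _ (isTraceForm_faceBdryTerm v K σ)

theorem faceGrad_add_smul (v w : M.Dofs) (c : ℝ) (K : M.cells) (σ : M.facesOf K) :
    ∀ x ∈ (σ.1 : Set R3), (faceGrad v K σ + c • faceGrad w K σ).at x =
      (faceGrad (v + c • w) K σ).at x := by
  have h1 := isGradRec_faceGrad (v + c • w) K σ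
  rw [faceBdryTerm_add_smul] at h1
  exact (M.isFlat_face σ.1).isGradRec_unique ((M.isFlat_face σ.1).isGradRec_add_smul
    (isGradRec_faceGrad v K σ) (isGradRec_faceGrad w K σ) c) h1

theorem faceRec_add_smul (v w : M.Dofs) (c : ℝ) (K : M.cells) (σ : M.facesOf K) :
    ∀ x ∈ (σ.1 : Set R3),
      (faceRec (v + c • w) K σ).at x = (faceRec v K σ).at x + c • (faceRec w K σ).at x := by
  have hf := M.isFlat_face σ.1
  have h1 := isPotRec_faceRec (v + c • w) K σ
  rw [faceBdryTerm_add_smul] at h1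
  have h2 := (hf.isPotRec_add_smul (isPotRec_faceRec v K σ) (isPotRec_faceRec w K σ) c).congr hf
    (faceGrad_add_smul v w c K σ)
  intro x hx
  rw [hf.isPotRec_unique two_ne_zero h1 h2 x hx, PolyVec.at_add, PolyVec.at_smul]

theorem isTraceForm_cellBdryTerm (v : M.Dofs) (K : M.cells) :
    IsTraceForm (K : Set R3) (cellBdryTerm v K) :=
  IsTraceForm.sum _ fun σ _ => (M.isFlat_cell K).isTraceForm_flux (M.isFlat_face σ.1)
    (σ.2.trans Set.sdiff_subset) _ _

theorem cellBdryTerm_add_smul (v w : M.Dofs) (c : ℝ) (K : M.cells) :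
    cellBdryTerm (v + c • w) K = fun ξ => cellBdryTerm v K ξ + c * cellBdryTerm w K ξ := by
  ext ξ
  unfold cellBdryTerm
  rw [Finset.mul_sum, ← Finset.sum_add_distrib]
  refine Finset.sum_congr rfl fun σ _ => ?_
  refine (M.isFlat_face σ.1).setIntegral_add_smul
    ((PolyVec.continuous_at _).dot (ξ.continuous_at.ddrMulVec _))
    ((PolyVec.continuous_at _).dot (ξ.continuous_at.ddrMulVec _)) c fun x hx => ?_
  rw [faceRec_add_smul v w c K σ x hx, dot_add_left, dot_smul_left]

theorem isGradRec_cellGrad (v : M.Dofs) (K : M.cells) :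
    IsGradRec 3 (K : Set R3) (Dofs.cell v K) (cellBdryTerm v K) (cellGrad v K) :=
  (M.isFlat_cell K).isGradRec_gradRec _ (isTraceForm_cellBdryTerm v K)

theorem isPotRec_cellRec (v : M.Dofs) (K : M.cells) :
    IsPotRec 3 (K : Set R3) (cellGrad v K) (cellBdryTerm v K) (cellRec v K) :=
  (M.isFlat_cell K).isPotRec_potRec three_ne_zero _ (isTraceForm_cellBdryTerm v K)

theorem cellGrad_add_smul (v w : M.Dofs) (c : ℝ) (K : M.cells) :
    ∀ x ∈ (K : Set R3), (cellGrad v K + c • cellGrad w K).at x =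
      (cellGrad (v + c • w) K).at x := by
  have h1 := isGradRec_cellGrad (v + c • w) K
  rw [cellBdryTerm_add_smul] at h1
  exact (M.isFlat_cell K).isGradRec_unique ((M.isFlat_cell K).isGradRec_add_smul
    (isGradRec_cellGrad v K) (isGradRec_cellGrad w K) c) h1

theorem mem_affineSpan_cell (K : M.cells) (x : R3) : x ∈ affineSpan ℝ (K : Set R3) := by
  rw [(M.isOpen_cell K).affineSpan_eq_top (M.isFlat_cell K).nonempty]
  trivial

/-- A polynomial that vanishes on a cell vanishes everywhere. -/
theorem at_eq_of_eqOn_cell (K : M.cells) {p q : PolyVec}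
    (h : ∀ x ∈ (K : Set R3), p.at x = q.at x) (x : R3) : p.at x = q.at x := by
  have h0 : (p - q).at x = 0 := PolyVec.at_eq_zero_iff.2 fun i =>
    (M.isFlat_cell K).eval_eq_zero_of_mem_affineSpan (fun y hy =>
      PolyVec.at_eq_zero_iff.1 (by rw [PolyVec.at_sub, h y hy, sub_self]) i)
      (mem_affineSpan_cell K x)
  rw [PolyVec.at_sub] at h0
  exact sub_eq_zero.1 h0

theorem cellRec_add_smul (v w : M.Dofs) (c : ℝ) (K : M.cells) (x : R3) :
    (cellRec (v + c • w) K).at x = (cellRec v K).at x + c • (cellRec w K).at x := by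
  have hf := M.isFlat_cell K
  have h1 := isPotRec_cellRec (v + c • w) K
  rw [cellBdryTerm_add_smul] at h1
  have h2 := (hf.isPotRec_add_smul (isPotRec_cellRec v K) (isPotRec_cellRec w K) c).congr hf
    (cellGrad_add_smul v w c K)
  rw [at_eq_of_eqOn_cell K (hf.isPotRec_unique three_ne_zero h1 h2) x, PolyVec.at_add,
    PolyVec.at_smul]

theorem strain_add_smul (v w : M.Dofs) (c : ℝ) (K : M.cells) :
    ∀ x ∈ (K : Set R3), strain (v + c • w) K x = strain v K x + c • strain w K x := by
  intro x hx
  unfold strain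
  rw [← cellGrad_add_smul v w c K x hx, PolyMat.at_add, PolyMat.at_smul, Matrix.transpose_add,
    Matrix.transpose_smul]
  module

/-! ### The forms of the scheme -/

theorem stabCell_comm (u v : M.Dofs) (K : M.cells) : stabCell u v K = stabCell v u K := by
  simp only [stabCell, dot_comm]

theorem stabCell_add_smul (u v w : M.Dofs) (c : ℝ) (K : M.cells) :
    stabCell u (v + c • w) K = stabCell u v K + c * stabCell u w K := by
  have hF : ∀ (v : M.Dofs) (σ : M.facesOf K),
      Continuous fun x => (cellRec v K).at x - (faceRec v K σ).at x :=
    fun v σ => (cellRec v K).continuous_at.sub (faceRec v K σ).continuous_at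
  have hE : ∀ (v : M.Dofs) (e : M.edgesOf K),
      Continuous fun x => (cellRec v K).at x - (edgeRec v K e).at x :=
    fun v e => (cellRec v K).continuous_at.sub (edgeRec v K e).continuous_at
  have h1 : ∀ σ : M.facesOf K, ∫ x in (σ.1 : Set R3),
      dot ((cellRec u K).at x - (faceRec u K σ).at x)
        ((cellRec (v + c • w) K).at x - (faceRec (v + c • w) K σ).at x) ∂μHE[2] = _ :=
    fun σ => (M.isFlat_face σ.1).setIntegral_add_smul ((hF u σ).dot (hF v σ))
      ((hF u σ).dot (hF w σ)) c fun x hx => by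
        rw [cellRec_add_smul, faceRec_add_smul v w c K σ x hx, ← dot_smul_right, ← dot_add_right]
        congr 1; module
  have h2 : ∀ e : M.edgesOf K, ∫ x in (e.1 : Set R3),
      dot ((cellRec u K).at x - (edgeRec u K e).at x)
        ((cellRec (v + c • w) K).at x - (edgeRec (v + c • w) K e).at x) ∂μHE[1] = _ :=
    fun e => (M.isFlat_edge e.1).setIntegral_add_smul ((hE u e).dot (hE v e))
      ((hE u e).dot (hE w e)) c fun x hx => by
        rw [cellRec_add_smul, edgeRec_add_smul v w c K e x hx, ← dot_smul_right, ← dot_add_right]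
        congr 1; module
  have h3 : ∀ s : M.vertsOf K, dot ((cellRec u K).at s.1 - Dofs.vert u K s)
      ((cellRec (v + c • w) K).at s.1 - Dofs.vert (v + c • w) K s) =
      dot ((cellRec u K).at s.1 - Dofs.vert u K s) ((cellRec v K).at s.1 - Dofs.vert v K s) +
      c * dot ((cellRec u K).at s.1 - Dofs.vert u K s)
        ((cellRec w K).at s.1 - Dofs.vert w K s) := fun s => by
    rw [cellRec_add_smul, ← dot_smul_right, ← dot_add_right]
    congr 1
    change _ - (Dofs.vert v K s + c • Dofs.vert w K s) = _
    module
  unfold stabCell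
  simp only [h1, h2, h3, Finset.sum_add_distrib, ← Finset.mul_sum]
  ring

theorem stab_comm (u v : M.Dofs) : stab u v = stab v u :=
  Finset.sum_congr rfl fun K _ => stabCell_comm u v K

theorem stab_add_smul (u v w : M.Dofs) (c : ℝ) :
    stab u (v + c • w) = stab u v + c * stab u w := by
  simp only [stab, stabCell_add_smul, Finset.sum_add_distrib, ← Finset.mul_sum]

theorem continuous_strain (v : M.Dofs) (K : M.cells) : Continuous (strain v K) := by
  have h := (cellGrad v K).continuous_at
  exact (h.add h.matrix_transpose).const_smul (1 / 2 : ℝ)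

theorem continuous_stress (E ν : ℝ) (v : M.Dofs) (K : M.cells) : Continuous (stress E ν v K) := by
  have h := continuous_strain v K
  have ht : Continuous fun x => ν / (1 - 2 * ν) * (strain v K x).trace :=
    continuous_const.mul h.matrix_trace
  exact (h.add (ht.smul continuous_const)).const_smul (E / (1 + ν))

theorem ddot_one (A : Matrix (Fin 3) (Fin 3) ℝ) : ddot 1 A = A.trace := by
  simp [ddot, Matrix.trace, Matrix.one_apply]

theorem ddot_stress (E ν : ℝ) (u v : M.Dofs) (K : M.cells) (x : R3) :
    ddot (stress E ν u K x) (strain v K x) = E / (1 + ν) * (ddot (strain u K x) (strain v K x) +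
      ν / (1 - 2 * ν) * ((strain u K x).trace * (strain v K x).trace)) := by
  rw [stress, ddot_smul_left, ddot_add_left, ddot_smul_left, ddot_one]
  ring

theorem elastic_comm (E ν : ℝ) (u v : M.Dofs) : elastic E ν u v = elastic E ν v u := by
  refine Finset.sum_congr rfl fun K _ => ?_
  refine integral_congr_ae (.of_forall fun x => ?_)
  simp only
  rw [ddot_stress, ddot_stress, ddot_comm, mul_comm (strain u K x).trace]

theorem elastic_add_smul (E ν : ℝ) (u v w : M.Dofs) (c : ℝ) :
    elastic E ν u (v + c • w) = elastic E ν u v + c * elastic E ν u w := by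
  unfold elastic
  rw [Finset.mul_sum, ← Finset.sum_add_distrib]
  refine Finset.sum_congr rfl fun K _ => ?_
  rw [← euclideanHausdorffMeasure_three]
  refine (M.isFlat_cell K).setIntegral_add_smul
    ((continuous_stress E ν u K).ddot (continuous_strain v K))
    ((continuous_stress E ν u K).ddot (continuous_strain w K)) c fun x hx => ?_
  rw [strain_add_smul v w c K x hx, ddot_add_right, ddot_smul_right]

/-- Since the mean of a face displacement is the face component, the contact term only involves the
jumps of the face components. -/
theorem contact_eq_sum (S : M.Sides G) (μ : M.multSpace G) (v : M.Dofs) :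
    contact S μ v = ∑ σ : M.fracFaces G, (μHE[2] : Measure R3).real (σ.1 : Set R3) *
      dot (μ σ) (Dofs.face v (S.plus σ) ⟨σ.1, S.mem_plus σ⟩ -
        Dofs.face v (S.minus σ) ⟨σ.1, S.mem_minus σ⟩) := by
  refine Finset.sum_congr rfl fun σ _ => ?_
  have hf := M.isFlat_face σ.1
  have hmean : ∀ (K : M.cells) (hK : (σ.1 : Set R3) ⊆ bdry K),
      ∫ x in (σ.1 : Set R3), dot (μ σ) ((faceRec v K ⟨σ.1, hK⟩).at x) ∂μHE[2] =
        (μHE[2] : Measure R3).real (σ.1 : Set R3) * dot (μ σ) (Dofs.face v K ⟨σ.1, hK⟩) :=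
    fun K hK => by
      simp only [dot_comm (μ σ)]
      exact hf.integral_dot_potRec two_ne_zero (isGradRec_faceGrad v K ⟨σ.1, hK⟩)
        (isPotRec_faceRec v K ⟨σ.1, hK⟩) (μ σ)
  have h := hf.setIntegral_add_smul
    (F := fun x => dot (μ σ) (jump S v σ x))
    (continuous_const.dot (faceRec v (S.plus σ) ⟨σ.1, S.mem_plus σ⟩).continuous_at)
    (continuous_const.dot (faceRec v (S.minus σ) ⟨σ.1, S.mem_minus σ⟩).continuous_at) (-1)
    fun x _ => by
      rw [jump, ← dot_smul_right, ← dot_add_right, neg_one_smul, ← sub_eq_add_neg]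
  rw [h, hmean, hmean, sub_eq_add_neg, ← neg_one_smul ℝ (Dofs.face v (S.minus σ) _),
    dot_add_right, dot_smul_right]
  ring

theorem contact_add_smul_left (S : M.Sides G) (μ κ : M.multSpace G) (c : ℝ) (v : M.Dofs) :
    contact S (μ + c • κ) v = contact S μ v + c * contact S κ v := by
  simp only [contact_eq_sum, Pi.add_apply, Pi.smul_apply, dot_add_left, dot_smul_left,
    Finset.mul_sum, ← Finset.sum_add_distrib]
  exact Finset.sum_congr rfl fun σ _ => by ring

theorem contact_add_smul_right (S : M.Sides G) (μ : M.multSpace G) (v w : M.Dofs) (c : ℝ) :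
    contact S μ (v + c • w) = contact S μ v + c * contact S μ w := by
  simp only [contact_eq_sum, Finset.mul_sum, ← Finset.sum_add_distrib]
  refine Finset.sum_congr rfl fun σ _ => ?_
  rw [mul_left_comm, ← mul_add]
  congr 1
  rw [← dot_smul_right, ← dot_add_right]
  congr 1
  change (Dofs.face v _ _ + c • Dofs.face w _ _) - (Dofs.face v _ _ + c • Dofs.face w _ _) = _
  module

theorem load_add_smul (hΩ : IsPolyhedron Ω) {f : R3 → R3} (hf : MemLp f 2 (volume.restrict Ω))
    (v w : M.Dofs) (c : ℝ) : load f (v + c • w) = load f v + c * load f w := by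
  unfold load
  rw [Finset.mul_sum, ← Finset.sum_add_distrib]
  refine Finset.sum_congr rfl fun K _ => ?_
  have hfK : IntegrableOn f (K : Set R3) := by
    have h1 : MemLp f 2 (volume.restrict (K : Set R3)) :=
      hf.mono_measure (Measure.restrict_mono (M.cell_subset hΩ K) le_rfl)
    have : IsFiniteMeasure (volume.restrict (K : Set R3)) := by
      have := (M.isFlat_cell K).isFiniteMeasure_restrict
      rwa [euclideanHausdorffMeasure_three] at this
    exact h1.integrable (by norm_num)
  have hdot : ∀ a : R3, IntegrableOn (fun x => dot (f x) a) (K : Set R3) := fun a => by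
    simp only [dot_eq_inner]
    exact hfK.inner_const a
  rw [← integral_const_mul, ← integral_add (hdot _) ((hdot _).const_mul c)]
  refine integral_congr_ae (.of_forall fun x => ?_)
  simp only
  rw [← dot_smul_right, ← dot_add_right]
  rfl

end PolyMesh

/-! ### Rigid motions -/

/-- The gradient of a vector-valued polynomial. -/
def PolyVec.grad (p : PolyVec) : PolyMat := fun i j => MvPolynomial.pderiv j (p i)

/-- A rigid motion: a polynomial whose gradient is antisymmetric. -/
def IsRigid (p : PolyVec) : Prop :=
  ∀ i j, MvPolynomial.pderiv j (p i) + MvPolynomial.pderiv i (p j) = 0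

theorem IsRigid.sub {p q : PolyVec} (hp : IsRigid p) (hq : IsRigid q) : IsRigid (p - q) := by
  intro i j
  simp only [Pi.sub_apply, map_sub]
  linear_combination hp i j - hq i j

theorem pderiv_comm (i j : Fin 3) (p : MvPolynomial (Fin 3) ℝ) :
    MvPolynomial.pderiv i (MvPolynomial.pderiv j p) =
      MvPolynomial.pderiv j (MvPolynomial.pderiv i p) := by
  induction p using MvPolynomial.induction_on with
  | C a => simp
  | add p q hp hq => simp [hp, hq]
  | mul_X p k hp =>
    simp only [MvPolynomial.pderiv_mul, map_add, hp, MvPolynomial.pderiv_X, Pi.single_apply]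
    split_ifs <;> simp [add_comm, add_left_comm]

theorem eval_add_eq_of_dirDeriv {p : MvPolynomial (Fin 3) ℝ} {x w : R3} {c : ℝ}
    (h : ∀ y : R3, MvPolynomial.eval y.ofLp (dirDeriv w p) = c) :
    MvPolynomial.eval (x + w).ofLp p = MvPolynomial.eval x.ofLp p + c := by
  have hd : ∀ t : ℝ, HasDerivAt
      (fun t : ℝ => MvPolynomial.eval (x + t • w).ofLp p - t * c) 0 t := fun t => by
    have h1 := (hasDerivAt_eval_line p x w t).sub ((hasDerivAt_id t).mul_const c)
    rw [h, one_mul, sub_self] at h1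
    exact h1
  have h01 := is_const_of_deriv_eq_zero (fun t => (hd t).differentiableAt) (fun t => (hd t).deriv)
    0 1
  simp only [zero_smul, add_zero, zero_mul, sub_zero, one_smul, one_mul] at h01
  linarith

/-- A rigid motion is affine with an antisymmetric linear part: the second derivatives are
antisymmetric in one pair of indices and symmetric in another one, hence vanish. -/
theorem IsRigid.exists_linear {p : PolyVec} (hp : IsRigid p) : ∃ L : R3 → R3,
    (∀ w z, inner ℝ (L w) z = - inner ℝ w (L z)) ∧ ∀ x w, p.at (x + w) = p.at x + L w := by
  have h2 : ∀ i j k, MvPolynomial.pderiv k (MvPolynomial.pderiv j (p i)) = 0 := by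
    intro i j k
    have e := fun a b c => congrArg (MvPolynomial.pderiv c) (hp a b)
    simp only [map_add, map_zero] at e
    have e1 := e i j k
    have e2 := e j k i
    have e3 := e k i j
    rw [pderiv_comm k i] at e1
    rw [pderiv_comm i j] at e2
    rw [pderiv_comm j k] at e3
    have : (2 : MvPolynomial (Fin 3) ℝ) *
        MvPolynomial.pderiv k (MvPolynomial.pderiv j (p i)) = 0 := by
      linear_combination e1 - e2 + e3
    exact (mul_eq_zero.1 this).resolve_left two_ne_zero
  -- the first derivatives are constant
  set A : Fin 3 → Fin 3 → ℝ := fun i j =>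
    MvPolynomial.eval (0 : R3).ofLp (MvPolynomial.pderiv j (p i)) with hA
  have hc : ∀ i j (y : R3), MvPolynomial.eval y.ofLp (MvPolynomial.pderiv j (p i)) = A i j := by
    intro i j y
    have := eval_add_eq_of_dirDeriv (p := MvPolynomial.pderiv j (p i)) (x := 0) (w := y) (c := 0)
      fun z => by simp [dirDeriv, h2]
    simpa [hA] using this
  have hskew : ∀ i j, A i j = - A j i := fun i j => by
    have := congrArg (MvPolynomial.eval (0 : R3).ofLp) (hp i j)
    rw [map_add, map_zero] at this
    linarith
  refine ⟨fun w => WithLp.toLp 2 fun i => ∑ j, w j * A i j, fun w z => ?_, fun x w => ?_⟩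
  · simp only [← dot_eq_inner, dot, Finset.sum_mul, Finset.mul_sum, ← Finset.sum_neg_distrib]
    rw [Finset.sum_comm]
    refine Finset.sum_congr rfl fun i _ => Finset.sum_congr rfl fun j _ => ?_
    rw [hskew]; ring
  · ext i
    exact eval_add_eq_of_dirDeriv fun y => by simp [dirDeriv, hc]

/-- A rigid motion that vanishes on a piece of a plane is zero. -/
theorem IsRigid.eq_zero_of_eqOn {p : PolyVec} (hp : IsRigid p) {X : Set R3} (hX : IsFlat 2 X)
    (h0 : ∀ x ∈ X, p.at x = 0) (y : R3) : p.at y = 0 := by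
  obtain ⟨L, hL, hpL⟩ := hp.exists_linear
  obtain ⟨n, hn, hnX⟩ := hX.exists_unit_normal
  obtain ⟨x, hx⟩ := hX.nonempty
  have hLw : ∀ w ∈ vectorSpan ℝ X, L w = 0 := by
    intro w hw
    have hv : p.at (x + w) = 0 := PolyVec.at_eq_zero_iff.2 fun i =>
      hX.eval_eq_zero_of_mem_affineSpan (fun z hz => PolyVec.at_eq_zero_iff.1 (h0 z hz) i) (by
        have := (affineSpan ℝ X).vadd_mem_of_mem_direction
          (by rw [direction_affineSpan]; exact hw) (subset_affineSpan ℝ X hx)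
        rwa [vadd_eq_add, add_comm] at this)
    rw [hpL, h0 x hx, zero_add] at hv
    exact hv
  -- the image of `L` is orthogonal to every vector
  have hproj : ∀ w : R3, ∃ a ∈ vectorSpan ℝ X, w = a + (inner ℝ n w : ℝ) • n := fun w =>
    ⟨w - (inner ℝ n w : ℝ) • n, (hX.mem_vectorSpan_iff hn hnX).2 (by
      rw [inner_sub_right, inner_smul_right, real_inner_self_eq_norm_sq, hn]; ring), by abel⟩
  have hLn : ∀ w, inner ℝ n (L w) = (0 : ℝ) := by
    intro w
    have hnn : inner ℝ n (L n) = (0 : ℝ) := by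
      have := hL n n
      rw [real_inner_comm] at this
      linarith
    obtain ⟨a, ha, hw⟩ := hproj w
    have h1 := hL n w
    rw [hw, inner_add_right, inner_smul_right, hL n a, hLw a ha, inner_zero_right, neg_zero,
      real_inner_comm n, hnn, mul_zero, add_zero, ← hw] at h1
    linarith
  have hL0 : L (y - x) = 0 := by
    obtain ⟨a, ha, hw⟩ := hproj (L (y - x))
    refine inner_self_eq_zero (𝕜 := ℝ).1 ?_
    nth_rewrite 2 [hw]
    rw [inner_add_right, inner_smul_right, hLn, zero_mul, add_zero, hL, hLw a ha, inner_zero_right,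
      neg_zero]
  have := hpL x (y - x)
  rwa [add_sub_cancel, h0 x hx, hL0, add_zero] at this

namespace PolyMesh

variable {Ω : Set R3} {M : PolyMesh Ω} {G : Set R3}

/-! ### The divergence theorem for the cell reconstructions -/

theorem div_cell_apply (K : M.cells) (ξ : PolyMat) (i : Fin 3) :
    ξ.div (K : Set R3) i = ∑ j, MvPolynomial.pderiv j (ξ i j) := by
  have hspan : vectorSpan ℝ (K : Set R3) = ⊤ := by
    rw [← direction_affineSpan, (M.isOpen_cell K).affineSpan_eq_top (M.isFlat_cell K).nonempty,
      AffineSubspace.direction_top]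
  rw [div_eq_sum_dirDeriv]
  refine Finset.sum_congr rfl fun j _ => ?_
  have : tangentBasis (K : Set R3) j = EuclideanSpace.single j 1 := by
    exact Submodule.starProjection_eq_self_iff.2 (by rw [hspan]; trivial)
  rw [this, dirDeriv_single]

/-- Integration by parts on a cell. -/
theorem integral_dot_div_add_integral_grad (K : M.cells) (p : PolyVec) (ξ : PolyMat) :
    ∫ x in (K : Set R3), dot (p.at x) ((ξ.div (K : Set R3)).at x) ∂μHE[3] +
      ∫ x in (K : Set R3), ddot (p.grad.at x) (ξ.at x) ∂μHE[3] =
    ∑ σ : M.facesOf K, ∫ x in (σ.1 : Set R3),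
      dot (p.at x) (mulVec (ξ.at x) (outwardNormal K σ.1)) ∂μHE[2] := by
  have hK := M.isFlat_cell K
  rw [← hK.integral_add (p.continuous_at.dot (PolyVec.continuous_at _))
    ((PolyMat.continuous_at _).ddot ξ.continuous_at)]
  have e1 : ∀ x : R3, dot (p.at x) ((ξ.div (K : Set R3)).at x) + ddot (p.grad.at x) (ξ.at x) =
      ∑ i, ∑ j, MvPolynomial.eval x.ofLp (MvPolynomial.pderiv j (p i * ξ i j)) := by
    intro x
    simp only [dot, ddot, PolyVec.at, PolyMat.at, PolyVec.grad, div_cell_apply, map_sum,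
      MvPolynomial.pderiv_mul, map_add, map_mul, Matrix.of_apply, Finset.mul_sum,
      ← Finset.sum_add_distrib]
    exact Finset.sum_congr rfl fun i _ => Finset.sum_congr rfl fun j _ => by ring
  have e2 : ∀ (n x : R3), dot (p.at x) (mulVec (ξ.at x) n) =
      ∑ i, ∑ j, n j * MvPolynomial.eval x.ofLp (p i * ξ i j) := by
    intro n x
    simp only [dot, mulVec, PolyVec.at, PolyMat.at, Matrix.mulVec, dotProduct, Matrix.of_apply,
      map_mul, Finset.mul_sum]
    exact Finset.sum_congr rfl fun i _ => Finset.sum_congr rfl fun j _ => by ring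
  simp only [e1, e2]
  have hint : ∀ i j, IntegrableOn (fun x : R3 =>
      MvPolynomial.eval x.ofLp (MvPolynomial.pderiv j (p i * ξ i j))) (K : Set R3) μHE[3] :=
    fun i j => hK.integrableOn (continuous_eval _)
  rw [integral_finsetSum _ fun i _ => integrable_finsetSum _ fun j _ => hint i j]
  have hσ : ∀ σ : M.facesOf K, ∫ x in (σ.1 : Set R3), ∑ i, ∑ j,
      outwardNormal (K : Set R3) (σ.1 : Set R3) j * MvPolynomial.eval x.ofLp (p i * ξ i j) ∂μHE[2] =
      ∑ i, ∑ j, outwardNormal (K : Set R3) (σ.1 : Set R3) j *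
        ∫ x in (σ.1 : Set R3), MvPolynomial.eval x.ofLp (p i * ξ i j) ∂μHE[2] := by
    intro σ
    have hi : ∀ i j, IntegrableOn (fun x : R3 => outwardNormal (K : Set R3) (σ.1 : Set R3) j *
        MvPolynomial.eval x.ofLp (p i * ξ i j)) (σ.1 : Set R3) μHE[2] :=
      fun i j => (M.isFlat_face σ.1).integrableOn (continuous_const.mul (continuous_eval _))
    rw [integral_finsetSum _ fun i _ => integrable_finsetSum _ fun j _ => hi i j]
    refine Finset.sum_congr rfl fun i _ => ?_
    rw [integral_finsetSum _ fun j _ => hi i j]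
    exact Finset.sum_congr rfl fun j _ => integral_const_mul _ _
  simp only [hσ]
  rw [Finset.sum_comm]
  refine Finset.sum_congr rfl fun i _ => ?_
  rw [integral_finsetSum _ fun j _ => hint i j, Finset.sum_comm]
  refine Finset.sum_congr rfl fun j _ => ?_
  rw [euclideanHausdorffMeasure_three]
  exact M.integral_pderiv_cell K _ j

theorem grad_degLE {p : PolyVec} (hp : p.DegLE 2) : p.grad.DegLE 1 := fun i j =>
  (totalDegree_pderiv_le j (p i)).trans (by have := hp i; omega)

/-- When the cell displacement matches the face displacements on the boundary, the discrete
gradient is the gradient of the cell displacement. -/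
theorem cellGrad_at_eq_grad {v : M.Dofs} {K : M.cells}
    (h : ∀ σ : M.facesOf K, ∀ x ∈ (σ.1 : Set R3), (cellRec v K).at x = (faceRec v K σ).at x) :
    ∀ x ∈ (K : Set R3), (cellGrad v K).at x = (cellRec v K).grad.at x := by
  have hK := M.isFlat_cell K
  have hG := isGradRec_cellGrad v K
  have hP := isPotRec_cellRec v K
  set ξ : PolyMat := cellGrad v K - (cellRec v K).grad with hξ
  have hξ1 : ξ.DegLE 1 := Submodule.sub_mem (PolyMat.degLE 1) hG.1 (grad_degLE hP.1)
  -- the divergence of `ξ` is constant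
  obtain ⟨a, ha⟩ : ∃ a : R3, ∀ x, (ξ.div (K : Set R3)).at x = a := by
    have h0 : ∀ i, (ξ.div (K : Set R3) i).totalDegree = 0 := fun i => by
      rw [div_cell_apply, ← Nat.le_zero]
      refine MvPolynomial.totalDegree_finsetSum_le fun j _ => ?_
      exact (totalDegree_pderiv_le j _).trans (by have := hξ1 i j; omega)
    refine ⟨(ξ.div (K : Set R3)).at 0, fun x => ?_⟩
    ext i
    change MvPolynomial.eval x.ofLp _ = MvPolynomial.eval (0 : R3).ofLp _
    rw [MvPolynomial.totalDegree_eq_zero_iff_eq_C.1 (h0 i)]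
    simp
  have e1 := hG.2 ξ hξ1
  have e2 := integral_dot_div_add_integral_grad K (cellRec v K) ξ
  have e3 : cellBdryTerm v K ξ = ∑ σ : M.facesOf K, ∫ x in (σ.1 : Set R3),
      dot ((cellRec v K).at x) (mulVec (ξ.at x) (outwardNormal K σ.1)) ∂μHE[2] :=
    Finset.sum_congr rfl fun σ _ => setIntegral_congr_fun (M.isFlat_face σ.1).measurableSet
      fun x hx => by simp only [h σ x hx]
  simp only [ha] at e1 e2
  rw [hK.integral_dot_potRec three_ne_zero hG hP a] at e2
  rw [e3, ← e2, setIntegral_const, smul_eq_mul, ← hK.ddotForm_apply, ← hK.ddotForm_apply] at e1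
  have h0 : hK.ddotForm ξ ξ = 0 := by
    have h1 : hK.ddotForm ξ ξ =
        hK.ddotForm (cellGrad v K) ξ - hK.ddotForm (cellRec v K).grad ξ := by
      conv_lhs => arg 1; rw [hξ, map_sub]
      rfl
    rw [h1, e1]
    ring
  intro x hx
  have := hK.at_eq_zero_of_ddotForm_self h0 x hx
  have hsub : ξ.at x = (cellGrad v K).at x - (cellRec v K).grad.at x := by
    ext i j; simp [ξ, PolyMat.at]
  rw [hsub] at this
  exact sub_eq_zero.1 this

/-- If moreover the discrete strain vanishes, then the cell displacement is a rigid motion. -/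
theorem isRigid_cellRec {v : M.Dofs} {K : M.cells}
    (h : ∀ σ : M.facesOf K, ∀ x ∈ (σ.1 : Set R3), (cellRec v K).at x = (faceRec v K σ).at x)
    (hs : ∀ x ∈ (K : Set R3), strain v K x = 0) : IsRigid (cellRec v K) := by
  intro i j
  refine MvPolynomial.funext fun y => ?_
  rw [map_zero]
  refine (M.isFlat_cell K).eval_eq_zero_of_mem_affineSpan (fun x hx => ?_)
    (mem_affineSpan_cell K (WithLp.toLp 2 y))
  have h1 := congrFun (congrFun (hs x hx) i) j
  rw [strain, cellGrad_at_eq_grad h x hx] at h1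
  simp only [Matrix.smul_apply, Matrix.add_apply, Matrix.transpose_apply, smul_eq_mul,
    Matrix.zero_apply, PolyMat.at, Matrix.of_apply, PolyVec.grad] at h1
  rw [map_add]
  linarith

end PolyMesh

theorem trace_sq_le (A : Matrix (Fin 3) (Fin 3) ℝ) : A.trace * A.trace ≤ 3 * ddot A A := by
  simp only [Matrix.trace, Matrix.diag, ddot, Fin.sum_univ_three]
  nlinarith [sq_nonneg (A 0 0 - A 1 1), sq_nonneg (A 0 0 - A 2 2), sq_nonneg (A 1 1 - A 2 2),
    sq_nonneg (A 0 1), sq_nonneg (A 0 2), sq_nonneg (A 1 0), sq_nonneg (A 1 2), sq_nonneg (A 2 0),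
    sq_nonneg (A 2 1)]

/-- Coercivity of the isotropic elasticity tensor: the bound `(tr A)² ≤ 3 |A|²` is what is needed
for negative Poisson ratios. -/
theorem exists_pos_mul_ddot_le {ν : ℝ} (hν : -1 < ν) (hν' : ν < 1 / 2) :
    ∃ c : ℝ, 0 < c ∧ ∀ A : Matrix (Fin 3) (Fin 3) ℝ,
      c * ddot A A ≤ ddot A A + ν / (1 - 2 * ν) * (A.trace * A.trace) := by
  have h2 : 0 < 1 - 2 * ν := by linarith
  rcases le_or_gt 0 ν with h | h
  · refine ⟨1, one_pos, fun A => ?_⟩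
    have : 0 ≤ ν / (1 - 2 * ν) * (A.trace * A.trace) :=
      mul_nonneg (div_nonneg h h2.le) (mul_self_nonneg _)
    linarith
  · refine ⟨1 + 3 * (ν / (1 - 2 * ν)), ?_, fun A => ?_⟩
    · have : 1 + 3 * (ν / (1 - 2 * ν)) = (1 + ν) / (1 - 2 * ν) := by
        rw [eq_div_iff h2.ne', add_mul, mul_assoc, div_mul_cancel₀ _ h2.ne']
        ring
      rw [this]
      exact div_pos (by linarith) h2
    · have := mul_le_mul_of_nonpos_left (trace_sq_le A) (div_neg_of_neg_of_pos h h2).le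
      linarith

namespace PolyMesh

variable {Ω : Set R3} {M : PolyMesh Ω} {G : Set R3}

/-! ### Kernels of the forms -/

theorem elastic_self_nonneg {E ν : ℝ} (hν : -1 < ν) (hν' : ν < 1 / 2) (hE : 0 < E / (1 + ν))
    (v : M.Dofs) : 0 ≤ elastic E ν v v ∧
      (elastic E ν v v = 0 → ∀ K : M.cells, ∀ x ∈ (K : Set R3), strain v K x = 0) := by
  obtain ⟨c, hc, hcA⟩ := exists_pos_mul_ddot_le hν hν'
  have hle : ∀ (K : M.cells) (x : R3), E / (1 + ν) * (c * ddot (strain v K x) (strain v K x)) ≤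
      ddot (stress E ν v K x) (strain v K x) := fun K x => by
    rw [ddot_stress]
    exact mul_le_mul_of_nonneg_left (hcA _) hE.le
  have hnn : ∀ (K : M.cells) (x : R3), 0 ≤ ddot (stress E ν v K x) (strain v K x) := fun K x =>
    (mul_nonneg hE.le (mul_nonneg hc.le (ddot_self_nonneg _))).trans (hle K x)
  have hK : ∀ K ∈ (Finset.univ : Finset M.cells),
      0 ≤ ∫ x in (K : Set R3), ddot (stress E ν v K x) (strain v K x) :=
    fun K _ => integral_nonneg (hnn K)
  refine ⟨Finset.sum_nonneg hK, fun h0 K x hx => ?_⟩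
  have h1 := (Finset.sum_eq_zero_iff_of_nonneg hK).1 h0 K (Finset.mem_univ K)
  rw [← euclideanHausdorffMeasure_three] at h1
  have h2 := (M.isFlat_cell K).eqOn_zero_of_integral_eq_zero
    ((continuous_stress E ν v K).ddot (continuous_strain v K)) (hnn K) h1 x hx
  have h3 := hle K x
  rw [h2, ← mul_assoc] at h3
  exact ddot_self_eq_zero.1 (le_antisymm
    (nonpos_of_mul_nonpos_right h3 (mul_pos hE hc)) (ddot_self_nonneg _))

/-- The cell displacement of `v` on `K` agrees with all the other reconstructions and components
of `v` on the boundary of `K`. -/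
structure IsMatching (v : M.Dofs) (K : M.cells) : Prop where
  face : ∀ σ : M.facesOf K, ∀ x ∈ (σ.1 : Set R3), (cellRec v K).at x = (faceRec v K σ).at x
  edge : ∀ e : M.edgesOf K, ∀ x ∈ (e.1 : Set R3), (cellRec v K).at x = (edgeRec v K e).at x
  vert : ∀ s : M.vertsOf K, (cellRec v K).at s.1 = Dofs.vert v K s

theorem diam_cell_pos (K : M.cells) : 0 < Metric.diam (K : Set R3) := by
  have hK := M.isFlat_cell K
  refine Metric.diam_pos ?_ hK.isBounded
  by_contra h
  rw [Set.not_nontrivial_iff] at h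
  have := hK.finrank_vectorSpan
  rw [vectorSpan_of_subsingleton ℝ h, finrank_bot] at this
  omega

theorem stabCell_self_nonneg (v : M.Dofs) (K : M.cells) :
    0 ≤ stabCell v v K ∧ (stabCell v v K = 0 → IsMatching v K) := by
  have hd := diam_cell_pos K
  have hF : ∀ σ ∈ (Finset.univ : Finset (M.facesOf K)), 0 ≤ ∫ x in (σ.1 : Set R3),
      dot ((cellRec v K).at x - (faceRec v K σ).at x)
        ((cellRec v K).at x - (faceRec v K σ).at x) ∂μHE[2] :=
    fun σ _ => integral_nonneg fun x => dot_self_nonneg _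
  have hE : ∀ e ∈ (Finset.univ : Finset (M.edgesOf K)), 0 ≤ ∫ x in (e.1 : Set R3),
      dot ((cellRec v K).at x - (edgeRec v K e).at x)
        ((cellRec v K).at x - (edgeRec v K e).at x) ∂μHE[1] :=
    fun e _ => integral_nonneg fun x => dot_self_nonneg _
  have hV : ∀ s ∈ (Finset.univ : Finset (M.vertsOf K)), 0 ≤
      dot ((cellRec v K).at s.1 - Dofs.vert v K s) ((cellRec v K).at s.1 - Dofs.vert v K s) :=
    fun s _ => dot_self_nonneg _
  have h1 := mul_nonneg (inv_nonneg.2 hd.le) (Finset.sum_nonneg hF)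
  have h2 := Finset.sum_nonneg hE
  have h3 := mul_nonneg hd.le (Finset.sum_nonneg hV)
  refine ⟨add_nonneg (add_nonneg h1 h2) h3, fun h0 => ?_⟩
  obtain ⟨h12, e3⟩ := (add_eq_zero_iff_of_nonneg (add_nonneg h1 h2) h3).1 h0
  obtain ⟨e1, e2⟩ := (add_eq_zero_iff_of_nonneg h1 h2).1 h12
  have e1' := (mul_eq_zero.1 e1).resolve_left (inv_ne_zero hd.ne')
  have e3' := (mul_eq_zero.1 e3).resolve_left hd.ne'
  refine ⟨fun σ x hx => ?_, fun e x hx => ?_, fun s => ?_⟩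
  · have hc : Continuous fun x => (cellRec v K).at x - (faceRec v K σ).at x :=
      (PolyVec.continuous_at _).sub (PolyVec.continuous_at _)
    exact sub_eq_zero.1 (dot_self_eq_zero.1 ((M.isFlat_face σ.1).eqOn_zero_of_integral_eq_zero
      (hc.dot hc) (fun _ => dot_self_nonneg _)
      ((Finset.sum_eq_zero_iff_of_nonneg hF).1 e1' σ (Finset.mem_univ σ)) x hx))
  · have hc : Continuous fun x => (cellRec v K).at x - (edgeRec v K e).at x :=
      (PolyVec.continuous_at _).sub (PolyVec.continuous_at _)
    exact sub_eq_zero.1 (dot_self_eq_zero.1 ((M.isFlat_edge e.1).eqOn_zero_of_integral_eq_zero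
      (hc.dot hc) (fun _ => dot_self_nonneg _)
      ((Finset.sum_eq_zero_iff_of_nonneg hE).1 e2 e (Finset.mem_univ e)) x hx))
  · exact sub_eq_zero.1 (dot_self_eq_zero.1
      ((Finset.sum_eq_zero_iff_of_nonneg hV).1 e3' s (Finset.mem_univ s)))

theorem stab_self_nonneg (v : M.Dofs) :
    0 ≤ stab v v ∧ (stab v v = 0 → ∀ K, IsMatching v K) := by
  have h : ∀ K ∈ (Finset.univ : Finset M.cells), 0 ≤ stabCell v v K :=
    fun K _ => (stabCell_self_nonneg v K).1
  exact ⟨Finset.sum_nonneg h, fun h0 K => (stabCell_self_nonneg v K).2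
    ((Finset.sum_eq_zero_iff_of_nonneg h).1 h0 K (Finset.mem_univ K))⟩

/-! ### Propagation of rigid motions -/

/-- The face displacement only depends on the components at the face and on its boundary. -/
theorem faceRec_congr {v w : M.Dofs} {K L : M.cells} {σ : M.faces} (hK : (σ : Set R3) ⊆ bdry K)
    (hL : (σ : Set R3) ⊆ bdry L)
    (hface : Dofs.face v K ⟨σ, hK⟩ = Dofs.face w L ⟨σ, hL⟩)
    (hedge : ∀ e : M.edges, (e : Set R3) ⊆ closure (σ : Set R3) →
      ∀ (heK : (e : Set R3) ⊆ bdry K) (heL : (e : Set R3) ⊆ bdry L),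
        Dofs.edge v K ⟨e, heK⟩ = Dofs.edge w L ⟨e, heL⟩)
    (hvert : ∀ s : M.vertices, (s : R3) ∈ closure (σ : Set R3) →
      ∀ (hsK : (s : R3) ∈ bdry K) (hsL : (s : R3) ∈ bdry L),
        Dofs.vert v K ⟨s, hsK⟩ = Dofs.vert w L ⟨s, hsL⟩) :
    faceRec v K ⟨σ, hK⟩ = faceRec w L ⟨σ, hL⟩ := by
  have he : ∀ e : M.edgesOf (σ : Set R3),
      edgeRec v K (M.edgeOfFace (σ := ⟨σ, hK⟩) e) =
        edgeRec w L (M.edgeOfFace (σ := ⟨σ, hL⟩) e) := by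
    intro e
    have heσ : (e.1 : Set R3) ⊆ closure (σ : Set R3) := e.2.trans Set.sdiff_subset
    unfold edgeRec
    congr 1
    ext p
    refine and_congr_right fun _ => and_congr (forall_congr' fun s => ?_) ?_
    · have h := hvert s.1 (closure_minimal heσ isClosed_closure s.2.1)
        (M.vertOfEdge (e := M.edgeOfFace (σ := ⟨σ, hK⟩) e) s).2
        (M.vertOfEdge (e := M.edgeOfFace (σ := ⟨σ, hL⟩) e) s).2
      exact Eq.congr_right h
    · exact Eq.congr_right (hedge e.1 heσ _ _)
  have hb : faceBdryTerm v K ⟨σ, hK⟩ = faceBdryTerm w L ⟨σ, hL⟩ := by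
    ext ξ
    unfold faceBdryTerm
    exact Finset.sum_congr rfl fun e _ => by rw [he e]
  unfold faceRec faceGrad
  rw [hb, hface]

theorem faceRec_eq_of_mem_dispSpace {v : M.Dofs} (hv : v ∈ M.dispSpace G) {K L : M.cells}
    {σ : M.faces} (hσ : ¬ M.IsFracture G σ) (hK : (σ : Set R3) ⊆ bdry K)
    (hL : (σ : Set R3) ⊆ bdry L) : faceRec v K ⟨σ, hK⟩ = faceRec v L ⟨σ, hL⟩ := by
  have hlink : ∀ z : Set R3, z ⊆ closure (σ : Set R3) → M.SameSide G z K L := fun z hz =>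
    Or.inr (.rel _ _ ⟨σ, hσ, hz, hK, hL⟩)
  exact faceRec_congr hK hL (hv.2.2 K L σ hK hL (hlink _ subset_closure))
    (fun e he heK heL => hv.2.1 K L e heK heL (hlink _ he))
    (fun s hs hsK hsL => hv.1 K L s hsK hsL (hlink _ (Set.singleton_subset_iff.2 hs)))

theorem faceRec_zero_at (K : M.cells) (σ : M.facesOf K) :
    ∀ x ∈ (σ.1 : Set R3), (faceRec (0 : M.Dofs) K σ).at x = 0 := by
  intro x hx
  have := faceRec_add_smul (0 : M.Dofs) 0 1 K σ x hx
  simpa using this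

theorem faceRec_at_eq_zero_of_mem_zeroTrace {v : M.Dofs} (hv : v ∈ M.zeroTrace) {K : M.cells}
    {σ : M.facesOf K} (hσ : (σ.1 : Set R3) ⊆ frontier Ω) :
    ∀ x ∈ (σ.1 : Set R3), (faceRec v K σ).at x = 0 := by
  have hcl : closure (σ.1 : Set R3) ⊆ frontier Ω := closure_minimal hσ isClosed_frontier
  have : faceRec v K σ = faceRec (0 : M.Dofs) K σ :=
    faceRec_congr σ.2 σ.2 (hv.2.2 K σ hσ) (fun e he heK _ => hv.2.1 K ⟨e, heK⟩ (he.trans hcl))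
      (fun s hs hsK _ => hv.1 K ⟨s, hsK⟩ (hcl hs))
  rw [this]
  exact faceRec_zero_at K σ

/-- A displacement whose reconstructions match, with rigid motions in the cells, vanishes: by the
matching the rigid motion is the same in neighbouring cells, and it vanishes in the cells at the
boundary of the domain, from which all the other cells can be reached. -/
theorem cellRec_at_eq_zero (hΩ : IsPolyhedron Ω) (hM : M.Compliant G) (hdisc : NotDisconnecting Ω G)
    {v : M.Dofs} (hv : v ∈ M.dispSpaceZero G) (hmatch : ∀ K, IsMatching v K)
    (hrigid : ∀ K : M.cells, IsRigid (cellRec v K)) (K : M.cells) (x : R3) :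
    (cellRec v K).at x = 0 := by
  have hnb : ∀ K L : M.cells, Relation.EqvGen (M.Neighbours G) K L →
      ∀ x, (cellRec v K).at x = (cellRec v L).at x := by
    intro K L h
    induction h with
    | rel K L h =>
      obtain ⟨σ, hσ, hK, hL⟩ := h
      intro x
      have h0 := ((hrigid K).sub (hrigid L)).eq_zero_of_eqOn (M.isFlat_face σ) (fun y hy => by
        rw [PolyVec.at_sub, (hmatch K).face ⟨σ, hK⟩ y hy, (hmatch L).face ⟨σ, hL⟩ y hy,
          faceRec_eq_of_mem_dispSpace hv.1 hσ hK hL, sub_self]) x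
      rw [PolyVec.at_sub] at h0
      exact sub_eq_zero.1 h0
    | refl K => exact fun _ => rfl
    | symm K L _ ih => exact fun x => (ih x).symm
    | trans K L N _ _ ih ih' => exact fun x => (ih x).trans (ih' x)
  obtain ⟨L, hKL, σ, hσ⟩ := M.exists_boundary_face hΩ hM hdisc K
  rw [hnb K L hKL]
  exact (hrigid L).eq_zero_of_eqOn (M.isFlat_face σ.1) (fun y hy => by
    rw [(hmatch L).face σ y hy, faceRec_at_eq_zero_of_mem_zeroTrace hv.2 hσ y hy]) x

/-- The components of a displacement are means or values of its reconstructions. -/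
theorem eq_zero_of_cellRec {v : M.Dofs} (hmatch : ∀ K, IsMatching v K)
    (h0 : ∀ (K : M.cells) (x : R3), (cellRec v K).at x = 0) : v = 0 := by
  have hs : ∀ K s, Dofs.vert v K s = 0 := fun K s => by rw [← (hmatch K).vert s, h0]
  have he : ∀ K e, Dofs.edge v K e = 0 := fun K e => by
    rw [← (isEdgeRec_edgeRec v K e).2.2, setAverage_eq, setIntegral_eq_zero_of_forall_eq_zero
      fun x hx => by rw [← (hmatch K).edge e x hx, h0], smul_zero]
  have hf : ∀ K σ, Dofs.face v K σ = 0 := fun K σ => eq_zero_of_forall_dot fun a => by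
    have := (M.isFlat_face σ.1).integral_dot_potRec two_ne_zero (isGradRec_faceGrad v K σ)
      (isPotRec_faceRec v K σ) a
    rw [setIntegral_eq_zero_of_forall_eq_zero fun x hx => by
      rw [← (hmatch K).face σ x hx, h0, dot_zero_left]] at this
    exact (mul_eq_zero.1 this.symm).resolve_left (M.isFlat_face σ.1).measureReal_pos.ne'
  have hc : ∀ K, Dofs.cell v K = 0 := fun K => eq_zero_of_forall_dot fun a => by
    have := (M.isFlat_cell K).integral_dot_potRec three_ne_zero (isGradRec_cellGrad v K)
      (isPotRec_cellRec v K) a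
    rw [setIntegral_eq_zero_of_forall_eq_zero fun x hx => by rw [h0, dot_zero_left]] at this
    exact (mul_eq_zero.1 this.symm).resolve_left (M.isFlat_cell K).measureReal_pos.ne'
  exact Prod.ext (funext₂ hs) (Prod.ext (funext₂ he) (Prod.ext (funext₂ hf) (funext hc)))

/-- The bilinear form of the scheme is positive definite. -/
theorem elastic_add_stab_pos (hΩ : IsPolyhedron Ω) (hM : M.Compliant G)
    (hdisc : NotDisconnecting Ω G) {E ν μ₁ : ℝ} (hν : -1 < ν) (hν' : ν < 1 / 2)
    (hE : 0 < E / (1 + ν)) (hμ₁ : 0 < μ₁) {v : M.Dofs} (hv : v ∈ M.dispSpaceZero G) (hv0 : v ≠ 0) :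
    0 < elastic E ν v v + μ₁ * stab v v := by
  have h1 := elastic_self_nonneg hν hν' hE v
  have h2 := stab_self_nonneg v
  have h3 := mul_nonneg hμ₁.le h2.1
  refine lt_of_le_of_ne (add_nonneg h1.1 h3) fun h0 => hv0 ?_
  have hs := h1.2 (by linarith)
  have hstab : μ₁ * stab v v = 0 := by linarith [h1.1]
  have hmatch := h2.2 ((mul_eq_zero.1 hstab).resolve_left hμ₁.ne')
  exact eq_zero_of_cellRec hmatch (cellRec_at_eq_zero hΩ hM hdisc hv hmatch fun K =>
    isRigid_cellRec (hmatch K).face (hs K))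

end PolyMesh

/-! ### An abstract saddle point problem -/

/-- Existence and uniqueness for the saddle point problem of a symmetric positive definite form `a`
and a constraint form `b` that is injective on the multipliers. In the inner product `a`, the
multiplier is found by projecting the unconstrained solution `u₀` onto the convex set of the
`T μ`, `μ ∈ C`, where `T μ` represents `b μ`. -/
theorem existsUnique_saddlePoint {V W : Type*} [AddCommGroup V] [Module ℝ V]
    [FiniteDimensional ℝ V] [AddCommGroup W] [Module ℝ W] [TopologicalSpace W]
    [IsTopologicalAddGroup W] [ContinuousSMul ℝ W] [T2Space W] [FiniteDimensional ℝ W]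
    (a : V →ₗ[ℝ] V →ₗ[ℝ] ℝ) (b : W →ₗ[ℝ] V →ₗ[ℝ] ℝ) (ℓ : V →ₗ[ℝ] ℝ)
    (hsymm : ∀ u v, a u v = a v u) (hpos : ∀ u, u ≠ 0 → 0 < a u u)
    (hb : ∀ μ, (∀ v, b μ v = 0) → μ = 0) {C : Set W} (hne : C.Nonempty) (hcl : IsClosed C)
    (hconv : Convex ℝ C) :
    ∃! p : V × C, (∀ v, a p.1 v + b p.2 v = ℓ v) ∧ ∀ m : C, b (m - p.2) p.1 ≤ 0 := by
  have hdef : ∀ u, a u u = 0 → u = 0 := fun u hu => by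
    by_contra h
    exact (hpos u h).ne' hu
  let core : InnerProductSpace.Core ℝ V :=
    { inner := fun u v => a u v
      conj_inner_symm := fun u v => hsymm v u
      re_inner_nonneg := fun u => by
        rcases eq_or_ne u 0 with rfl | h
        · simp
        · exact (hpos u h).le
      add_left := fun u v w => by simp
      smul_left := fun u v r => by simp
      definite := hdef }
  let : NormedAddCommGroup V := core.toNormedAddCommGroup
  let : InnerProductSpace ℝ V := InnerProductSpace.ofCore core.toCore
  have hinner : ∀ u v : V, inner ℝ u v = a u v := fun _ _ => rfl
  have hinj : Function.Injective a := (injective_iff_map_eq_zero a).2 fun u hu =>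
    hdef u (by rw [hu]; rfl)
  have hfr : Module.finrank ℝ V = Module.finrank ℝ (V →ₗ[ℝ] ℝ) :=
    (Subspace.dual_finrank_eq (K := ℝ) (V := V)).symm
  let R : V ≃ₗ[ℝ] (V →ₗ[ℝ] ℝ) := LinearEquiv.ofInjectiveOfFinrankEq a hinj hfr
  have hR : ∀ φ v, a (R.symm φ) v = φ v := fun φ v =>
    congrArg (fun ψ : V →ₗ[ℝ] ℝ => ψ v) (R.apply_symm_apply φ)
  let T : W →ₗ[ℝ] V := R.symm.toLinearMap ∘ₗ b
  have hT : ∀ μ v, a (T μ) v = b μ v := fun μ v => hR (b μ) v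
  have hTinj : LinearMap.ker T = ⊥ := LinearMap.ker_eq_bot'.2 fun μ hμ => hb μ fun v => by
    rw [← hT, hμ, map_zero, LinearMap.zero_apply]
  have hK : IsClosed (T '' C) :=
    (LinearMap.isClosedEmbedding_of_injective hTinj).isClosedMap C hcl
  have hKc : Convex ℝ (T '' C) := hconv.linear_image T
  obtain ⟨_, ⟨l, hl, rfl⟩, hmin⟩ := exists_norm_eq_iInf_of_complete_convex (hne.image T)
    hK.isComplete hKc (R.symm ℓ)
  rw [norm_eq_iInf_iff_real_inner_le_zero hKc (Set.mem_image_of_mem T hl)] at hmin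
  have h1 : ∀ v, a (R.symm ℓ - T l) v + b l v = ℓ v := fun v => by simp [hR, hT]
  have h2 : ∀ m : C, b (m - l) (R.symm ℓ - T l) ≤ 0 := fun m => by
    have := hmin (T m) (Set.mem_image_of_mem T m.2)
    rwa [hinner, ← map_sub, hsymm, hT] at this
  refine ⟨(R.symm ℓ - T l, ⟨l, hl⟩), ⟨h1, h2⟩, ?_⟩
  rintro ⟨u, κ⟩ ⟨h1', h2'⟩
  generalize R.symm ℓ - T l = u' at h1 h2
  have hd : ∀ v, a (u - u') v = b (l - κ.1) v := fun v => by
    have e1 := h1 v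
    have e2 := h1' v
    simp only [map_sub, LinearMap.sub_apply] at e1 e2 ⊢
    linarith
  have hu : u - u' = 0 := by
    by_contra h
    have hp := hpos _ h
    have e1 := h2 κ
    have e2 := h2' ⟨l, hl⟩
    rw [hd] at hp
    simp only [map_sub, LinearMap.sub_apply] at e1 e2 hp
    linarith
  have hl' : l - κ.1 = 0 := hb _ fun v => by rw [← hd, hu, map_zero, LinearMap.zero_apply]
  exact Prod.ext (sub_eq_zero.1 hu) (Subtype.ext (sub_eq_zero.1 hl').symm)

namespace PolyMesh

variable {Ω : Set R3} {M : PolyMesh Ω} {G : Set R3}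

/-! ### Multipliers -/

/-- The two cells at a fracture face are on different sides of the network: every face that
touches the whole of a face `σ` is `σ` itself. -/
theorem eq_of_sameSide {σ : M.fracFaces G} {K L : M.cells}
    (h : M.SameSide G (σ.1 : Set R3) K L) : K = L := by
  rcases h with h | h
  · exact absurd (σ.2.trans Set.inter_subset_left) h
  · induction h with
    | rel K L h =>
      obtain ⟨τ, hτ, hστ, -, -⟩ := h
      obtain ⟨x, hx⟩ := (M.isFlat_face σ.1).nonempty
      rw [← M.eq_of_mem_closure_face hx (hστ hx)] at hτ
      exact absurd σ.2 hτ
    | refl K => rfl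
    | symm K L _ ih => exact ih.symm
    | trans K L N _ _ ih ih' => exact ih.trans ih'

/-- The contact form separates multipliers: a displacement whose only nonzero component is the one
at a given fracture face, seen from the positive side, has a jump on that face only. -/
theorem eq_zero_of_contact (hΩ : IsPolyhedron Ω) (S : M.Sides G) {μ : M.multSpace G}
    (h : ∀ v ∈ M.dispSpaceZero G, contact S μ v = 0) : μ = 0 := by
  classical
  ext1 σ
  set v : M.Dofs := (0, 0, fun K τ => if K = S.plus σ ∧ τ.1 = σ.1 then μ σ else 0, 0) with hv
  have hface : ∀ (K : M.cells) (τ : M.facesOf K),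
      Dofs.face v K τ = if K = S.plus σ ∧ τ.1 = σ.1 then μ σ else 0 := fun _ _ => rfl
  have hmem : v ∈ M.dispSpaceZero G := by
    refine ⟨⟨fun _ _ _ _ _ _ => rfl, fun _ _ _ _ _ _ => rfl, fun K L τ hK hL hs => ?_⟩,
      fun _ _ _ => rfl, fun _ _ _ => rfl, fun K τ hτ => ?_⟩
    · rw [hface, hface]
      by_cases hτ : τ = σ.1
      · subst hτ
        obtain rfl := eq_of_sameSide hs
        rfl
      · simp only [hτ, and_false, if_false]
    · rw [hface, if_neg]
      rintro ⟨-, hτσ⟩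
      obtain ⟨x, hx⟩ := (M.isFlat_face τ.1).nonempty
      have hxΩ : x ∈ Ω := (σ.2 (hτσ ▸ hx)).2
      exact (hτ hx).2 ((isOpen_domain hΩ).interior_eq.symm ▸ hxΩ)
  have h0 := h v hmem
  rw [contact_eq_sum, Finset.sum_eq_single σ] at h0
  · rw [hface, hface, if_pos ⟨rfl, rfl⟩, if_neg fun h => S.plus_ne_minus σ h.1.symm, sub_zero] at h0
    exact dot_self_eq_zero.1
      ((mul_eq_zero.1 h0).resolve_left (M.isFlat_face σ.1).measureReal_pos.ne')
  · intro τ _ hτ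
    have hne : τ.1 ≠ σ.1 := fun h => hτ (Subtype.ext h)
    rw [hface, hface, if_neg fun h => hne h.2, if_neg fun h => hne h.2, sub_zero, dot_zero_right,
      mul_zero]
  · exact fun hσ => absurd (Finset.mem_univ σ) hσ

theorem normalPart_add_smul (S : M.Sides G) (μ κ : M.multSpace G) (r s : ℝ) (σ : M.fracFaces G) :
    normalPart S (r • μ + s • κ) σ = r * normalPart S μ σ + s * normalPart S κ σ := by
  simp only [normalPart, Pi.add_apply, Pi.smul_apply, dot_add_left, dot_smul_left]

theorem tangentPart_add_smul (S : M.Sides G) (μ κ : M.multSpace G) (r s : ℝ) (σ : M.fracFaces G) :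
    tangentPart S (r • μ + s • κ) σ = r • tangentPart S μ σ + s • tangentPart S κ σ := by
  simp only [tangentPart, normalPart_add_smul, Pi.add_apply, Pi.smul_apply]
  module

theorem continuous_normalPart (S : M.Sides G) (σ : M.fracFaces G) :
    Continuous fun μ : M.multSpace G => normalPart S μ σ :=
  (continuous_apply σ).dot continuous_const

theorem continuous_tangentPart (S : M.Sides G) (σ : M.fracFaces G) :
    Continuous fun μ : M.multSpace G => tangentPart S μ σ :=
  (continuous_apply σ).sub ((continuous_normalPart S σ).smul continuous_const)

theorem isClosed_dualCone (S : M.Sides G) (g : M.fracFaces G → ℝ) : IsClosed (dualCone S g) := by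
  have : dualCone S g = ⋂ σ, {μ | 0 ≤ normalPart S μ σ} ∩ {μ | ‖tangentPart S μ σ‖ ≤ g σ} := by
    ext μ; simp [dualCone]
  rw [this]
  exact isClosed_iInter fun σ => (isClosed_le continuous_const (continuous_normalPart S σ)).inter
    (isClosed_le (continuous_tangentPart S σ).norm continuous_const)

theorem convex_dualCone (S : M.Sides G) (g : M.fracFaces G → ℝ) : Convex ℝ (dualCone S g) := by
  intro μ hμ κ hκ r s hr hs hrs σ
  rw [normalPart_add_smul, tangentPart_add_smul]
  refine ⟨add_nonneg (mul_nonneg hr (hμ σ).1) (mul_nonneg hs (hκ σ).1), ?_⟩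
  calc _ ≤ r * ‖tangentPart S μ σ‖ + s * ‖tangentPart S κ σ‖ := by
        refine (norm_add_le _ _).trans_eq ?_
        rw [norm_smul, norm_smul, Real.norm_of_nonneg hr, Real.norm_of_nonneg hs]
    _ ≤ r * g σ + s * g σ :=
        add_le_add (mul_le_mul_of_nonneg_left (hμ σ).2 hr) (mul_le_mul_of_nonneg_left (hκ σ).2 hs)
    _ = g σ := by rw [← add_mul, hrs, one_mul]

theorem zero_mem_dualCone (S : M.Sides G) {g : M.fracFaces G → ℝ} (hg : ∀ σ, 0 ≤ g σ) :
    0 ∈ dualCone S g := fun σ => by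
  simpa [tangentPart, normalPart, dot_zero_left] using hg σ

/-! ### The forms of the scheme as linear maps -/

/-- A map with `φ (v + c • w) = φ v + c * φ w` is linear. -/
def linearMapOfAddSMul {V : Type*} [AddCommGroup V] [Module ℝ V] (φ : V → ℝ)
    (h : ∀ v w (c : ℝ), φ (v + c • w) = φ v + c * φ w) : V →ₗ[ℝ] ℝ :=
  have h0 : φ 0 = 0 := by simpa using h 0 0 1
  { toFun := φ
    map_add' := fun v w => by simpa using h v w 1
    map_smul' := fun c v => by simpa [h0] using h 0 v c }

/-- The bilinear map given by a function that is linear in both arguments. -/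
def bilinOfAddSMul {V W : Type*} [AddCommGroup V] [Module ℝ V] [AddCommGroup W] [Module ℝ W]
    (φ : W → V → ℝ) (hl : ∀ μ κ (c : ℝ) v, φ (μ + c • κ) v = φ μ v + c * φ κ v)
    (hr : ∀ μ v w (c : ℝ), φ μ (v + c • w) = φ μ v + c * φ μ w) : W →ₗ[ℝ] V →ₗ[ℝ] ℝ where
  toFun μ := linearMapOfAddSMul (φ μ) (hr μ)
  map_add' μ κ := LinearMap.ext fun v =>
    (linearMapOfAddSMul (fun μ => φ μ v) fun μ κ c => hl μ κ c v).map_add μ κ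
  map_smul' c μ := LinearMap.ext fun v =>
    (linearMapOfAddSMul (fun μ => φ μ v) fun μ κ c => hl μ κ c v).map_smul c μ

/-- The symmetric bilinear form of the scheme on the displacements. -/
def energyForm (E ν μ₁ : ℝ) : M.Dofs →ₗ[ℝ] M.Dofs →ₗ[ℝ] ℝ :=
  bilinOfAddSMul (fun u v => elastic E ν u v + μ₁ * stab u v)
    (fun u w c v => by
      rw [elastic_comm, stab_comm, elastic_add_smul, stab_add_smul, elastic_comm E ν v,
        elastic_comm E ν v, stab_comm v, stab_comm v]
      ring)
    (fun u v w c => by rw [elastic_add_smul, stab_add_smul]; ring)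

theorem energyForm_apply (E ν μ₁ : ℝ) (u v : M.Dofs) :
    energyForm E ν μ₁ u v = elastic E ν u v + μ₁ * stab u v := rfl

/-- The contact form as a bilinear map. -/
def contactForm (S : M.Sides G) : M.multSpace G →ₗ[ℝ] M.Dofs →ₗ[ℝ] ℝ :=
  bilinOfAddSMul (contact S) (contact_add_smul_left S) (contact_add_smul_right S)

theorem contactForm_apply (S : M.Sides G) (μ : M.multSpace G) (v : M.Dofs) :
    contactForm S μ v = contact S μ v := rfl

/-- The load as a linear form. -/
def loadForm (hΩ : IsPolyhedron Ω) {f : R3 → R3} (hf : MemLp f 2 (volume.restrict Ω)) :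
    M.Dofs →ₗ[ℝ] ℝ :=
  linearMapOfAddSMul (load f) (load_add_smul hΩ hf)

theorem loadForm_apply (hΩ : IsPolyhedron Ω) {f : R3 → R3} (hf : MemLp f 2 (volume.restrict Ω))
    (v : M.Dofs) : loadForm hΩ hf v = load f v := rfl

end PolyMesh

end DDR

end

/-! ### Existence and uniqueness of the discrete solution -/

theorem mainTheorem3 (Ω : Set DDR.R3) (hΩ : DDR.IsPolyhedron Ω)
    {ι : Type*} [Finite ι] (Γ : ι → Set DDR.R3) (hΓ : DDR.IsFractureNetwork Ω Γ)
    (hdisc : DDR.NotDisconnecting Ω (DDR.network Γ))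
    (M : DDR.PolyMesh Ω) (hM : M.Compliant (DDR.network Γ)) (S : M.Sides (DDR.network Γ))
    (E ν μ₁ μ₂ : ℝ) (hμ₁ : 0 < μ₁) (hν : -1 < ν) (hν' : ν < 1 / 2)
    (hE : E / (1 + ν) ∈ Set.Icc μ₁ μ₂)
    (f : DDR.R3 → DDR.R3)
    (hf : MeasureTheory.MemLp f 2 (MeasureTheory.volume.restrict Ω))
    (g : M.fracFaces (DDR.network Γ) → ℝ) (hg : ∀ σ, 0 ≤ g σ) :
    ∃! p : M.dispSpaceZero (DDR.network Γ) × DDR.PolyMesh.dualCone S g,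
      DDR.PolyMesh.IsSolution S E ν μ₁ f g p.1 p.2 := by
  set V := M.dispSpaceZero (DDR.network Γ)
  have key := DDR.existsUnique_saddlePoint
    ((DDR.PolyMesh.energyForm E ν μ₁).domRestrict₁₂ V V)
    ((DDR.PolyMesh.contactForm S).compl₂ V.subtype)
    (DDR.PolyMesh.loadForm hΩ hf ∘ₗ V.subtype)
    (fun u v => by
      simp only [LinearMap.domRestrict₁₂_apply, DDR.PolyMesh.energyForm_apply]
      rw [DDR.PolyMesh.elastic_comm, DDR.PolyMesh.stab_comm])
    (fun u hu => DDR.PolyMesh.elastic_add_stab_pos hΩ hM hdisc hν hν' (hμ₁.trans_le hE.1) hμ₁ u.2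
      fun h => hu (Subtype.ext h))
    (fun μ h => DDR.PolyMesh.eq_zero_of_contact hΩ S fun v hv => h ⟨v, hv⟩)
    ⟨0, DDR.PolyMesh.zero_mem_dualCone S hg⟩ (DDR.PolyMesh.isClosed_dualCone S g)
    (DDR.PolyMesh.convex_dualCone S g)
  simp only [LinearMap.domRestrict₁₂_apply, DDR.PolyMesh.energyForm_apply, LinearMap.compl₂_apply,
    DDR.PolyMesh.contactForm_apply, LinearMap.comp_apply, DDR.PolyMesh.loadForm_apply,
    Submodule.subtype_apply] at key
  exact key
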